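/- Let $(A,\alpha,\mathcal L)$ be an Exel system, i.e. $A$ is a $C^*$-algebra, $\alpha:A\to A$ is a $*$-endomorphism and $\mathcal L:A\to A$ is a positive linear map with $\mathcal L(a\alpha(b))=\mathcal L(a)b$ for all $a,b\in A$. Write $\overline{\,\cdot\,}$ for closed linear spans, $N_{\mathcal L}=\{a\in A:\mathcal L((ab)^*ab)=0\text{ for all }b\in A\}$, and $I^{\perp}=\{a\in A: aI=0\}$. **Crossed products.** A representation of $(A,\mathcal L)$ is a pair $(\pi,S)$ of a non-degenerate representation $\pi:A\to B(H)$ on a Hilbert space and $S\in B(H)$ with $S^*\pi(a)S=\pi(\mathcal L(a))$ for all $a\in A$; it is a representation of $(A,\alpha,\mathcal L)$ if moreover $S\pi(a)=\pi(\alpha(a))S$ for all $a\in A$. A redundancy of $(\pi,S)$ is a pair $(\pi(a),k)$ with $a\in A$, $\pi(a)\pi(b)S=k\pi(b)S$ for all $b\in A$, and $k\in\overline{\pi(A)S\pi(A)S^*\pi(A)}$ (for representations of $(A,\mathcal L)$), respectively $k\in\overline{\pi(A)SS^*\pi(A)}$ (for representations of $(A,\alpha,\mathcal L)$). Let $(i_A,t)$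 be the universal representation of $(A,\mathcal L)$, respectively of $(A,\alpha,\mathcal L)$; the Toeplitz algebra $\mathcal T(A,\mathcal L)$, respectively $\mathcal T(A,\alpha,\mathcal L)$, is the $C^*$-algebra generated by $i_A(A)\cup i_A(A)t$. The crossed product $C^*(A,\mathcal L)$ is the quotient of $\mathcal T(A,\mathcal L)$ by the closed ideal generated by all $i_A(a)-k$ with $a\in N_{\mathcal L}^{\perp}$ and $(i_A(a),k)$ a redundancy of $(i_A,t)$. Exel's crossed product $A\times_{\alpha,\mathcal L}\mathbb N$ is the quotient of $\mathcal T(A,\alpha,\mathcal L)$ by the closed ideal generated by all $i_A(a)-k$ with $a\in\overline{A\alpha(A)A}$ and $(i_A(a),k)$ a redundancy of $(i_A,t)$. **Cuntz–Pimsner algebra.** $M_{\mathcal L}$ is the $C^*$-correspondence over $A$ obtained as the Hausdorff completion of $A$ with $\langle m,n\rangle=\mathcal L(m^*n)$, $m\cdot a=m\alpha(a)$, $a\cdot m=am$; $q:A\to M_{\mathcal L}$ is the canonical map and $\phi$ is the left action. For a $C^*$-correspondence $X$ over $A$, $\mathcal O_X$ is the $C^*$-algebra generated by the universal one among the non-degenerate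 representations $(\pi,\pi_X)$ of $X$ that satisfy $(\pi,\pi_X)^{(1)}(\phi(a))=\pi(a)$ for all $a\in(\ker\phi)^{\perp}\cap\phi^{-1}(\mathcal K(X))$, where $(\pi,\pi_X)^{(1)}:\mathcal K(X)\to B(H)$ is the homomorphism with $\Theta_{x,y}\mapsto\pi_X(x)\pi_X(y)^*$ and $\Theta_{x,y}(z)=x\langle y,z\rangle$. **Proposition.** Suppose that one of the following conditions holds: (i) $\mathcal L$ is almost faithful on $A$ (that is, $N_{\mathcal L}=\{0\}$) and $\alpha$ is non-degenerate (that is, $\overline{\alpha(A)A}=A$); (ii) $\mathcal L$ is faithful (that is, $\mathcal L(a^*a)=0$ implies $a=0$) and $\alpha$ is extendible (that is, $\alpha$ extends to a strictly continuous map $M(A)\to M(A)$ on the multiplier algebra). Then $$A\times_{\alpha,\mathcal L}\mathbb N=C^*(A,\mathcal L)\cong\mathcal O_{M_{\mathcal L}}.$$ Here the equality means that there is a $*$-isomorphism which maps the classes of $i_A(a)$ and $i_A(a)t$ in $A\times_{\alpha,\mathcal L}\mathbb N$ to the classes of $i_A(a)$ and $i_A(a)t$ in $C^*(A,\mathcal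 L)$, for all $a\in A$, and the second isomorphism is the natural one: it maps the classes of $i_A(a)$ and $i_A(a)t$ in $C^*(A,\mathcal L)$ to the canonical images of $a$ and $q(a)$ in $\mathcal O_{M_{\mathcal L}}$, for all $a\in A$. -/

import Mathlib

open scoped ENNReal

universe u v

noncomputable section

namespace ExelCrossed

/-! ### Quotients of C⋆-algebras by closed two-sided ideals -/

section Ideals

variable (B : Type v) [NonUnitalCStarAlgebra B]

/-- A closed two-sided ideal of a C⋆-algebra. (Closed two-sided ideals of C⋆-algebras are
automatically self-adjoint, so the field `star_mem` is no restriction.) -/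
structure ClosedIdeal extends Submodule ℂ B where
  isClosed : IsClosed (carrier : Set B)
  mul_mem_left : ∀ (b : B) {x : B}, x ∈ carrier → b * x ∈ carrier
  mul_mem_right : ∀ {x : B} (b : B), x ∈ carrier → x * b ∈ carrier
  star_mem : ∀ {x : B}, x ∈ carrier → star x ∈ carrier

variable {B}

/-- The closed two-sided ideal generated by a set: the intersection of all closed two-sided ideals
containing it. -/
def ClosedIdeal.generatedBy (s : Set B) : ClosedIdeal B where
  carrier := {x | ∀ I : ClosedIdeal B, s ⊆ I.carrier → x ∈ I.carrier}
  add_mem' hx hy I hI := I.add_mem' (hx I hI) (hy I hI)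
  zero_mem' I _ := I.zero_mem'
  smul_mem' c _ hx I hI := I.smul_mem' c (hx I hI)
  isClosed := by
    have : {x | ∀ I : ClosedIdeal B, s ⊆ I.carrier → x ∈ I.carrier}
        = ⋂ I : ClosedIdeal B, ⋂ _ : s ⊆ I.carrier, I.carrier := by
      ext x; simp
    rw [this]
    exact isClosed_iInter fun I => isClosed_iInter fun _ => I.isClosed
  mul_mem_left b _ hx I hI := I.mul_mem_left b (hx I hI)
  mul_mem_right b hx I hI := I.mul_mem_right b (hx I hI)
  star_mem hx I hI := I.star_mem (hx I hI)

/-- The quotient C⋆-algebra `B / I` as a ⋆-algebra (⋆-isomorphisms of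
C⋆-algebras are automatically isometric, so the quotient norm need not be recorded). -/
def ClosedIdeal.Quotient (I : ClosedIdeal B) : Type v := B ⧸ I.toSubmodule

namespace ClosedIdeal

variable (I : ClosedIdeal B)

instance : AddCommGroup I.Quotient := inferInstanceAs (AddCommGroup (B ⧸ I.toSubmodule))
instance : Module ℂ I.Quotient := inferInstanceAs (Module ℂ (B ⧸ I.toSubmodule))

/-- The quotient map. -/
def proj : B →ₗ[ℂ] I.Quotient := I.toSubmodule.mkQ

lemma proj_surjective : Function.Surjective I.proj := I.toSubmodule.mkQ_surjective

lemma proj_eq_proj {x y : B} : I.proj x = I.proj y ↔ x - y ∈ I.carrier :=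
  Submodule.Quotient.eq I.toSubmodule

instance : Mul I.Quotient where
  mul := Quotient.map₂ (· * ·) (by
    intro x₁ x₂ hx y₁ y₂ hy
    rw [← Quotient.eq_iff_equiv] at *
    have hx' := I.proj_eq_proj.1 hx
    have hy' := I.proj_eq_proj.1 hy
    refine I.proj_eq_proj.2 ?_
    have : x₁ * y₁ - x₂ * y₂ = (x₁ - x₂) * y₁ + x₂ * (y₁ - y₂) := by
      rw [sub_mul, mul_sub]; abel
    rw [this]
    exact I.add_mem' (I.mul_mem_right _ hx') (I.mul_mem_left _ hy'))

instance : Star I.Quotient where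
  star := Quotient.map star (by
    intro x₁ x₂ hx
    rw [← Quotient.eq_iff_equiv] at *
    have hx' := I.proj_eq_proj.1 hx
    refine I.proj_eq_proj.2 ?_
    rw [← star_sub]
    exact I.star_mem hx')

@[simp] lemma proj_mul (x y : B) : I.proj (x * y) = I.proj x * I.proj y := rfl
@[simp] lemma proj_star (x : B) : I.proj (star x) = star (I.proj x) := rfl

instance : NonUnitalRing I.Quotient where
  left_distrib := by
    intro a b c
    obtain ⟨a, rfl⟩ := I.proj_surjective a
    obtain ⟨b, rfl⟩ := I.proj_surjective b
    obtain ⟨c, rfl⟩ := I.proj_surjective c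
    simp only [← proj_mul, ← map_add, mul_add]
  right_distrib := by
    intro a b c
    obtain ⟨a, rfl⟩ := I.proj_surjective a
    obtain ⟨b, rfl⟩ := I.proj_surjective b
    obtain ⟨c, rfl⟩ := I.proj_surjective c
    simp only [← proj_mul, ← map_add, add_mul]
  zero_mul := by
    intro a
    obtain ⟨a, rfl⟩ := I.proj_surjective a
    rw [← map_zero I.proj, ← proj_mul, zero_mul]
  mul_zero := by
    intro a
    obtain ⟨a, rfl⟩ := I.proj_surjective a
    rw [← map_zero I.proj, ← proj_mul, mul_zero]
  mul_assoc := by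
    intro a b c
    obtain ⟨a, rfl⟩ := I.proj_surjective a
    obtain ⟨b, rfl⟩ := I.proj_surjective b
    obtain ⟨c, rfl⟩ := I.proj_surjective c
    simp only [← proj_mul, mul_assoc]

instance : StarRing I.Quotient where
  star_involutive := by
    intro a
    obtain ⟨a, rfl⟩ := I.proj_surjective a
    simp only [← proj_star, star_star]
  star_mul := by
    intro a b
    obtain ⟨a, rfl⟩ := I.proj_surjective a
    obtain ⟨b, rfl⟩ := I.proj_surjective b
    simp only [← proj_star, ← proj_mul, star_mul]
  star_add := by
    intro a b
    obtain ⟨a, rfl⟩ := I.proj_surjective a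
    obtain ⟨b, rfl⟩ := I.proj_surjective b
    simp only [← proj_star, ← map_add, star_add]

end ClosedIdeal

end Ideals

/-! ### Positive maps, Exel systems, and the conditions on them -/

section Systems

variable {A : Type u} [NonUnitalCStarAlgebra A]

/-- The strict topology on the multiplier algebra `M(A)`: the coarsest topology for which all the
maps `m ↦ m a` and `m ↦ a m`, with `a` in `A`, are continuous into `A` with its norm. -/
@[reducible]
def strictTopology (A : Type u) [NonUnitalCStarAlgebra A] :
    TopologicalSpace (DoubleCentralizer ℂ A) :=
  TopologicalSpace.induced
    (fun m => ((fun a => m.fst a, fun a => m.snd a) : (A → A) × (A → A))) inferInstance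

/-- `α` extends to a strictly continuous map `M(A) → M(A)`. -/
def Extendible (α : A →⋆ₙₐ[ℂ] A) : Prop :=
  ∃ β : DoubleCentralizer ℂ A → DoubleCentralizer ℂ A,
    (@Continuous _ _ (strictTopology A) (strictTopology A) β) ∧
      ∀ a : A, β (DoubleCentralizer.coe ℂ a) = DoubleCentralizer.coe ℂ (α a)

/-- `α(A)A = A`, where `α(A)A` is the closed linear span of the products `α(a) b`. -/
def Nondegenerate (α : A →⋆ₙₐ[ℂ] A) : Prop :=
  (Submodule.span ℂ {x : A | ∃ a b : A, x = α a * b}).topologicalClosure = ⊤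

variable [PartialOrder A] [StarOrderedRing A]

/-- Faithfulness (on `A`) of a positive map. -/
def Faithful (L : A →ₚ[ℂ] A) : Prop := ∀ a : A, L (star a * a) = 0 → a = 0

/-- The GNS-kernel `N_L`. -/
def gnsKernel (L : A →ₚ[ℂ] A) : Set A := {a | ∀ b : A, L (star (a * b) * (a * b)) = 0}

/-- Almost faithfulness (on `A`) of a positive map. -/
def AlmostFaithful (L : A →ₚ[ℂ] A) : Prop :=
  ∀ a : A, (∀ b : A, L (star (a * b) * (a * b)) = 0) → a = 0

/-- The annihilator `I^⊥ = {a : a I = 0}`. -/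
def annihilator (I : Set A) : Set A := {a | ∀ n ∈ I, a * n = 0}

/-- An Exel system `(A, α, L)`: an endomorphism `α` of `A` and a transfer operator `L` for it. -/
structure ExelSystem (A : Type u) [NonUnitalCStarAlgebra A] [PartialOrder A]
    [StarOrderedRing A] where
  α : A →⋆ₙₐ[ℂ] A
  L : A →ₚ[ℂ] A
  transfer : ∀ a b : A, L (a * α b) = L a * b

/-- The ideal `closure (A α(A) A)`. -/
def ExelSystem.rangeIdeal (E : ExelSystem A) : Set A :=
  (Submodule.span ℂ {x : A | ∃ a b c : A, x = a * E.α b * c}).topologicalClosure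

end Systems

/-! ### Representations of `(A, L)` and of `(A, α, L)`, Toeplitz algebras, crossed products -/

section Representations

variable {A : Type u} [NonUnitalCStarAlgebra A] [PartialOrder A] [StarOrderedRing A]

/-- A representation `(π, S)` of `(A, L)` on a Hilbert space: a non-degenerate representation `π`
and an operator `S` with `S* π(a) S = π(L(a))`. -/
structure CPRep (L : A →ₚ[ℂ] A) where
  H : Type u
  [normedAddCommGroup : NormedAddCommGroup H]
  [innerProductSpace : InnerProductSpace ℂ H]
  [completeSpace : CompleteSpace H]
  π : A →⋆ₙₐ[ℂ] (H →L[ℂ] H)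
  nondegenerate : (Submodule.span ℂ {x : H | ∃ a h, x = π a h}).topologicalClosure = ⊤
  S : H →L[ℂ] H
  star_mul_mul : ∀ a : A, star S * π a * S = π (L a)

attribute [instance] CPRep.normedAddCommGroup CPRep.innerProductSpace CPRep.completeSpace

/-- A representation `(π, S)` of the Exel system `(A, α, L)`. -/
structure ExelRep (E : ExelSystem A) extends CPRep E.L where
  mul_eq : ∀ a : A, S * π a = π (E.α a) * S

lemma norm_le_of_nondegenerate {H : Type u} [NormedAddCommGroup H] [InnerProductSpace ℂ H]
    [CompleteSpace H] (π : A →⋆ₙₐ[ℂ] (H →L[ℂ] H))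
    (hπ : (Submodule.span ℂ {x : H | ∃ a h, x = π a h}).topologicalClosure = ⊤)
    (x : H) (M : ℝ) (hM : ∀ a : A, ‖a‖ ≤ 1 → ‖π a x‖ ≤ M) : ‖x‖ ≤ M := by
  have hl := CStarAlgebra.increasingApproximateUnit A
  have hspan : ∀ y ∈ Submodule.span ℂ {x : H | ∃ a h, x = π a h},
      Filter.Tendsto (fun e : A => π e y) (CStarAlgebra.approximateUnit A) (nhds y) := by
    intro y hy
    induction hy using Submodule.span_induction with
    | mem y hy =>
      obtain ⟨a, h, rfl⟩ := hy
      have h1 : Filter.Tendsto (fun e : A => e * a) (CStarAlgebra.approximateUnit A) (nhds a) :=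
        hl.tendsto_mul_right a
      have hc : Continuous fun b : A => π b h :=
        ((ContinuousLinearMap.apply ℂ H h).continuous).comp (map_continuous π)
      have h2 := (hc.tendsto a).comp h1
      simpa [Function.comp_def, map_mul] using h2
    | zero => simp
    | add y z _ _ hy hz => simpa using hy.add hz
    | smul c y _ hy => simpa using hy.const_smul c
  refine le_of_forall_pos_le_add fun ε hε => ?_
  have hx : x ∈ closure ((Submodule.span ℂ {x : H | ∃ a h, x = π a h} : Submodule ℂ H) : Set H) := by
    have : x ∈ (Submodule.span ℂ {x : H | ∃ a h, x = π a h}).topologicalClosure := by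
      rw [hπ]; trivial
    exact this
  obtain ⟨y, hy, hxy⟩ := Metric.mem_closure_iff.1 hx (ε / 3) (by positivity)
  have h1 : ∀ᶠ e in CStarAlgebra.approximateUnit A, dist (π e y) y < ε / 3 :=
    (Metric.tendsto_nhds.1 (hspan y hy)) _ (by positivity)
  have h2 : ∀ᶠ e in CStarAlgebra.approximateUnit A, ‖e‖ ≤ 1 := hl.eventually_norm
  obtain ⟨e, he1, he2⟩ := (h1.and h2).exists
  have hπe : ‖π e‖ ≤ 1 := (NonUnitalStarAlgHom.norm_apply_le π e).trans he2
  have e1 : x = (x - y) + (y - π e y) + π e (y - x) + π e x := by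
    rw [map_sub]; abel
  have e2 : ‖π e (y - x)‖ ≤ ‖x - y‖ := by
    calc ‖π e (y - x)‖ ≤ ‖π e‖ * ‖y - x‖ := (π e).le_opNorm _
      _ ≤ 1 * ‖y - x‖ := by gcongr
      _ = ‖x - y‖ := by rw [one_mul, norm_sub_rev]
  have e3 : ‖x - y‖ < ε / 3 := by rwa [← dist_eq_norm]
  have e4 : ‖y - π e y‖ < ε / 3 := by rwa [norm_sub_rev, ← dist_eq_norm]
  calc ‖x‖ = ‖(x - y) + (y - π e y) + π e (y - x) + π e x‖ := by rw [← e1]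
    _ ≤ ‖x - y‖ + ‖y - π e y‖ + ‖π e (y - x)‖ + ‖π e x‖ := norm_add₄_le
    _ ≤ M + ε := by linarith [hM e he2]

lemma CPRep.exists_norm_S_le (L : A →ₚ[ℂ] A) : ∃ M : ℝ, ∀ ρ : CPRep L, ‖ρ.S‖ ≤ M := by
  obtain ⟨C, hC⟩ := L.exists_norm_apply_le
  refine ⟨√C, fun ρ => ?_⟩
  refine ContinuousLinearMap.opNorm_le_bound _ (by positivity) fun h => ?_
  refine norm_le_of_nondegenerate ρ.π ρ.nondegenerate _ _ fun a ha => ?_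
  have h1 : ‖ρ.π a * ρ.S‖ ≤ √C := by
    refine Real.le_sqrt_of_sq_le ?_
    rw [sq, ← CStarRing.norm_star_mul_self]
    have : star (ρ.π a * ρ.S) * (ρ.π a * ρ.S) = ρ.π (L (star a * a)) := by
      rw [← ρ.star_mul_mul, map_mul, map_star, star_mul]
      simp only [mul_assoc]
    rw [this]
    calc ‖ρ.π (L (star a * a))‖ ≤ ‖L (star a * a)‖ := NonUnitalStarAlgHom.norm_apply_le _ _
      _ ≤ C * ‖star a * a‖ := hC _
      _ = C * (‖a‖ * ‖a‖) := by rw [CStarRing.norm_star_mul_self]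
      _ ≤ C * (1 * 1) := by gcongr
      _ = C := by ring
  calc ‖ρ.π a (ρ.S h)‖ = ‖(ρ.π a * ρ.S) h‖ := rfl
    _ ≤ ‖ρ.π a * ρ.S‖ * ‖h‖ := ContinuousLinearMap.le_opNorm _ _
    _ ≤ √C * ‖h‖ := by gcongr

section Prod

variable {ι : Type v} (H : ι → Type u) [∀ i, NormedAddCommGroup (H i)]
  [∀ i, InnerProductSpace ℂ (H i)] [∀ i, CompleteSpace (H i)]

/-- The C⋆-algebra `∏ B(H_i)` of bounded families of operators, which acts faithfully on the
Hilbert space direct sum of the `H_i`. -/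
def BoundedProd : Type (max u v) := lp (fun i => H i →L[ℂ] H i) ∞

instance : NonUnitalCStarAlgebra (BoundedProd H) :=
  inferInstanceAs (NonUnitalCStarAlgebra (lp (fun i => H i →L[ℂ] H i) ∞))

variable {H}

/-- A bounded family of operators as an element of `∏ B(H_i)`. -/
def BoundedProd.ofBounded (T : ∀ i, H i →L[ℂ] H i) (hT : ∃ C : ℝ, ∀ i, ‖T i‖ ≤ C) :
    BoundedProd H :=
  (⟨T, memℓp_infty (by
    obtain ⟨C, hC⟩ := hT
    exact ⟨C, by rintro _ ⟨i, rfl⟩; exact hC i⟩)⟩ : lp (fun i => H i →L[ℂ] H i) ∞)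

/-- The coordinate homomorphisms `∏ B(H_i) → B(H_i)`. -/
def BoundedProd.eval (i : ι) : BoundedProd H →⋆ₙₐ[ℂ] (H i →L[ℂ] H i) where
  toFun x := (show lp (fun i => H i →L[ℂ] H i) ∞ from x) i
  map_smul' _ _ := rfl
  map_zero' := rfl
  map_add' _ _ := rfl
  map_mul' _ _ := rfl
  map_star' _ := rfl

@[simp] lemma BoundedProd.eval_ofBounded (T : ∀ i, H i →L[ℂ] H i) (hT) (i : ι) :
    BoundedProd.eval i (BoundedProd.ofBounded T hT) = T i := rfl

lemma BoundedProd.ext {x y : BoundedProd H}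
    (h : ∀ i, BoundedProd.eval i x = BoundedProd.eval i y) : x = y :=
  lp.ext (E := fun i => H i →L[ℂ] H i) (funext h)

/-- The direct product of a family of representations of a C⋆-algebra. -/
def prodHom {A : Type u} [NonUnitalCStarAlgebra A]
    (π : ∀ i, A →⋆ₙₐ[ℂ] (H i →L[ℂ] H i)) : A →⋆ₙₐ[ℂ] BoundedProd H where
  toFun a := BoundedProd.ofBounded (fun i => π i a)
    ⟨‖a‖, fun i => NonUnitalStarAlgHom.norm_apply_le (π i) a⟩
  map_smul' c a := BoundedProd.ext fun i => by simp
  map_zero' := BoundedProd.ext fun i => by simp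
  map_add' a b := BoundedProd.ext fun i => by simp
  map_mul' a b := BoundedProd.ext fun i => by simp
  map_star' a := BoundedProd.ext fun i => by simp [map_star]

end Prod

/-- For a family of representations `(π_i, S_i)` of `(A, L)`, the operator `(S_i)_i`. -/
def prodS {L : A →ₚ[ℂ] A} {ι : Type v} (ρ : ι → CPRep L) : BoundedProd fun i => (ρ i).H :=
  BoundedProd.ofBounded (fun i => (ρ i).S)
    ⟨(CPRep.exists_norm_S_le L).choose, fun i => (CPRep.exists_norm_S_le L).choose_spec (ρ i)⟩

/-- The C⋆-subalgebra `C*(s)` generated by a set `s`. -/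
def cstarGenerated {B : Type v} [NonUnitalCStarAlgebra B] (s : Set B) :
    NonUnitalStarSubalgebra ℂ B :=
  (NonUnitalStarAlgebra.adjoin ℂ s).topologicalClosure

instance {B : Type v} [NonUnitalCStarAlgebra B] (s : Set B) :
    NonUnitalCStarAlgebra (cstarGenerated s) :=
  NonUnitalStarSubalgebra.nonUnitalCStarAlgebra (cstarGenerated s)
    (h_closed := NonUnitalStarSubalgebra.isClosed_topologicalClosure _)

lemma mem_cstarGenerated {B : Type v} [NonUnitalCStarAlgebra B] {s : Set B} {x : B} (hx : x ∈ s) :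
    x ∈ cstarGenerated s :=
  NonUnitalStarSubalgebra.le_topologicalClosure _ (NonUnitalStarAlgebra.subset_adjoin ℂ _ hx)

section Pairs

variable {A : Type u} [NonUnitalCStarAlgebra A] {B : Type v} [NonUnitalCStarAlgebra B]
  (π : A →⋆ₙₐ[ℂ] B) (S : B)

/-- `C*(π, S)`: the C⋆-algebra generated by `π(A) ∪ π(A) S`. -/
abbrev pairAlgebra : NonUnitalStarSubalgebra ℂ B :=
  cstarGenerated (Set.range π ∪ Set.range fun a => π a * S)

lemma mem_pairAlgebra (a : A) : π a ∈ pairAlgebra π S := mem_cstarGenerated (Or.inl ⟨a, rfl⟩)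

lemma mul_mem_pairAlgebra (a : A) : π a * S ∈ pairAlgebra π S :=
  mem_cstarGenerated (Or.inr ⟨a, rfl⟩)

/-- `(π(a), k)` is a redundancy of `(π, S)` regarded as a representation of `(A, L)`: here
`k` lies in the closed linear span of `π(A) S π(A) S* π(A)`. -/
def IsRedundancy (a : A) (k : B) : Prop :=
  k ∈ (Submodule.span ℂ
      {x : B | ∃ b c d : A, x = π b * S * π c * star S * π d}).topologicalClosure ∧
    ∀ b : A, π a * π b * S = k * (π b * S)

/-- `(π(a), k)` is a redundancy of `(π, S)` regarded as a representation of `(A, α, L)`: here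
`k` lies in the closed linear span of `π(A) S S* π(A)`. -/
def IsExelRedundancy (a : A) (k : B) : Prop :=
  k ∈ (Submodule.span ℂ {x : B | ∃ b c : A, x = π b * S * star S * π c}).topologicalClosure ∧
    ∀ b : A, π a * π b * S = k * (π b * S)

end Pairs

/-- The homomorphism `i_A` of the universal representation `(i_A, t)` of `(A, L)`, realised as
the product of all representations of `(A, L)`. -/
def cpUnivπ (L : A →ₚ[ℂ] A) : A →⋆ₙₐ[ℂ] BoundedProd fun ρ : CPRep L => ρ.H :=
  prodHom fun ρ : CPRep L => ρ.π

/-- The operator `t` of the universal representation `(i_A, t)` of `(A, L)`. -/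
def cpUnivS (L : A →ₚ[ℂ] A) : BoundedProd fun ρ : CPRep L => ρ.H := prodS fun ρ : CPRep L => ρ

/-- The Toeplitz algebra `T(A, L)`. -/
abbrev CPToeplitz (L : A →ₚ[ℂ] A) : Type (u + 1) := pairAlgebra (cpUnivπ L) (cpUnivS L)

/-- The closed ideal of `T(A, L)` generated by the `i_A(a) - k`, where `a ∈ J` and `(i_A(a), k)` is
a redundancy. -/
def cpIdeal (L : A →ₚ[ℂ] A) (J : Set A) : ClosedIdeal (CPToeplitz L) :=
  ClosedIdeal.generatedBy {x : CPToeplitz L | ∃ a ∈ J, ∃ k,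
    IsRedundancy (cpUnivπ L) (cpUnivS L) a k ∧ x.1 = cpUnivπ L a - k}

/-- The relative crossed product `C*(A, L; J)`. -/
abbrev RelCrossedProduct (L : A →ₚ[ℂ] A) (J : Set A) : Type (u + 1) := (cpIdeal L J).Quotient

/-- The crossed product `C*(A, L) = C*(A, L; N_L^⊥)`. -/
abbrev CPCrossedProduct (L : A →ₚ[ℂ] A) : Type (u + 1) :=
  RelCrossedProduct L (annihilator (gnsKernel L))

/-- The canonical image `j_A(a)` of `a ∈ A` in `C*(A, L)`. -/
def CPCrossedProduct.j (L : A →ₚ[ℂ] A) (a : A) : CPCrossedProduct L :=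
  (cpIdeal L _).proj ⟨cpUnivπ L a, mem_pairAlgebra _ _ a⟩

/-- The canonical image `j_A(a) s` in `C*(A, L)`. -/
def CPCrossedProduct.js (L : A →ₚ[ℂ] A) (a : A) : CPCrossedProduct L :=
  (cpIdeal L _).proj ⟨cpUnivπ L a * cpUnivS L, mul_mem_pairAlgebra _ _ a⟩

namespace ExelSystem

variable (E : ExelSystem A)

/-- The homomorphism `i_A` of the universal representation `(i_A, t)` of `(A, α, L)`, realised as
the product of all representations of `(A, α, L)`. -/
def univπ : A →⋆ₙₐ[ℂ] BoundedProd fun ρ : ExelRep E => ρ.H := prodHom fun ρ : ExelRep E => ρ.π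

/-- The operator `t` of the universal representation `(i_A, t)` of `(A, α, L)`. -/
def univS : BoundedProd fun ρ : ExelRep E => ρ.H := prodS fun ρ : ExelRep E => ρ.toCPRep

/-- The Toeplitz algebra `T(A, α, L)`. -/
abbrev Toeplitz : Type (u + 1) := pairAlgebra E.univπ E.univS

/-- The closed ideal of `T(A, α, L)` generated by the `i_A(a) - k`, where `a` is in
`closure (A α(A) A)` and `(i_A(a), k)` is a redundancy. -/
def redundancyIdeal : ClosedIdeal E.Toeplitz :=
  ClosedIdeal.generatedBy {x : E.Toeplitz | ∃ a ∈ E.rangeIdeal, ∃ k,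
    IsExelRedundancy E.univπ E.univS a k ∧ x.1 = E.univπ a - k}

/-- Exel's crossed product `A ×_{α,L} ℕ`. -/
abbrev CrossedProduct : Type (u + 1) := E.redundancyIdeal.Quotient

/-- The canonical image of `a ∈ A` in `A ×_{α,L} ℕ`. -/
def j (a : A) : E.CrossedProduct := E.redundancyIdeal.proj ⟨E.univπ a, mem_pairAlgebra _ _ a⟩

/-- The canonical image of `i_A(a) t` in `A ×_{α,L} ℕ`. -/
def js (a : A) : E.CrossedProduct :=
  E.redundancyIdeal.proj ⟨E.univπ a * E.univS, mul_mem_pairAlgebra _ _ a⟩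

end ExelSystem

end Representations

/-! ### C⋆-correspondences and their Cuntz-Pimsner algebras -/

section Correspondences

variable {A : Type u} [NonUnitalCStarAlgebra A] [PartialOrder A] [StarOrderedRing A]

/-- Cauchy-Schwarz for `A`-valued semi-inner products, in the form of a statement about
`p = ⟨x, x⟩`, `q = ⟨y, y⟩` and `a = ⟨x, y⟩`. -/
lemma cauchySchwarz_aux (p q a : A) (hp : 0 ≤ p)
    (h : ∀ t : ℝ, 0 ≤ star a * p * a - (2 * t) • (star a * a) + (t * t) • q) :
    ‖a‖ ^ 2 ≤ ‖p‖ * ‖q‖ := by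
  have key : ∀ t : ℝ, 0 < t → ‖p‖ ≤ t → ‖a‖ ^ 2 ≤ t * ‖q‖ := by
    intro t ht hpt
    have h1 : star a * p * a ≤ t • (star a * a) :=
      (CStarAlgebra.star_left_conjugate_le_norm_smul (IsSelfAdjoint.of_nonneg hp)).trans
        (smul_le_smul_of_nonneg_right hpt (star_mul_self_nonneg a))
    have h2 : t • (star a * a) ≤ (t * t) • q := by
      have h3 := (h t).trans (add_le_add_left (sub_le_sub_right h1 _) _)
      have h4 : t • (star a * a) - (2 * t) • (star a * a) + (t * t) • q
          = (t * t) • q - t • (star a * a) := by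
        rw [two_mul, add_smul]; abel
      rw [h4] at h3
      exact sub_nonneg.1 h3
    have h5 : star a * a ≤ t • q := by
      have h6 := smul_le_smul_of_nonneg_left h2 (inv_nonneg.2 ht.le)
      rwa [smul_smul, smul_smul, inv_mul_cancel₀ ht.ne', one_smul, ← mul_assoc,
        inv_mul_cancel₀ ht.ne', one_mul] at h6
    calc ‖a‖ ^ 2 = ‖star a * a‖ := by rw [CStarRing.norm_star_mul_self, sq]
      _ ≤ ‖t • q‖ := CStarAlgebra.norm_le_norm_of_nonneg_of_le (star_mul_self_nonneg a) h5
      _ = t * ‖q‖ := by rw [norm_smul, Real.norm_of_nonneg ht.le]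
  refine le_of_forall_pos_le_add fun ε hε => ?_
  have hq : 0 < ‖q‖ + 1 := by positivity
  have h1 := key (‖p‖ + ε / (‖q‖ + 1)) (by positivity) (by linarith [div_pos hε hq])
  have h2 : ε / (‖q‖ + 1) * ‖q‖ ≤ ε := by
    rw [div_mul_eq_mul_div, div_le_iff₀ hq]
    nlinarith
  linarith

/-- A (right) C⋆-correspondence over `A`: a right Hilbert `A`-module `X` with a left action `φ`
of `A` by adjointable operators, the adjoint of `φ a` being `φ (star a)`. -/
structure CStarCorrespondence (A : Type u) [NonUnitalCStarAlgebra A] [PartialOrder A]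
    [StarOrderedRing A] (X : Type u) [NormedAddCommGroup X] [NormedSpace ℂ X]
    [CompleteSpace X] where
  rsmul : X → A → X
  inner : X → X → A
  φ : A →ₙₐ[ℂ] (X →L[ℂ] X)
  add_rsmul : ∀ x y a, rsmul (x + y) a = rsmul x a + rsmul y a
  rsmul_add : ∀ x a b, rsmul x (a + b) = rsmul x a + rsmul x b
  smul_rsmul : ∀ (c : ℂ) x a, rsmul (c • x) a = c • rsmul x a
  rsmul_smul : ∀ (c : ℂ) x a, rsmul x (c • a) = c • rsmul x a
  rsmul_mul : ∀ x a b, rsmul x (a * b) = rsmul (rsmul x a) b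
  inner_add_right : ∀ x y z, inner x (y + z) = inner x y + inner x z
  inner_smul_right : ∀ (c : ℂ) x y, inner x (c • y) = c • inner x y
  inner_rsmul_right : ∀ x y a, inner x (rsmul y a) = inner x y * a
  star_inner : ∀ x y, star (inner x y) = inner y x
  inner_self_nonneg : ∀ x, 0 ≤ inner x x
  norm_sq_eq : ∀ x, ‖x‖ ^ 2 = ‖inner x x‖
  φ_adjoint : ∀ a x y, inner (φ a x) y = inner x (φ (star a) y)

namespace CStarCorrespondence

variable {X : Type u} [NormedAddCommGroup X] [NormedSpace ℂ X] [CompleteSpace X]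
  (E : CStarCorrespondence A X)

lemma inner_rsmul_left (x y : X) (a : A) : E.inner (E.rsmul x a) y = star a * E.inner x y := by
  rw [← E.star_inner, E.inner_rsmul_right, star_mul, E.star_inner]

lemma inner_add_left (x y z : X) : E.inner (x + y) z = E.inner x z + E.inner y z := by
  rw [← E.star_inner, E.inner_add_right, star_add, E.star_inner, E.star_inner]

lemma inner_smul_left (c : ℂ) (x y : X) : E.inner (c • x) y = star c • E.inner x y := by
  rw [← E.star_inner, E.inner_smul_right, star_smul, E.star_inner]

lemma norm_inner_le (x y : X) : ‖E.inner x y‖ ≤ ‖x‖ * ‖y‖ := by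
  have h := cauchySchwarz_aux (E.inner x x) (E.inner y y) (E.inner x y) (E.inner_self_nonneg x) (by
    intro t
    have h := E.inner_self_nonneg (E.rsmul x (E.inner x y) + (-(t : ℂ)) • y)
    have e : E.inner (E.rsmul x (E.inner x y) + (-(t : ℂ)) • y)
        (E.rsmul x (E.inner x y) + (-(t : ℂ)) • y) = star (E.inner x y) * E.inner x x * E.inner x y
          - (2 * t) • (star (E.inner x y) * E.inner x y) + (t * t) • E.inner y y := by
      have hs : E.inner y x = star (E.inner x y) := (E.star_inner x y).symm
      have hr : ∀ (r : ℝ) (z : A), (r : ℂ) • z = r • z := fun r z => Complex.coe_smul r z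
      have hn : -(t : ℂ) = ((-t : ℝ) : ℂ) := by simp
      rw [hn]
      simp only [E.inner_add_left, E.inner_add_right, E.inner_smul_left, E.inner_smul_right,
        E.inner_rsmul_left, E.inner_rsmul_right, hs, RCLike.star_def,
        Complex.conj_ofReal, hr, neg_smul, two_mul, add_smul, mul_smul, mul_assoc, smul_neg, neg_neg]
      abel
    rwa [e] at h)
  rw [← E.norm_sq_eq, ← E.norm_sq_eq, ← mul_pow] at h
  exact (sq_le_sq₀ (norm_nonneg _) (by positivity)).1 h

lemma norm_rsmul_le (x : X) (a : A) : ‖E.rsmul x a‖ ≤ ‖x‖ * ‖a‖ := by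
  refine (sq_le_sq₀ (norm_nonneg _) (by positivity)).1 ?_
  rw [E.norm_sq_eq, mul_pow, E.norm_sq_eq, E.inner_rsmul_left, E.inner_rsmul_right, ← mul_assoc]
  calc ‖star a * E.inner x x * a‖ ≤ ‖star a‖ * ‖E.inner x x‖ * ‖a‖ :=
        (norm_mul_le _ _).trans (by gcongr; exact norm_mul_le _ _)
    _ = ‖E.inner x x‖ * ‖a‖ ^ 2 := by rw [norm_star]; ring

/-- The operator `Θ_{x,y} z = x ⟨y, z⟩`. -/
def Θ (x y : X) : X →L[ℂ] X :=
  LinearMap.mkContinuous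
    { toFun := fun z => E.rsmul x (E.inner y z)
      map_add' := fun z w => by rw [E.inner_add_right, E.rsmul_add]
      map_smul' := fun c z => by rw [E.inner_smul_right, E.rsmul_smul]; rfl }
    (‖x‖ * ‖y‖) (fun z => by
      calc ‖E.rsmul x (E.inner y z)‖ ≤ ‖x‖ * ‖E.inner y z‖ := E.norm_rsmul_le _ _
        _ ≤ ‖x‖ * (‖y‖ * ‖z‖) := by gcongr; exact E.norm_inner_le _ _
        _ = ‖x‖ * ‖y‖ * ‖z‖ := by ring)

/-- The generalized compact operators `K(X)`: the closed linear span of the `Θ_{x,y}`. -/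
def compacts : Submodule ℂ (X →L[ℂ] X) :=
  (Submodule.span ℂ {T | ∃ x y, T = E.Θ x y}).topologicalClosure

lemma Θ_mem (x y : X) : E.Θ x y ∈ E.compacts :=
  Submodule.le_topologicalClosure _ (Submodule.subset_span ⟨x, y, rfl⟩)

/-- `J(X) = φ⁻¹(K(X))`. -/
def compactIdeal : Set A := {a | E.φ a ∈ E.compacts}

/-- Katsura's ideal `J_X = (ker φ)^⊥ ∩ J(X)`. -/
def katsuraIdeal : Set A := annihilator {a | E.φ a = 0} ∩ E.compactIdeal

/-- A (non-degenerate) representation `(π, π_X)` of a C⋆-correspondence on a Hilbert space. -/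
structure Rep where
  H : Type u
  [normedAddCommGroup : NormedAddCommGroup H]
  [innerProductSpace : InnerProductSpace ℂ H]
  [completeSpace : CompleteSpace H]
  π : A →⋆ₙₐ[ℂ] (H →L[ℂ] H)
  nondegenerate : (Submodule.span ℂ {x : H | ∃ a h, x = π a h}).topologicalClosure = ⊤
  πX : X →ₗ[ℂ] (H →L[ℂ] H)
  map_bimod : ∀ a x b, πX (E.rsmul (E.φ a x) b) = π a * πX x * π b
  map_inner : ∀ x y, star (πX x) * πX y = π (E.inner x y)

attribute [instance] Rep.normedAddCommGroup Rep.innerProductSpace Rep.completeSpace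

/-- `J`-covariance, for `J ⊆ J(X)`: `(π, π_X)^{(1)} (φ(a)) = π(a)` for all `a ∈ J`. Here
`(π, π_X)^{(1)}` is the unique bounded linear map on `K(X)` which sends each `Θ_{x,y}`
to `π_X(x) π_X(y)*`. -/
def Rep.IsCovariant {E : CStarCorrespondence A X} (ρ : E.Rep) (J : Set A) : Prop :=
  ∃ ψ : E.compacts →L[ℂ] (ρ.H →L[ℂ] ρ.H),
    (∀ x y, ψ ⟨E.Θ x y, E.Θ_mem x y⟩ = ρ.πX x * star (ρ.πX y)) ∧
      ∀ a ∈ J, ∃ h : E.φ a ∈ E.compacts, ψ ⟨E.φ a, h⟩ = ρ.π a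

/-- The `J`-covariant representations of a C⋆-correspondence. -/
def CovRep (J : Set A) : Type (u + 1) := {ρ : E.Rep // ρ.IsCovariant J}

/-- The homomorphism `j_A` of the universal `J`-covariant representation `(j_A, j_X)`, realised as
the product of all `J`-covariant representations. -/
def univA (J : Set A) : A →⋆ₙₐ[ℂ] BoundedProd fun ρ : E.CovRep J => ρ.1.H :=
  prodHom fun ρ : E.CovRep J => ρ.1.π

/-- The linear map `j_X` of the universal `J`-covariant representation `(j_A, j_X)`. -/
def univX (J : Set A) (x : X) : BoundedProd fun ρ : E.CovRep J => ρ.1.H :=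
  BoundedProd.ofBounded (fun ρ => ρ.1.πX x) ⟨‖x‖, fun ρ => by
    refine (sq_le_sq₀ (norm_nonneg _) (norm_nonneg _)).1 ?_
    rw [E.norm_sq_eq, sq, ← CStarRing.norm_star_mul_self, ρ.1.map_inner]
    exact NonUnitalStarAlgHom.norm_apply_le _ _⟩

/-- The relative Cuntz-Pimsner algebra `O(J, X)`: the C⋆-algebra generated by the universal
`J`-covariant representation of `X`. -/
abbrev relCuntzPimsner (J : Set A) :
    NonUnitalStarSubalgebra ℂ (BoundedProd fun ρ : E.CovRep J => ρ.1.H) :=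
  cstarGenerated (Set.range (E.univA J) ∪ Set.range (E.univX J))

/-- The Cuntz-Pimsner algebra `O_X = O(J_X, X)`. -/
abbrev CuntzPimsner : Type (u + 1) := E.relCuntzPimsner E.katsuraIdeal

/-- The canonical image of `a ∈ A` in `O_X`. -/
def CuntzPimsner.jA (a : A) : E.CuntzPimsner :=
  ⟨E.univA _ a, mem_cstarGenerated (Or.inl ⟨a, rfl⟩)⟩

/-- The canonical image of `x ∈ X` in `O_X`. -/
def CuntzPimsner.jX (x : X) : E.CuntzPimsner :=
  ⟨E.univX _ x, mem_cstarGenerated (Or.inr ⟨x, rfl⟩)⟩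

end CStarCorrespondence

end Correspondences

/-! ### The C⋆-correspondence `M_L` of an Exel system -/

namespace ExelSystem

variable {A : Type u} [NonUnitalCStarAlgebra A] [PartialOrder A] [StarOrderedRing A]

/-- The vector space `A_L`, which is `A` with the semi-inner product `⟨m, n⟩ = L(m* n)`. -/
@[nolint unusedArguments]
def Pre (_E : ExelSystem A) : Type u := A

variable (E : ExelSystem A)

instance : AddCommGroup E.Pre := inferInstanceAs (AddCommGroup A)
instance : Module ℂ E.Pre := inferInstanceAs (Module ℂ A)

/-- The identity map `A → A_L`. -/
def toPre : A ≃ₗ[ℂ] E.Pre := LinearEquiv.refl ℂ A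

/-- The identity map `A_L → A`. -/
def ofPre : E.Pre ≃ₗ[ℂ] A := LinearEquiv.refl ℂ A

@[simp] lemma ofPre_toPre (a : A) : E.ofPre (E.toPre a) = a := rfl
@[simp] lemma toPre_ofPre (a : E.Pre) : E.toPre (E.ofPre a) = a := rfl

instance : Inner A E.Pre where
  inner m n := E.L (star (E.ofPre m) * E.ofPre n)

lemma pre_inner_def (m n : E.Pre) : inner A m n = E.L (star (E.ofPre m) * E.ofPre n) := rfl

lemma transfer' (a b : A) : E.L (E.α a * b) = a * E.L b := by
  have h := E.transfer (star b) (star a)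
  have h2 := congrArg star h
  rwa [← map_star E.L, star_mul, star_mul, star_star, ← map_star E.L, star_star, map_star E.α,
    star_star, star_star] at h2

lemma pre_inner_self_nonneg (m : E.Pre) : 0 ≤ inner A m m := by
  have := E.L.map_nonneg (star_mul_self_nonneg (E.ofPre m))
  exact this

instance : Norm E.Pre where
  norm m := √‖(inner A m m : A)‖

lemma pre_norm_def (m : E.Pre) : ‖m‖ = √‖(inner A m m : A)‖ := rfl

lemma pre_norm_sq (m : E.Pre) : ‖m‖ ^ 2 = ‖(inner A m m : A)‖ := by
  rw [pre_norm_def, Real.sq_sqrt (norm_nonneg _)]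

lemma pre_norm_nonneg (m : E.Pre) : 0 ≤ ‖m‖ := Real.sqrt_nonneg _

lemma pre_inner_add_right (m n k : E.Pre) :
    (inner A m (n + k) : A) = inner A m n + inner A m k := by
  simp only [pre_inner_def, map_add, mul_add]

lemma pre_inner_add_left (m n k : E.Pre) :
    (inner A (m + n) k : A) = inner A m k + inner A n k := by
  simp only [pre_inner_def, map_add, star_add, add_mul]

lemma pre_star_inner (m n : E.Pre) : star (inner A m n : A) = inner A n m := by
  simp only [pre_inner_def, ← map_star E.L, star_mul, star_star]

lemma pre_inner_smul_right (c : ℂ) (m n : E.Pre) :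
    (inner A m (c • n) : A) = c • inner A m n := by
  simp only [pre_inner_def, map_smul, mul_smul_comm]

lemma pre_norm_inner_le (m n : E.Pre) : ‖(inner A m n : A)‖ ≤ ‖m‖ * ‖n‖ := by
  have h := cauchySchwarz_aux (inner A m m : A) (inner A n n) (inner A m n)
    (E.pre_inner_self_nonneg m) (by
      intro t
      set x := E.ofPre m
      set y := E.ofPre n
      set a : A := E.L (star x * y) with ha
      have e0 : star a = E.L (star y * x) := by
        rw [ha, ← map_star E.L, star_mul, star_star]
      have h := E.L.map_nonneg (star_mul_self_nonneg (x * E.α a - (t : ℂ) • y))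
      have e : E.L (star (x * E.α a - (t : ℂ) • y) * (x * E.α a - (t : ℂ) • y))
          = star a * E.L (star x * x) * a - (2 * t) • (star a * a)
            + (t * t) • E.L (star y * y) := by
        have e1 : star (x * E.α a - (t : ℂ) • y) * (x * E.α a - (t : ℂ) • y)
            = E.α (star a) * (star x * x * E.α a) - (t : ℂ) • (E.α (star a) * (star x * y))
              - (t : ℂ) • (star y * x * E.α a) + ((t * t : ℝ) : ℂ) • (star y * y) := by
          simp only [star_sub, star_mul, star_smul, RCLike.star_def, Complex.conj_ofReal, sub_mul,
            mul_sub, smul_mul_assoc, mul_smul_comm, map_star, mul_assoc,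
            Complex.ofReal_mul, mul_smul, smul_sub]
          abel
        rw [e1]
        simp only [map_add, map_sub, map_smul, E.transfer, E.transfer']
        simp only [← ha, ← e0, two_mul, add_smul, Complex.coe_smul, mul_assoc]
        abel
      rw [e] at h
      exact h)
  rw [← pre_norm_sq, ← pre_norm_sq, ← mul_pow] at h
  exact (sq_le_sq₀ (norm_nonneg _) (mul_nonneg (E.pre_norm_nonneg m) (E.pre_norm_nonneg n))).1 h

instance : SeminormedAddCommGroup E.Pre :=
  SeminormedAddCommGroup.ofCore (𝕜 := ℂ) (E := E.Pre)
    { norm_nonneg := E.pre_norm_nonneg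
      norm_smul := by
        intro c m
        have h : (inner A (c • m) (c • m) : A) = (star c * c) • inner A m m := by
          rw [E.pre_inner_smul_right, ← E.pre_star_inner, E.pre_inner_smul_right, star_smul,
            E.pre_star_inner, smul_smul, mul_comm]
        rw [pre_norm_def, pre_norm_def, h, norm_smul, norm_mul, norm_star,
          Real.sqrt_mul (by positivity), Real.sqrt_mul_self (norm_nonneg c)]
      norm_triangle := by
        intro m n
        refine (sq_le_sq₀ (E.pre_norm_nonneg _)
          (add_nonneg (E.pre_norm_nonneg m) (E.pre_norm_nonneg n))).1 ?_
        rw [pre_norm_sq, E.pre_inner_add_left, E.pre_inner_add_right, E.pre_inner_add_right]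
        have h1 := E.pre_norm_inner_le m n
        have h2 := E.pre_norm_inner_le n m
        have h3 := E.pre_norm_sq m
        have h4 := E.pre_norm_sq n
        have h5 := norm_add_le ((inner A m m : A) + inner A m n) (inner A n m + inner A n n)
        have h6 := norm_add_le (inner A m m : A) (inner A m n)
        have h7 := norm_add_le (inner A n m : A) (inner A n n)
        nlinarith }

instance : NormedSpace ℂ E.Pre where
  norm_smul_le c m := by
    have h : (inner A (c • m) (c • m) : A) = (star c * c) • inner A m m := by
      rw [E.pre_inner_smul_right, ← E.pre_star_inner, E.pre_inner_smul_right, star_smul,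
        E.pre_star_inner, smul_smul, mul_comm]
    change √‖(inner A (c • m) (c • m) : A)‖ ≤ ‖c‖ * √‖(inner A m m : A)‖
    rw [h, norm_smul, norm_mul, norm_star,
      Real.sqrt_mul (by positivity), Real.sqrt_mul_self (norm_nonneg c)]

lemma pre_inner_smul_left (c : ℂ) (m n : E.Pre) :
    (inner A (c • m) n : A) = star c • inner A m n := by
  rw [← E.pre_star_inner, E.pre_inner_smul_right, star_smul, E.pre_star_inner]

/-- Left multiplication by `a` on `A_L`. -/
def preLeft (a : A) : E.Pre →L[ℂ] E.Pre :=
  LinearMap.mkContinuous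
    { toFun := fun m => E.toPre (a * E.ofPre m)
      map_add' := fun m n => by simp only [map_add, mul_add]
      map_smul' := fun c m => by simp only [map_smul, mul_smul_comm, RingHom.id_apply] }
    ‖a‖ (fun m => by
      change ‖E.toPre (a * E.ofPre m)‖ ≤ ‖a‖ * ‖m‖
      refine (sq_le_sq₀ (norm_nonneg _) (by positivity)).1 ?_
      rw [mul_pow, E.pre_norm_sq, E.pre_norm_sq, pre_inner_def, pre_inner_def, ofPre_toPre,
        star_mul]
      have h1 : star (E.ofPre m) * star a * (a * E.ofPre m)
          ≤ ‖star a * a‖ • (star (E.ofPre m) * E.ofPre m) := by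
        have := CStarAlgebra.star_left_conjugate_le_norm_smul (a := E.ofPre m)
          (IsSelfAdjoint.star_mul_self a)
        simpa only [mul_assoc] using this
      have h0 : 0 ≤ star (E.ofPre m) * star a * (a * E.ofPre m) := by
        rw [← star_mul]; exact star_mul_self_nonneg _
      have h2 := OrderHomClass.mono E.L h1
      rw [PositiveLinearMap.map_smul_of_tower] at h2
      have h3 := CStarAlgebra.norm_le_norm_of_nonneg_of_le (E.L.map_nonneg h0) h2
      rwa [norm_smul, norm_norm, CStarRing.norm_star_mul_self, ← sq] at h3)

/-- The right action `m · a = m α(a)` on `A_L`. -/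
def preRight (a : A) : E.Pre →L[ℂ] E.Pre :=
  LinearMap.mkContinuous
    { toFun := fun m => E.toPre (E.ofPre m * E.α a)
      map_add' := fun m n => by simp only [map_add, add_mul]
      map_smul' := fun c m => by simp only [map_smul, smul_mul_assoc, RingHom.id_apply] }
    ‖a‖ (fun m => by
      change ‖E.toPre (E.ofPre m * E.α a)‖ ≤ ‖a‖ * ‖m‖
      refine (sq_le_sq₀ (norm_nonneg _) (by positivity)).1 ?_
      rw [mul_pow, E.pre_norm_sq, E.pre_norm_sq, pre_inner_def, pre_inner_def, ofPre_toPre,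
        ← mul_assoc, E.transfer, star_mul, ← map_star, mul_assoc, E.transfer']
      calc ‖star a * E.L (star (E.ofPre m) * E.ofPre m) * a‖
          ≤ ‖star a‖ * ‖E.L (star (E.ofPre m) * E.ofPre m)‖ * ‖a‖ :=
            (norm_mul_le _ _).trans (by gcongr; exact norm_mul_le _ _)
        _ = ‖a‖ ^ 2 * ‖E.L (star (E.ofPre m) * E.ofPre m)‖ := by rw [norm_star]; ring)

@[simp] lemma preLeft_apply (a : A) (m : E.Pre) : E.preLeft a m = E.toPre (a * E.ofPre m) := rfl
@[simp] lemma preRight_apply (a : A) (m : E.Pre) :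
    E.preRight a m = E.toPre (E.ofPre m * E.α a) := rfl

lemma pre_continuous_inner : Continuous fun p : E.Pre × E.Pre => (inner A p.1 p.2 : A) := by
  let f : E.Pre →ₗ⋆[ℂ] E.Pre →ₗ[ℂ] A := LinearMap.mk₂'ₛₗ _ _ (fun m n => inner A m n)
    E.pre_inner_add_left E.pre_inner_smul_left E.pre_inner_add_right E.pre_inner_smul_right
  let g := LinearMap.mkContinuous₂ f 1 (fun m n => by
    rw [one_mul]; exact E.pre_norm_inner_le m n)
  exact (g.continuous.comp continuous_fst).clm_apply continuous_snd

open UniformSpace in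
/-- The Hilbert module `M_L`: the Hausdorff completion of `A_L`. -/
abbrev M : Type u := Completion E.Pre

/-- The canonical map `q : A → M_L`. -/
def q (a : A) : E.M := ((E.toPre a : E.Pre) : E.M)

lemma M_inner_coe (m n : E.Pre) : (inner A (m : E.M) (n : E.M) : A) = inner A m n :=
  (UniformSpace.Completion.isDenseInducing_coe.prodMap
    UniformSpace.Completion.isDenseInducing_coe).extend_eq E.pre_continuous_inner (m, n)

lemma M_continuous_inner : Continuous (Function.uncurry (inner A : E.M → E.M → A)) := by
  let inner' : E.Pre →+ E.Pre →+ A :=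
    AddMonoidHom.mk' (fun x => AddMonoidHom.mk' (fun y => inner A x y) (E.pre_inner_add_right x))
      (fun x y => by ext z; exact E.pre_inner_add_left x y z)
  have : Continuous fun p : E.Pre × E.Pre => inner' p.1 p.2 := E.pre_continuous_inner
  exact (UniformSpace.Completion.isDenseInducing_toCompl E.Pre).extend_Z_bilin
    (UniformSpace.Completion.isDenseInducing_toCompl E.Pre) this

lemma M_continuous_inner' {T : Type*} [TopologicalSpace T] {f g : T → E.M} (hf : Continuous f)
    (hg : Continuous g) : Continuous fun t => (inner A (f t) (g t) : A) :=
  E.M_continuous_inner.comp (hf.prodMk hg)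

lemma M_clm_ext {f g : E.M →L[ℂ] E.M} (h : ∀ m : E.Pre, f (m : E.M) = g (m : E.M)) : f = g := by
  ext x
  induction x using UniformSpace.Completion.induction_on with
  | hp => exact isClosed_eq f.continuous g.continuous
  | ih m => exact h m

/-- The left action of `A` on `M_L`, `a · q(m) = q(a m)`. -/
def leftAction : A →ₙₐ[ℂ] (E.M →L[ℂ] E.M) where
  toFun a := (E.preLeft a).completion
  map_smul' c a := by
    refine E.M_clm_ext fun m => ?_
    simp only [ContinuousLinearMap.completion_apply_coe, preLeft_apply, smul_mul_assoc,
      map_smul, MonoidHom.id_apply, smul_apply,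
      UniformSpace.Completion.coe_smul]
  map_zero' := by
    refine E.M_clm_ext fun m => ?_
    simp only [ContinuousLinearMap.completion_apply_coe, preLeft_apply, zero_mul, map_zero,
      zero_apply, UniformSpace.Completion.coe_zero]
  map_add' a b := by
    refine E.M_clm_ext fun m => ?_
    simp only [ContinuousLinearMap.completion_apply_coe, preLeft_apply, add_mul, map_add,
      add_apply, UniformSpace.Completion.coe_add]
  map_mul' a b := by
    refine E.M_clm_ext fun m => ?_
    change _ = (E.preLeft a).completion ((E.preLeft b).completion (m : E.M))
    simp only [ContinuousLinearMap.completion_apply_coe, preLeft_apply, mul_assoc, ofPre_toPre]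

@[simp] lemma leftAction_q (a m : A) : E.leftAction a (E.q m) = E.q (a * m) := by
  change (E.preLeft a).completion (E.toPre m : E.M) = _
  rw [ContinuousLinearMap.completion_apply_coe]
  rfl

lemma M_inner_add_right (x y z : E.M) : (inner A x (y + z) : A) = inner A x y + inner A x z := by
  induction x, y, z using UniformSpace.Completion.induction_on₃ with
  | hp =>
    refine isClosed_eq (E.M_continuous_inner' ?_ ?_)
      ((E.M_continuous_inner' ?_ ?_).add (E.M_continuous_inner' ?_ ?_))
    · exact continuous_fst
    · exact (continuous_fst.comp continuous_snd).add (continuous_snd.comp continuous_snd)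
    · exact continuous_fst
    · exact continuous_fst.comp continuous_snd
    · exact continuous_fst
    · exact continuous_snd.comp continuous_snd
  | ih m n k => simp only [← UniformSpace.Completion.coe_add, M_inner_coe, E.pre_inner_add_right]

lemma M_inner_smul_right (c : ℂ) (x y : E.M) : (inner A x (c • y) : A) = c • inner A x y := by
  induction x, y using UniformSpace.Completion.induction_on₂ with
  | hp =>
    have h1 : Continuous fun p : E.M × E.M => c • (inner A p.1 p.2 : A) :=
      (E.M_continuous_inner' continuous_fst continuous_snd).const_smul c
    have h0 : Continuous fun p : E.M × E.M => c • p.2 := continuous_snd.const_smul c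
    exact isClosed_eq (E.M_continuous_inner' continuous_fst h0) h1
  | ih m n =>
    rw [← UniformSpace.Completion.coe_smul, M_inner_coe, M_inner_coe, E.pre_inner_smul_right]

lemma M_inner_preRight (x y : E.M) (a : A) :
    (inner A x ((E.preRight a).completion y) : A) = inner A x y * a := by
  induction x, y using UniformSpace.Completion.induction_on₂ with
  | hp =>
    exact isClosed_eq
      (E.M_continuous_inner' continuous_fst
        ((E.preRight a).completion.continuous.comp continuous_snd))
      ((E.M_continuous_inner' continuous_fst continuous_snd).mul continuous_const)
  | ih m n =>
    simp only [ContinuousLinearMap.completion_apply_coe, M_inner_coe, pre_inner_def,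
      preRight_apply, ofPre_toPre, ← mul_assoc, E.transfer]

open UniformSpace in
/-- The C⋆-correspondence `M_L` of the Exel system: inner product, right and left action are the
continuous extensions of `⟨m, n⟩ = L(m* n)`, `m · a = m α(a)` and `a · m = a m`. -/
def correspondence : CStarCorrespondence A E.M where
  rsmul x a := (E.preRight a).completion x
  inner x y := inner A x y
  φ := E.leftAction
  add_rsmul x y a := map_add _ x y
  rsmul_add x a b := by
    have : (E.preRight (a + b)).completion
        = (E.preRight a).completion + (E.preRight b).completion := by
      refine E.M_clm_ext fun m => ?_
      simp only [ContinuousLinearMap.completion_apply_coe, preRight_apply, mul_add, map_add,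
        add_apply, UniformSpace.Completion.coe_add]
    exact DFunLike.congr_fun this x
  smul_rsmul c x a := map_smul _ c x
  rsmul_smul c x a := by
    have : (E.preRight (c • a)).completion = c • (E.preRight a).completion := by
      refine E.M_clm_ext fun m => ?_
      simp only [ContinuousLinearMap.completion_apply_coe, preRight_apply, mul_smul_comm,
        map_smul, smul_apply, UniformSpace.Completion.coe_smul]
    exact DFunLike.congr_fun this x
  rsmul_mul x a b := by
    have : (E.preRight (a * b)).completion
        = (E.preRight b).completion.comp (E.preRight a).completion := by
      refine E.M_clm_ext fun m => ?_
      rw [ContinuousLinearMap.comp_apply]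
      simp only [ContinuousLinearMap.completion_apply_coe, preRight_apply, map_mul, mul_assoc,
        ofPre_toPre]
    exact DFunLike.congr_fun this x
  inner_add_right := E.M_inner_add_right
  inner_smul_right := E.M_inner_smul_right
  inner_rsmul_right := E.M_inner_preRight
  star_inner x y := by
    induction x, y using Completion.induction_on₂ with
    | hp =>
      exact isClosed_eq (E.M_continuous_inner' continuous_fst continuous_snd).star
        (E.M_continuous_inner' continuous_snd continuous_fst)
    | ih m n => simp only [M_inner_coe, E.pre_star_inner]
  inner_self_nonneg x := by
    induction x using Completion.induction_on with
    | hp =>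
      exact CStarAlgebra.isClosed_nonneg.preimage
        (E.M_continuous_inner' continuous_id continuous_id)
    | ih m => rw [M_inner_coe]; exact E.pre_inner_self_nonneg m
  norm_sq_eq x := by
    induction x using Completion.induction_on with
    | hp =>
      exact isClosed_eq (by fun_prop) (E.M_continuous_inner' continuous_id continuous_id).norm
    | ih m => rw [M_inner_coe, Completion.norm_coe]; exact E.pre_norm_sq m
  φ_adjoint a x y := by
    induction x, y using Completion.induction_on₂ with
    | hp =>
      refine isClosed_eq (E.M_continuous_inner' ?_ ?_) (E.M_continuous_inner' ?_ ?_)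
      · exact ((E.preLeft a).completion.continuous).comp continuous_fst
      · exact continuous_snd
      · exact continuous_fst
      · exact ((E.preLeft (star a)).completion.continuous).comp continuous_snd
    | ih m n =>
      change (inner A ((E.preLeft a).completion m) (n : E.M) : A)
        = inner A (m : E.M) ((E.preLeft (star a)).completion n)
      simp only [ContinuousLinearMap.completion_apply_coe, M_inner_coe, pre_inner_def,
        preLeft_apply, ofPre_toPre, star_mul, mul_assoc]

end ExelSystem

end ExelCrossed

end

/-! The two crossed products differ in three ways: the relation `S π(a) = π(α(a)) S`, the shape of
the redundancies, and the coefficients `a` whose redundancies are divided out. The first difference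
is void. For `D = S π(a) - π(α(a)) S` the transfer identities give `(π(b) D)* (π(b) D) = 0` for all
`b`, and non-degeneracy of `π` forces `D = 0` (`mul_eq_of_star_mul_mul`). Hence the two Toeplitz
algebras agree. So do the redundancies: an inner factor `π(c)` is absorbed by `S π(c) = π(α(c)) S`
and, conversely, supplied by an approximate unit (`isRedundancy_iff`). Finally, both coefficient
ideals are `A`. Almost faithfulness kills `N_L`. Non-degeneracy of `α` makes `closure (A α(A) A)`
everything. Under (ii), strict continuity makes `b α(e)` converge along the approximate unit, `L`
does not distinguish `b` from the limit, and faithfulness yields `b α(e) → b`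
(`Extendible.tendsto_mul`).

For the Cuntz-Pimsner algebra, representations of `(A, L)` correspond to representations of `M_L` by
`π_X(q(a)) = π(a) S`, where `S` is recovered as a weak limit of the operators `π_X(q(e))`
(`exists_operator`). In the universal representation the redundancies are exactly the pairs
`(i_A(a), k)` with `φ(a)` compact and `k` the image of `φ(a)` under `K(M_L) → T(A, L)`
(`exists_compact_of_redundancy`, `isRedundancy_toeplitzK`). This needs `i_A` isometric, so that
`K(M_L)` has closed image and acts faithfully; the Fock representations on the sums of the GNS
spaces of `f ∘ L^n` provide it (`cpUnivπ_injective`). For almost faithful `L` the left action `φ` is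
injective, so every `a` with `φ(a)` compact lies in Katsura's ideal, and killing redundancies is the
same as covariance.

It remains that `T(A, L) → O_{M_L}` kills nothing outside the redundancy ideal. An element outside a
closed ideal is detected by a positive functional vanishing on the ideal
(`exists_positive_functional`), and its GNS representation is a covariant representation of `M_L`.
One set-theoretic point intervenes: `T(A, L)` lives one universe above the Hilbert spaces allowed in
the definitions. But it is generated by a family indexed by `A`, hence is small, and its GNS spaces
can be replaced by spaces `ℓ²(ι)` in the right universe. -/

noncomputable section

namespace ExelCrossed

open Filter Topology
open scoped CStarAlgebra ComplexOrder

/-! ### Positive functionals vanishing on a closed ideal -/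

section Functionals

variable {B : Type v} [NonUnitalCStarAlgebra B]

/-- A closed ideal as a ⋆-subalgebra. -/
def ClosedIdeal.toSubalgebra (I : ClosedIdeal B) : NonUnitalStarSubalgebra ℂ B where
  carrier := I.carrier
  add_mem' := I.add_mem'
  zero_mem' := I.zero_mem'
  smul_mem' := I.smul_mem'
  mul_mem' := fun {_ _} _ hy => I.mul_mem_left _ hy
  star_mem' := I.star_mem

/-- A closed ideal is itself a C⋆-algebra, so its own increasing approximate unit does the job. -/
lemma ClosedIdeal.exists_approx_unit (I : ClosedIdeal B) {x : B} (hx : x ∈ I.carrier)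
    {ε : ℝ} (hε : 0 < ε) :
    ∃ e ∈ I.carrier, star e = e ∧ ‖e‖ ≤ 1 ∧ ‖x - e * x‖ < ε := by
  let _ : NonUnitalCStarAlgebra I.toSubalgebra :=
    NonUnitalStarSubalgebra.nonUnitalCStarAlgebra I.toSubalgebra (h_closed := I.isClosed)
  let _ := CStarAlgebra.spectralOrder I.toSubalgebra
  let _ := CStarAlgebra.spectralOrderedRing I.toSubalgebra
  have hl := CStarAlgebra.increasingApproximateUnit I.toSubalgebra
  have h1 := Metric.tendsto_nhds.1 (hl.tendsto_mul_right (⟨x, hx⟩ : I.toSubalgebra)) ε hε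
  obtain ⟨e, ⟨he1, he2⟩, he3⟩ := ((h1.and hl.eventually_norm).and hl.eventually_star_eq).exists
  refine ⟨e.1, e.2, congrArg Subtype.val he3, he2, ?_⟩
  rw [dist_eq_norm, norm_sub_rev] at he1
  exact he1

/-- The element estimated is `(1 - e) y (1 - e)`, written without a unit. -/
lemma norm_compress_le (e y : B) (he : ‖e‖ ≤ 1) :
    ‖y - e * y - (y - e * y) * e‖ ≤ 2 * ‖y - e * y‖ := by
  calc ‖y - e * y - (y - e * y) * e‖ ≤ ‖y - e * y‖ + ‖y - e * y‖ * ‖e‖ :=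
        (norm_sub_le _ _).trans (by gcongr; exact norm_mul_le _ _)
    _ ≤ ‖y - e * y‖ + ‖y - e * y‖ * 1 := by gcongr
    _ = 2 * ‖y - e * y‖ := by ring

variable [PartialOrder B] [StarOrderedRing B]

/-- Compressing by `1 - e`, with `e` from an approximate unit of `I`, nearly kills `i` and keeps `p`
positive. So `(1 - e) x* x (1 - e)` is dominated by something small, and `x` is close to `x e ∈ I`.
-/
lemma ClosedIdeal.mem_of_approx (I : ClosedIdeal B) (x : B)
    (h : ∀ ε > 0, ∃ p : B, 0 ≤ p ∧ ∃ i ∈ I.carrier, ‖star x * x + p + i‖ < ε) :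
    x ∈ I.carrier := by
  have hcl : closure I.carrier = I.carrier := I.isClosed.closure_eq
  rw [← hcl]
  refine Metric.mem_closure_iff.2 fun ε hε => ?_
  -- The compressions of `s` and `i` have norm at most `4 ‖s‖` and `2 ‖i - e i‖`, in total below `6
  -- ε² / 8`.
  obtain ⟨p, hp, i, hi, hs⟩ := h (ε ^ 2 / 8) (by positivity)
  obtain ⟨e, he, hes, hen, hei⟩ := I.exists_approx_unit hi (ε := ε ^ 2 / 8) (by positivity)
  refine ⟨x * e, I.mul_mem_left _ he, ?_⟩
  set s := star x * x + p + i with hs'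
  let c : B → B := fun y => y - e * y - (y - e * y) * e
  have hcpos : ∀ z : B, c (star z * z) = star (z - z * e) * (z - z * e) := by
    intro z
    simp only [c, star_sub, star_mul, hes, sub_mul, mul_sub, mul_assoc]
  have hc0 : 0 ≤ c p := by
    obtain ⟨z, rfl⟩ := CStarAlgebra.nonneg_iff_eq_star_mul_self.1 hp
    rw [hcpos]
    exact star_mul_self_nonneg _
  have hle : c (star x * x) ≤ c s - c i := by
    have : c s - c i = c (star x * x) + c p := by
      simp only [c, hs', mul_add, add_mul, sub_mul]
      abel
    rw [this]
    exact le_add_of_nonneg_right hc0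
  have h0 : 0 ≤ c (star x * x) := by rw [hcpos]; exact star_mul_self_nonneg _
  have hn := CStarAlgebra.norm_le_norm_of_nonneg_of_le h0 hle
  rw [hcpos, CStarRing.norm_star_mul_self, ← sq] at hn
  have h1 : ‖c s‖ ≤ 4 * ‖s‖ := by
    have h2 : ‖s - e * s‖ ≤ 2 * ‖s‖ := by
      calc ‖s - e * s‖ ≤ ‖s‖ + ‖e‖ * ‖s‖ :=
            (norm_sub_le _ _).trans (by gcongr; exact norm_mul_le _ _)
        _ ≤ ‖s‖ + 1 * ‖s‖ := by gcongr
        _ = 2 * ‖s‖ := by ring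
    linarith [norm_compress_le e s hen]
  have h3 : ‖c i‖ ≤ 2 * ‖i - e * i‖ := norm_compress_le e i hen
  have h4 : ‖x - x * e‖ ^ 2 < ε ^ 2 := by
    have : 0 < ε ^ 2 := by positivity
    linarith [norm_sub_le (c s) (c i)]
  rw [dist_eq_norm]
  exact lt_of_pow_lt_pow_left₀ 2 hε.le h4

/-- Positive functionals vanishing on a closed ideal separate the points outside of the ideal. -/
lemma ClosedIdeal.exists_positive_functional (I : ClosedIdeal B) (x : B) (hx : x ∉ I.carrier) :
    ∃ f : B →ₚ[ℂ] ℂ, (∀ i ∈ I.carrier, f i = 0) ∧ f (star x * x) ≠ 0 := by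
  let C : Set B := {y | ∃ p : B, 0 ≤ p ∧ ∃ i ∈ I.carrier, y = p + i}
  have hconv : Convex ℝ C := by
    rintro _ ⟨p, hp, i, hi, rfl⟩ _ ⟨p', hp', i', hi', rfl⟩ a b ha hb -
    refine ⟨a • p + b • p', add_nonneg (smul_nonneg ha hp) (smul_nonneg hb hp'), a • i + b • i',
      I.add_mem' ?_ ?_, by rw [smul_add, smul_add]; abel⟩
    · rw [← Complex.coe_smul]; exact I.smul_mem' _ hi
    · rw [← Complex.coe_smul]; exact I.smul_mem' _ hi'
  -- Closure points of the cone `B₊ + I` of the form `-x* x` are precisely what `mem_of_approx`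
  -- handles, so Hahn-Banach applies.
  have hnot : -(star x * x) ∉ closure C := by
    intro hmem
    refine hx (I.mem_of_approx x fun ε hε => ?_)
    obtain ⟨_, ⟨p, hp, i, hi, rfl⟩, hd⟩ := Metric.mem_closure_iff.1 hmem ε hε
    refine ⟨p, hp, i, hi, ?_⟩
    rw [dist_eq_norm, norm_sub_rev] at hd
    have e : star x * x + p + i = p + i - -(star x * x) := by abel
    rwa [e]
  obtain ⟨g, r, hr1, hr2⟩ :=
    RCLike.geometric_hahn_banach_point_closed (𝕜 := ℂ) hconv.closure isClosed_closure hnot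
  have hr3 : ∀ p i : B, 0 ≤ p → i ∈ I.carrier → r < (g p).re + (g i).re := fun p i hp hi => by
    have := hr2 (p + i) (subset_closure ⟨p, hp, i, hi, rfl⟩)
    simpa using this
  have hr0 : r < 0 := by simpa using hr3 0 0 le_rfl I.zero_mem'
  -- `C` is a cone, so a functional bounded below on it is non-negative on it.
  have scale : ∀ t : ℝ, (∀ n : ℕ, r < n * t) → 0 ≤ t := by
    intro t ht
    by_contra! hneg
    obtain ⟨n, hn⟩ := exists_nat_gt (r / t)
    have := ht n
    rw [div_lt_iff_of_neg hneg] at hn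
    linarith
  have hpos : ∀ p : B, 0 ≤ p → 0 ≤ (g p).re := fun p hp => scale _ fun n => by
    have := hr3 (n • p) 0 (nsmul_nonneg hp n) I.zero_mem'
    simpa using this
  have hI1 : ∀ i ∈ I.carrier, 0 ≤ (g i).re := fun i hi => scale _ fun n => by
    have := hr3 0 ((n : ℂ) • i) le_rfl (I.smul_mem' _ hi)
    simpa using this
  have hI2 : ∀ i ∈ I.carrier, (g i).re = 0 := fun i hi => by
    have h1 := hI1 _ hi
    have h2 := hI1 _ (I.smul_mem' (-1) hi)
    simp at h2
    linarith
  have hI : ∀ i ∈ I.carrier, g i = 0 := fun i hi => by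
    refine Complex.ext (hI2 i hi) ?_
    have := hI2 _ (I.smul_mem' (-Complex.I) hi)
    simpa using this
  -- Only the real part of `g` is controlled on positive elements; symmetrising makes the values
  -- there real without losing linearity or the vanishing on `I`.
  let F : B →ₗ[ℂ] ℂ :=
    { toFun := fun y => g y + star (g (star y))
      map_add' := fun y z => by simp only [star_add, map_add]; ring
      map_smul' := fun c y => by
        simp only [star_smul, map_smul, smul_eq_mul, star_mul', star_star, RingHom.id_apply]
        ring }
  have hF : ∀ y : B, star y = y → F y = ((2 * (g y).re : ℝ) : ℂ) := fun y hy => by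
    change g y + star (g (star y)) = _
    rw [hy]
    exact Complex.add_conj _
  let f : B →ₚ[ℂ] ℂ := PositiveLinearMap.mk₀ F fun y hy => by
    rw [hF y (IsSelfAdjoint.of_nonneg hy).star_eq]
    have := hpos y hy
    exact Complex.zero_le_real.2 (by linarith)
  refine ⟨f, fun i hi => ?_, ?_⟩
  · change g i + star (g (star i)) = 0
    rw [hI i hi, hI _ (I.star_mem hi), star_zero, add_zero]
  · change F (star x * x) ≠ 0
    rw [hF _ (by simp)]
    have h1 : (g (-(star x * x))).re < r := hr1
    rw [map_neg, Complex.neg_re] at h1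
    exact_mod_cast (by linarith : (0 : ℝ) < 2 * (g (star x * x)).re).ne'

end Functionals

/-! ### Generalities on ⋆-homomorphisms -/

section Homs

variable {B : Type*} [NonUnitalCStarAlgebra B] {D : Type*} [NonUnitalCStarAlgebra D]

/-- Cut `x` off at height `‖φ x‖` by functional calculus. The cut-off is the identity on the
spectrum of `φ x`, so the image does not change. -/
lemma exists_lift_selfAdjoint (φ : B →⋆ₙₐ[ℂ] D) (x : B) (hx : IsSelfAdjoint x) :
    ∃ y, φ y = φ x ∧ ‖y‖ ≤ ‖φ x‖ := by
  set M := ‖φ x‖ with hM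
  have hM0 : 0 ≤ M := norm_nonneg _
  let f : ℝ → ℝ := fun t => max (-M) (min t M)
  have hf : Continuous f := by fun_prop
  have hf0 : f 0 = 0 := by simp [f, hM0]
  have hφx : IsSelfAdjoint (φ x) := hx.map φ
  refine ⟨cfcₙ f x, ?_, ?_⟩
  · rw [NonUnitalStarAlgHom.map_cfcₙ (S := ℂ) φ f x hf.continuousOn hf0 (map_continuous φ) hx hφx]
    conv_rhs => rw [← cfcₙ_id' ℝ (φ x)]
    refine cfcₙ_congr fun t ht => ?_
    have h1 : ‖t‖ ≤ M := by
      have := NonUnitalIsometricContinuousFunctionalCalculus.norm_quasispectrum_le (𝕜 := ℝ)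
        (φ x) ht hφx
      exact this
    rw [Real.norm_eq_abs, abs_le] at h1
    simp only [f]
    rw [min_eq_left h1.2, max_eq_right h1.1]
  · refine norm_cfcₙ_le fun t _ => ?_
    rw [Real.norm_eq_abs, abs_le]
    exact ⟨le_max_left _ _, max_le (by linarith) (min_le_right _ _)⟩

/-- Lift real and imaginary part separately; this is the source of the factor 2. -/
lemma exists_lift_norm_le (φ : B →⋆ₙₐ[ℂ] D) (x : B) : ∃ y, φ y = φ x ∧ ‖y‖ ≤ 2 * ‖φ x‖ := by
  obtain ⟨y, hy, hyn⟩ := exists_lift_selfAdjoint φ (realPart x : B) (realPart x).2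
  obtain ⟨z, hz, hzn⟩ := exists_lift_selfAdjoint φ (imaginaryPart x : B) (imaginaryPart x).2
  have e1 : ‖φ (realPart x : B)‖ ≤ ‖φ x‖ := by
    have : φ (realPart x : B) = (realPart (φ x) : D) := by
      simp only [realPart_apply_coe, ← Complex.coe_smul, map_smul, map_add, map_star]
    rw [this]
    exact realPart.norm_le (φ x)
  have e2 : ‖φ (imaginaryPart x : B)‖ ≤ ‖φ x‖ := by
    have : φ (imaginaryPart x : B) = (imaginaryPart (φ x) : D) := by
      simp only [imaginaryPart_apply_coe, ← Complex.coe_smul, map_smul, map_sub, map_star]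
    rw [this]
    exact imaginaryPart.norm_le (φ x)
  refine ⟨y + Complex.I • z, ?_, ?_⟩
  · rw [map_add, map_smul, hy, hz, ← map_smul, ← map_add, realPart_add_I_smul_imaginaryPart]
  · calc ‖y + Complex.I • z‖ ≤ ‖y‖ + ‖Complex.I • z‖ := norm_add_le _ _
      _ = ‖y‖ + ‖z‖ := by rw [norm_smul, Complex.norm_I, one_mul]
      _ ≤ 2 * ‖φ x‖ := by linarith

/-- Lifts of controlled norm allow the successive approximation argument of the open mapping
theorem; no quotient norm is needed. -/
lemma isClosed_range_starAlgHom (φ : B →⋆ₙₐ[ℂ] D) : IsClosed (Set.range φ) := by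
  let F : NormedAddGroupHom B D := (φ : B →+ D).mkNormedAddGroupHom 1 fun x => by
    rw [one_mul]; exact NonUnitalStarAlgHom.norm_apply_le φ x
  have hF : ∀ x, F x = φ x := fun _ => rfl
  have h := controlled_closure_of_complete (f := F) (K := F.range) (C := 2) (ε := 1) two_pos
    one_pos (by
      rintro _ ⟨x, rfl⟩
      exact exists_lift_norm_le φ x)
  refine isClosed_of_closure_subset fun y hy => ?_
  obtain ⟨x, hx, -⟩ := h y hy
  exact ⟨x, hx⟩

/-- Induction over a C⋆-algebra generated by a set. -/
lemma cstarGenerated_induction {B : Type v} [NonUnitalCStarAlgebra B] {s : Set B}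
    {P : cstarGenerated s → Prop}
    (mem : ∀ x (hx : x ∈ s), P ⟨x, mem_cstarGenerated hx⟩) (zero : P 0)
    (add : ∀ x y, P x → P y → P (x + y)) (mul : ∀ x y, P x → P y → P (x * y))
    (smul : ∀ (c : ℂ) x, P x → P (c • x)) (star : ∀ x, P x → P (star x))
    (closed : IsClosed {x | P x}) (x : cstarGenerated s) : P x := by
  have hle : NonUnitalStarAlgebra.adjoin ℂ s ≤ cstarGenerated s :=
    NonUnitalStarSubalgebra.le_topologicalClosure _
  have h1 : ∀ y (hy : y ∈ NonUnitalStarAlgebra.adjoin ℂ s), P ⟨y, hle hy⟩ := by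
    intro y hy
    induction hy using NonUnitalStarAlgebra.adjoin_induction with
    | mem x hx => exact mem x hx
    | add x y hx hy h1 h2 => exact add _ _ h1 h2
    | zero => exact zero
    | mul x y hx hy h1 h2 => exact mul _ _ h1 h2
    | smul r x hx h => exact smul r _ h
    | star x hx h => exact star _ h
  have hd : x ∈ closure {x : cstarGenerated s | P x} := by
    rw [Metric.mem_closure_iff]
    intro ε hε
    have hx : x.1 ∈ closure (NonUnitalStarAlgebra.adjoin ℂ s : Set B) := x.2
    obtain ⟨y, hy, hd⟩ := Metric.mem_closure_iff.1 hx ε hε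
    exact ⟨⟨y, hle hy⟩, h1 y hy, hd⟩
  rwa [closed.closure_eq] at hd

lemma cstarGenerated_hom_ext {B : Type v} [NonUnitalCStarAlgebra B] {s : Set B}
    {φ ψ : cstarGenerated s →⋆ₙₐ[ℂ] D}
    (h : ∀ x (hx : x ∈ s), φ ⟨x, mem_cstarGenerated hx⟩ = ψ ⟨x, mem_cstarGenerated hx⟩)
    (x : cstarGenerated s) : φ x = ψ x := by
  induction x using cstarGenerated_induction with
  | mem x hx => exact h x hx
  | zero => simp
  | add x y h1 h2 => rw [map_add, map_add, h1, h2]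
  | mul x y h1 h2 => rw [map_mul, map_mul, h1, h2]
  | smul c x h => rw [map_smul, map_smul, h]
  | star x h => rw [map_star, map_star, h]
  | closed => exact isClosed_eq (map_continuous φ) (map_continuous ψ)

/-- A ⋆-homomorphism which maps generators to generators restricts to the generated
C⋆-algebras. -/
def cstarGeneratedMap {B : Type v} [NonUnitalCStarAlgebra B] {s : Set B}
    {D : Type*} [NonUnitalCStarAlgebra D] (t : Set D) (φ : B →⋆ₙₐ[ℂ] D)
    (h : ∀ x ∈ s, φ x ∈ t) : cstarGenerated s →⋆ₙₐ[ℂ] cstarGenerated t :=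
  NonUnitalStarAlgHom.codRestrict
    (φ.comp (NonUnitalStarSubalgebraClass.subtype (cstarGenerated s))) (cstarGenerated t) (by
    intro x
    induction x using cstarGenerated_induction with
    | mem x hx => exact mem_cstarGenerated (h x hx)
    | zero => simp
    | add x y h1 h2 => rw [map_add]; exact add_mem h1 h2
    | mul x y h1 h2 => rw [map_mul]; exact mul_mem h1 h2
    | smul c x h => rw [map_smul]; exact SMulMemClass.smul_mem c h
    | star x h => rw [map_star]; exact star_mem h
    | closed =>
      have h1 : IsClosed ((cstarGenerated t : NonUnitalStarSubalgebra ℂ D) : Set D) :=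
        NonUnitalStarSubalgebra.isClosed_topologicalClosure _
      exact h1.preimage ((map_continuous φ).comp continuous_subtype_val))

lemma cstarGeneratedMap_surjective {B : Type v} [NonUnitalCStarAlgebra B] {s : Set B}
    {D : Type*} [NonUnitalCStarAlgebra D] (t : Set D) (φ : B →⋆ₙₐ[ℂ] D)
    (h : ∀ x ∈ s, φ x ∈ t) (ht : ∀ y ∈ t, ∃ x ∈ cstarGenerated s, φ x = y) :
    Function.Surjective (cstarGeneratedMap t φ h) := by
  intro y
  have hcl := isClosed_range_starAlgHom (cstarGeneratedMap t φ h)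
  change y ∈ Set.range (cstarGeneratedMap t φ h)
  induction y using cstarGenerated_induction with
  | mem y hy =>
    obtain ⟨x, hx, rfl⟩ := ht y hy
    exact ⟨⟨x, hx⟩, rfl⟩
  | zero => exact ⟨0, map_zero _⟩
  | add x y h1 h2 =>
    obtain ⟨x, rfl⟩ := h1
    obtain ⟨y, rfl⟩ := h2
    exact ⟨x + y, map_add _ _ _⟩
  | mul x y h1 h2 =>
    obtain ⟨x, rfl⟩ := h1
    obtain ⟨y, rfl⟩ := h2
    exact ⟨x * y, map_mul _ _ _⟩
  | smul c x h =>
    obtain ⟨x, rfl⟩ := h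
    exact ⟨c • x, map_smul _ _ _⟩
  | star x h =>
    obtain ⟨x, rfl⟩ := h
    exact ⟨star x, map_star _ _⟩
  | closed => exact hcl

/-- The preimage of a closed ideal. -/
def ClosedIdeal.comap (φ : B →⋆ₙₐ[ℂ] D) (I : ClosedIdeal D) : ClosedIdeal B where
  carrier := φ ⁻¹' I.carrier
  add_mem' {x y} hx hy := by
    rw [Set.mem_preimage, map_add]; exact I.add_mem' hx hy
  zero_mem' := by
    rw [Set.mem_preimage, map_zero]; exact I.zero_mem'
  smul_mem' c x hx := by
    rw [Set.mem_preimage, map_smul]; exact I.smul_mem' c hx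
  isClosed := I.isClosed.preimage (map_continuous φ)
  mul_mem_left b {x} hx := by
    rw [Set.mem_preimage, map_mul]; exact I.mul_mem_left _ hx
  mul_mem_right {x} b hx := by
    rw [Set.mem_preimage, map_mul]; exact I.mul_mem_right _ hx
  star_mem {x} hx := by
    rw [Set.mem_preimage, map_star]; exact I.star_mem hx

/-- The zero ideal. -/
def ClosedIdeal.zero (B : Type*) [NonUnitalCStarAlgebra B] : ClosedIdeal B where
  toSubmodule := ⊥
  isClosed := isClosed_singleton
  mul_mem_left b {x} hx := by
    rw [Set.mem_singleton_iff.1 hx, mul_zero]; rfl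
  mul_mem_right {x} b hx := by
    rw [Set.mem_singleton_iff.1 hx, zero_mul]; rfl
  star_mem {x} hx := by
    rw [Set.mem_singleton_iff.1 hx, star_zero]; rfl

lemma ClosedIdeal.subset_generatedBy (s : Set B) :
    s ⊆ (ClosedIdeal.generatedBy s).carrier := fun _ hx _ hI => hI hx

/-- A surjective ⋆-homomorphism with kernel `I` induces an isomorphism from the quotient by `I`. -/
def ClosedIdeal.quotientEquiv {D : Type*} [NonUnitalRing D] [Module ℂ D] [StarRing D]
    (I : ClosedIdeal B) (φ : B →⋆ₙₐ[ℂ] D)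
    (hker : ∀ x, φ x = 0 ↔ x ∈ I.carrier) (hsurj : Function.Surjective φ) :
    I.Quotient ≃⋆ₐ[ℂ] D :=
  let e : I.Quotient →ₗ[ℂ] D := I.toSubmodule.liftQ (φ : B →ₗ[ℂ] D) fun x hx => (hker x).2 hx
  have he : ∀ x, e (I.proj x) = φ x := fun x => Submodule.liftQ_apply _ _ _
  StarAlgEquiv.ofBijective
    ({ toFun := e
       map_smul' := map_smul e
       map_zero' := map_zero e
       map_add' := map_add e
       map_mul' := fun x y => by
         obtain ⟨x, rfl⟩ := I.proj_surjective x
         obtain ⟨y, rfl⟩ := I.proj_surjective y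
         rw [← proj_mul, he, he, he, map_mul]
       map_star' := fun x => by
         obtain ⟨x, rfl⟩ := I.proj_surjective x
         rw [← proj_star, he, he, map_star] } : I.Quotient →⋆ₙₐ[ℂ] D)
    ⟨(injective_iff_map_eq_zero e).2 fun x hx => by
        obtain ⟨x, rfl⟩ := I.proj_surjective x
        rw [he, hker] at hx
        rw [← map_zero I.proj, I.proj_eq_proj, sub_zero]
        exact hx,
      fun y => by
        obtain ⟨x, rfl⟩ := hsurj y
        exact ⟨I.proj x, he x⟩⟩

end Homs

/-! ### Representations of C⋆-correspondences in C⋆-algebras -/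

section CorrespondenceReps

variable {A : Type u} [NonUnitalCStarAlgebra A] [PartialOrder A] [StarOrderedRing A]
  {X : Type u} [NormedAddCommGroup X] [NormedSpace ℂ X] [CompleteSpace X]

/-- A ⋆-homomorphism of C⋆-algebras as a continuous linear map. -/
def homCLM {B D : Type*} [NonUnitalCStarAlgebra B] [NonUnitalCStarAlgebra D] (σ : B →⋆ₙₐ[ℂ] D) :
    B →L[ℂ] D := ⟨(σ : B →ₗ[ℂ] D), map_continuous σ⟩

/-- A representation of a C⋆-correspondence in a C⋆-algebra. -/
structure CStarCorrespondence.IsRepOn (C : CStarCorrespondence A X) {B : Type*}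
    [NonUnitalCStarAlgebra B] (π : A →⋆ₙₐ[ℂ] B) (πX : X →L[ℂ] B) : Prop where
  map_inner : ∀ x y, star (πX x) * πX y = π (C.inner x y)
  map_left : ∀ a x, πX (C.φ a x) = π a * πX x

namespace CStarCorrespondence

variable (C : CStarCorrespondence A X)

/-! ### The homomorphism on `K(X)`, built from formal combinations of rank-one operators -/

/-- The finite-rank operator `∑ c_{x,y} Θ_{x,y}`. -/
def finiteRank : (X × X →₀ ℂ) →ₗ[ℂ] (X →L[ℂ] X) :=
  Finsupp.linearCombination ℂ fun p => C.Θ p.1 p.2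

lemma finiteRank_mem (c : X × X →₀ ℂ) : C.finiteRank c ∈ C.compacts := by
  induction c using Finsupp.induction_linear with
  | zero => simp
  | add f g hf hg => rw [map_add]; exact add_mem hf hg
  | single p r =>
    rw [finiteRank, Finsupp.linearCombination_single]
    exact C.compacts.smul_mem _ (C.Θ_mem _ _)

@[simp] lemma finiteRank_single (x y : X) (r : ℂ) :
    C.finiteRank (Finsupp.single (x, y) r) = r • C.Θ x y :=
  Finsupp.linearCombination_single ..

/-- Finite-rank operators as elements of `K(X)`. -/
def finiteRankCompact : (X × X →₀ ℂ) →ₗ[ℂ] C.compacts :=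
  C.finiteRank.codRestrict _ C.finiteRank_mem

lemma denseRange_finiteRankCompact : DenseRange C.finiteRankCompact := by
  intro K
  rw [Metric.mem_closure_iff]
  intro ε hε
  have hK : K.1 ∈ closure (Submodule.span ℂ {T | ∃ x y, T = C.Θ x y} : Set (X →L[ℂ] X)) := K.2
  obtain ⟨T, hT, hd⟩ := Metric.mem_closure_iff.1 hK ε hε
  have hT' : T ∈ Set.range C.finiteRank := by
    have hle : Submodule.span ℂ {T | ∃ x y, T = C.Θ x y} ≤ LinearMap.range C.finiteRank := by
      rw [Submodule.span_le]
      rintro _ ⟨x, y, rfl⟩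
      exact ⟨Finsupp.single (x, y) 1, by simp⟩
    exact hle hT
  obtain ⟨c, rfl⟩ := hT'
  exact ⟨C.finiteRankCompact c, ⟨c, rfl⟩, hd⟩

@[simp] lemma Θ_apply (x y z : X) : C.Θ x y z = C.rsmul x (C.inner y z) := rfl

lemma inner_Θ (x y z w : X) : C.inner (C.Θ x y z) w = C.inner z (C.Θ y x w) := by
  rw [Θ_apply, Θ_apply, C.inner_rsmul_left, C.inner_rsmul_right, C.star_inner]

section RepOn

variable {C} {B : Type*} [NonUnitalCStarAlgebra B] {π : A →⋆ₙₐ[ℂ] B} {πX : X →L[ℂ] B}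
  (h : C.IsRepOn π πX)

/-- Compatibility with the right action is automatic: expand the square of the difference, and every
term is determined by inner products. -/
lemma map_rsmul_of_map_inner {πX : X →ₗ[ℂ] B}
    (h : ∀ x y, star (πX x) * πX y = π (C.inner x y)) (x : X) (a : A) :
    πX (C.rsmul x a) = πX x * π a := by
  have e : star (πX (C.rsmul x a) - πX x * π a) * (πX (C.rsmul x a) - πX x * π a) = 0 := by
    have h1 : star (πX (C.rsmul x a)) * πX x = star (π a) * (star (πX x) * πX x) := by
      rw [h, h, C.inner_rsmul_left, map_mul, map_star]
    have h2 : star (πX x) * πX (C.rsmul x a) = star (πX x) * πX x * π a := by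
      rw [h, h, C.inner_rsmul_right, map_mul]
    have h3 : star (πX (C.rsmul x a)) * πX (C.rsmul x a)
        = star (π a) * (star (πX x) * πX x) * π a := by
      rw [h, h, C.inner_rsmul_left, C.inner_rsmul_right, map_mul, map_mul,
        map_star, mul_assoc]
    calc _ = star (πX (C.rsmul x a)) * πX (C.rsmul x a)
          - star (πX (C.rsmul x a)) * πX x * π a - star (π a) * (star (πX x) * πX (C.rsmul x a))
          + star (π a) * (star (πX x) * πX x) * π a := by
            simp only [star_sub, star_mul, sub_mul, mul_sub, mul_assoc]
            abel
      _ = 0 := by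
        rw [h1, h2, h3]
        simp only [mul_assoc]
        abel
  rwa [CStarRing.star_mul_self_eq_zero_iff, sub_eq_zero] at e

include h in
lemma IsRepOn.map_rsmul (x : X) (a : A) : πX (C.rsmul x a) = πX x * π a :=
  map_rsmul_of_map_inner (πX := (πX : X →ₗ[ℂ] B)) h.map_inner x a

/-- The image of a finite-rank operator in a representation. -/
def finiteRankRep (πX : X →L[ℂ] B) : (X × X →₀ ℂ) →ₗ[ℂ] B :=
  Finsupp.linearCombination ℂ fun p => πX p.1 * star (πX p.2)

omit [CompleteSpace X] in
@[simp] lemma finiteRankRep_single (x y : X) (r : ℂ) :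
    finiteRankRep πX (Finsupp.single (x, y) r) = r • (πX x * star (πX y)) :=
  Finsupp.linearCombination_single ..

include h in
lemma IsRepOn.finiteRankRep_mul (c : X × X →₀ ℂ) (z : X) :
    finiteRankRep πX c * πX z = πX (C.finiteRank c z) := by
  induction c using Finsupp.induction_linear with
  | zero => simp
  | add f g hf hg => simp only [map_add, add_mul, hf, hg, add_apply]
  | single p r =>
    obtain ⟨x, y⟩ := p
    simp only [finiteRankRep_single, finiteRank_single, smul_apply, map_smul, smul_mul_assoc,
      Θ_apply, h.map_rsmul, mul_assoc, h.map_inner]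

/-- Swapping the two indices and conjugating the coefficients is the adjoint in `B` and on `X` at
once. -/
lemma finiteRank_adjoint (c : X × X →₀ ℂ) :
    ∃ c', finiteRankRep πX c' = star (finiteRankRep πX c) ∧
      ∀ x y, C.inner (C.finiteRank c x) y = C.inner x (C.finiteRank c' y) := by
  induction c using Finsupp.induction_linear with
  | zero => exact ⟨0, by simp, fun x y => by
      have h1 : C.inner x ((0 : ℂ) • (0 : X)) = 0 := by rw [C.inner_smul_right, zero_smul]
      have h2 : C.inner ((0 : ℂ) • (0 : X)) y = 0 := by
        rw [C.inner_smul_left, star_zero, zero_smul]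
      simp only [smul_zero] at h1 h2
      simp [h1, h2]⟩
  | add f g hf hg =>
    obtain ⟨f', hf1, hf2⟩ := hf
    obtain ⟨g', hg1, hg2⟩ := hg
    exact ⟨f' + g', by simp only [map_add, star_add, hf1, hg1], fun x y => by
      simp only [map_add, add_apply, C.inner_add_left, C.inner_add_right, hf2, hg2]⟩
  | single p r =>
    obtain ⟨x, y⟩ := p
    exact ⟨Finsupp.single (y, x) (star r), by simp, fun z w => by
      simp only [finiteRank_single, smul_apply, C.inner_smul_left, C.inner_smul_right, inner_Θ]⟩

lemma norm_adjoint_le {K K' : X →L[ℂ] X} (hK : ∀ x y, C.inner (K x) y = C.inner x (K' y)) :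
    ‖K'‖ ≤ ‖K‖ := by
  refine K'.opNorm_le_bound (norm_nonneg _) fun y => ?_
  have h1 : ‖K' y‖ ^ 2 ≤ ‖K‖ * ‖K' y‖ * ‖y‖ := by
    rw [C.norm_sq_eq, ← hK]
    exact (C.norm_inner_le _ _).trans (by gcongr; exact K.le_opNorm _)
  rcases (norm_nonneg (K' y)).eq_or_lt with h0 | h0
  · rw [← h0]; positivity
  · refine le_of_mul_le_mul_left ?_ h0
    linarith

lemma norm_le_of_map_inner {πX : X →ₗ[ℂ] B}
    (h : ∀ x y, star (πX x) * πX y = π (C.inner x y)) (x : X) : ‖πX x‖ ≤ ‖x‖ := by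
  refine (sq_le_sq₀ (norm_nonneg _) (norm_nonneg _)).1 ?_
  rw [C.norm_sq_eq, sq, ← CStarRing.norm_star_mul_self, h]
  exact NonUnitalStarAlgHom.norm_apply_le _ _

include h in
lemma IsRepOn.norm_le (x : X) : ‖πX x‖ ≤ ‖x‖ :=
  norm_le_of_map_inner (πX := (πX : X →ₗ[ℂ] B)) h.map_inner x

include h in
-- A crude bound, with `M` the sum of the `|r| ‖x‖ ‖y‖` over the terms of `c`. What matters is that
-- it depends on `c` only and is linear in `‖K‖`, so that it can be applied to high powers.
lemma IsRepOn.exists_mul_bound (c : X × X →₀ ℂ) : ∃ M : ℝ, 0 ≤ M ∧ ∀ (T : B) (K : X →L[ℂ] X),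
    (∀ z, T * πX z = πX (K z)) → ‖T * finiteRankRep πX c‖ ≤ M * ‖K‖ := by
  induction c using Finsupp.induction_linear with
  | zero => exact ⟨0, le_rfl, fun T K _ => by simp⟩
  | add f g hf hg =>
    obtain ⟨M, hM0, hM⟩ := hf
    obtain ⟨N, hN0, hN⟩ := hg
    refine ⟨M + N, by positivity, fun T K hTK => ?_⟩
    rw [map_add, mul_add, add_mul]
    exact (norm_add_le _ _).trans (add_le_add (hM T K hTK) (hN T K hTK))
  | single p r =>
    refine ⟨‖r‖ * ‖p.1‖ * ‖p.2‖, by positivity, fun T K hTK => ?_⟩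
    rw [finiteRankRep_single, mul_smul_comm, ← mul_assoc, hTK, norm_smul]
    calc ‖r‖ * ‖πX (K p.1) * star (πX p.2)‖ ≤ ‖r‖ * (‖πX (K p.1)‖ * ‖star (πX p.2)‖) := by
          gcongr; exact norm_mul_le _ _
      _ ≤ ‖r‖ * (‖K p.1‖ * ‖p.2‖) := by
          rw [norm_star]
          gcongr
          · exact h.norm_le _
          · exact h.norm_le _
      _ ≤ ‖r‖ * (‖K‖ * ‖p.1‖ * ‖p.2‖) := by gcongr; exact K.le_opNorm _
      _ = _ := by ring

end RepOn

/-- If the powers of a self-adjoint element grow at most like `k ^ n`, then its norm is at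
most `k`. -/
lemma norm_le_of_pow_le {B : Type*} [CStarAlgebra B] {S : B} (hS : IsSelfAdjoint S) {k M : ℝ}
    (hk : 0 ≤ k) (hM : ∀ n : ℕ, 0 < n → ‖S ^ (n + 1)‖ ≤ M * k ^ n) : ‖S‖ ≤ k := by
  by_contra! hlt
  have hr : 0 < ‖S‖ := hk.trans_lt hlt
  -- For exponents that are powers of two, the C⋆-identity turns the norm of the power into the
  -- power of the norm.
  have key : ∀ m : ℕ, ‖S‖ ^ (2 ^ (m + 1)) ≤ M * k ^ (2 ^ (m + 1) - 1) := fun m => by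
    have h2 : 2 ≤ 2 ^ (m + 1) := by
      calc 2 = 2 ^ 1 := rfl
        _ ≤ 2 ^ (m + 1) := Nat.pow_le_pow_right two_pos (by omega)
    have h1 := hM (2 ^ (m + 1) - 1) (by omega)
    rw [Nat.sub_add_cancel (by omega)] at h1
    have h3 : ‖S ^ 2 ^ (m + 1)‖ = ‖S‖ ^ 2 ^ (m + 1) := by
      have := congrArg NNReal.toReal (hS.nnnorm_pow_two_pow (m + 1))
      rwa [NNReal.coe_pow, coe_nnnorm, coe_nnnorm] at this
    rwa [h3] at h1
  rcases hk.eq_or_lt with rfl | hk0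
  · have := key 0
    norm_num at this
    rw [this] at hr
    simp at hr
  · have hone : 1 < ‖S‖ / k := (one_lt_div hk0).2 hlt
    obtain ⟨N, hN⟩ := pow_unbounded_of_one_lt (M / ‖S‖) hone
    have h1 := key N
    have hle : N ≤ 2 ^ (N + 1) - 1 := by
      have := (Nat.lt_two_pow_self (n := N + 1))
      omega
    set n := 2 ^ (N + 1) - 1 with hn
    have h2 : 2 ^ (N + 1) = n + 1 := by
      have : 0 < 2 ^ (N + 1) := by positivity
      omega
    rw [h2, pow_succ] at h1
    have h3 : M / ‖S‖ < (‖S‖ / k) ^ n := hN.trans_le (pow_le_pow_right₀ hone.le hle)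
    rw [div_pow, div_lt_div_iff₀ hr (by positivity)] at h3
    linarith

variable {C}

/-- Apply the crude bound to `(T* T)^n T*`, which acts on `π_X(X)` as `(K' K)^n K'`. The constant
disappears on taking roots, leaving `‖T* T‖ ≤ ‖K' K‖ ≤ ‖K‖²`. In particular the image of `∑ r
Θ_{x,y}` does not depend on how the operator is written. The unit of `B` gives sense to the zeroth
power. -/
lemma IsRepOn.norm_finiteRankRep_le_of_unital {B : Type*} [CStarAlgebra B] {π : A →⋆ₙₐ[ℂ] B}
    {πX : X →L[ℂ] B} (h : C.IsRepOn π πX) (c : X × X →₀ ℂ) :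
    ‖finiteRankRep πX c‖ ≤ ‖C.finiteRank c‖ := by
  obtain ⟨c', hc1, hc2⟩ := C.finiteRank_adjoint (πX := πX) c
  set T := finiteRankRep πX c with hT
  set K := C.finiteRank c with hK
  set K' := C.finiteRank c' with hK'
  have hS : IsSelfAdjoint (star T * T) := IsSelfAdjoint.star_mul_self T
  have hpow : ∀ (n : ℕ) (z : X), (star T * T) ^ n * πX z = πX (((K' * K) ^ n) z) := by
    intro n
    induction n with
    | zero => intro z; simp
    | succ n ih =>
      intro z
      rw [pow_succ, mul_assoc, mul_assoc, h.finiteRankRep_mul, ← hc1, h.finiteRankRep_mul, hc1, ih,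
        pow_succ]
      rfl
  obtain ⟨M, hM0, hM⟩ := h.exists_mul_bound c
  have h1 : ‖star T * T‖ ≤ ‖K' * K‖ := by
    refine norm_le_of_pow_le (M := M * ‖K'‖) hS (norm_nonneg _) fun n hn => ?_
    have h2 := hM ((star T * T) ^ n * star T) ((K' * K) ^ n * K') fun z => by
      rw [mul_assoc, ← hc1, h.finiteRankRep_mul, hc1, hpow]
      rfl
    calc ‖(star T * T) ^ (n + 1)‖ = ‖(star T * T) ^ n * star T * T‖ := by
          rw [pow_succ, ← mul_assoc]
      _ ≤ M * ‖(K' * K) ^ n * K'‖ := h2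
      _ ≤ M * (‖K' * K‖ ^ n * ‖K'‖) := by
          gcongr
          exact (norm_mul_le _ _).trans (by gcongr; exact norm_pow_le' _ hn)
      _ = _ := by ring
  have h2 : ‖T‖ ^ 2 ≤ ‖K‖ ^ 2 := by
    calc ‖T‖ ^ 2 = ‖star T * T‖ := by rw [CStarRing.norm_star_mul_self, sq]
      _ ≤ ‖K'‖ * ‖K‖ := h1.trans (norm_mul_le _ _)
      _ ≤ ‖K‖ * ‖K‖ := by gcongr; exact C.norm_adjoint_le hc2
      _ = ‖K‖ ^ 2 := by ring
  exact (sq_le_sq₀ (norm_nonneg _) (norm_nonneg _)).1 h2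

lemma IsRepOn.comp {B D : Type*} [NonUnitalCStarAlgebra B] [NonUnitalCStarAlgebra D]
    {π : A →⋆ₙₐ[ℂ] B} {πX : X →L[ℂ] B} (h : C.IsRepOn π πX) (σ : B →⋆ₙₐ[ℂ] D) :
    C.IsRepOn (σ.comp π) ((homCLM σ).comp πX) where
  map_inner x y := by
    change star (σ (πX x)) * σ (πX y) = σ (π _)
    rw [← h.map_inner, map_mul, map_star]
  map_left a x := by
    change σ (πX _) = σ (π a) * σ (πX x)
    rw [h.map_left, map_mul]

variable {B : Type*} [NonUnitalCStarAlgebra B] {π : A →⋆ₙₐ[ℂ] B} {πX : X →L[ℂ] B}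

/-- Pass to the unitization, into which `B` embeds isometrically. -/
lemma IsRepOn.norm_finiteRankRep_le (h : C.IsRepOn π πX) (c : X × X →₀ ℂ) :
    ‖finiteRankRep πX c‖ ≤ ‖C.finiteRank c‖ := by
  have h1 := (h.comp (Unitization.inrNonUnitalStarAlgHom ℂ B)).norm_finiteRankRep_le_of_unital c
  have h2 : finiteRankRep ((homCLM (Unitization.inrNonUnitalStarAlgHom ℂ B)).comp πX) c
      = Unitization.inrNonUnitalStarAlgHom ℂ B (finiteRankRep πX c) := by
    clear h1
    induction c using Finsupp.induction_linear with
    | zero => simp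
    | add f g hf hg => simp only [map_add, hf, hg]
    | single p r =>
      rw [finiteRankRep_single, finiteRankRep_single, map_smul, map_mul, map_star]
      rfl
  rw [h2] at h1
  simpa [Unitization.norm_inr] using h1

instance : NormedAddCommGroup C.compacts := Submodule.normedAddCommGroup _
instance : NormedSpace ℂ C.compacts := Submodule.normedSpace _

/-- The linear map `K(X) → B` with `Θ_{x,y} ↦ π_X(x) π_X(y)*` for a representation `(π, π_X)`. -/
def compactRep (C : CStarCorrespondence A X) (πX : X →L[ℂ] B) : C.compacts →L[ℂ] B :=
  (finiteRankRep πX).extendOfNorm C.finiteRankCompact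

lemma IsRepOn.compactRep_finiteRank (h : C.IsRepOn π πX) (c : X × X →₀ ℂ) :
    C.compactRep πX (C.finiteRankCompact c) = finiteRankRep πX c := by
  unfold compactRep
  exact LinearMap.extendOfNorm_eq C.denseRange_finiteRankCompact
    ⟨1, fun c => by rw [one_mul]; exact h.norm_finiteRankRep_le c⟩ c

lemma IsRepOn.compactRep_Θ (h : C.IsRepOn π πX) (x y : X) :
    C.compactRep πX ⟨C.Θ x y, C.Θ_mem x y⟩ = πX x * star (πX y) := by
  have h1 := h.compactRep_finiteRank (Finsupp.single (x, y) 1)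
  have h2 : C.finiteRankCompact (Finsupp.single (x, y) 1) = ⟨C.Θ x y, C.Θ_mem x y⟩ :=
    Subtype.ext (by simp [finiteRankCompact])
  rw [h2] at h1
  simpa using h1

lemma IsRepOn.compactRep_mul (h : C.IsRepOn π πX) (K : C.compacts) (x : X) :
    C.compactRep πX K * πX x = πX (K.1 x) := by
  refine C.denseRange_finiteRankCompact.induction_on (p := fun K : C.compacts =>
    C.compactRep πX K * πX x = πX (K.1 x)) K ?_ fun c => ?_
  · refine isClosed_eq (by fun_prop) (πX.continuous.comp ?_)
    exact (ContinuousLinearMap.apply ℂ X x).continuous.comp continuous_subtype_val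
  · rw [h.compactRep_finiteRank, h.finiteRankRep_mul]
    rfl

/-- Continuous linear maps on `K(X)` agree if they agree on the `Θ_{x,y}`. -/
lemma compacts_clm_ext {F : Type*} [NormedAddCommGroup F] [NormedSpace ℂ F]
    {f g : C.compacts →L[ℂ] F}
    (h : ∀ x y, f ⟨C.Θ x y, C.Θ_mem x y⟩ = g ⟨C.Θ x y, C.Θ_mem x y⟩) (K : C.compacts) :
    f K = g K := by
  refine C.denseRange_finiteRankCompact.induction_on (p := fun K : C.compacts => f K = g K) K
    (isClosed_eq f.continuous g.continuous) fun c => ?_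
  induction c using Finsupp.induction_linear with
  | zero => simp
  | add c d hc hd => simp only [map_add, hc, hd]
  | single p r =>
    have h2 : C.finiteRankCompact (Finsupp.single p r) = r • ⟨C.Θ p.1 p.2, C.Θ_mem _ _⟩ :=
      Subtype.ext (by
        change C.finiteRank (Finsupp.single (p.1, p.2) r) = _
        rw [finiteRank_single]
        rfl)
    rw [h2, map_smul, map_smul, h]

lemma IsRepOn.norm_eq_of_injective (h : C.IsRepOn π πX) (hπ : ∀ a, ‖π a‖ = ‖a‖) (x : X) :
    ‖πX x‖ = ‖x‖ := by
  refine (sq_eq_sq₀ (norm_nonneg _) (norm_nonneg _)).1 ?_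
  rw [C.norm_sq_eq, sq, ← CStarRing.norm_star_mul_self, h.map_inner, hπ]

/-- If `π` is isometric, so is `π_X`, and `K` is seen as left multiplication on the isometric copy
of `X`. -/
lemma IsRepOn.norm_le_compactRep (h : C.IsRepOn π πX) (hπ : ∀ a, ‖π a‖ = ‖a‖) (K : C.compacts) :
    ‖K‖ ≤ ‖C.compactRep πX K‖ := by
  refine K.1.opNorm_le_bound (norm_nonneg _) fun x => ?_
  rw [← h.norm_eq_of_injective hπ, ← h.compactRep_mul, ← h.norm_eq_of_injective hπ x]
  exact norm_mul_le _ _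

lemma IsRepOn.isClosed_range_compactRep (h : C.IsRepOn π πX) (hπ : ∀ a, ‖π a‖ = ‖a‖) :
    IsClosed (Set.range (C.compactRep πX)) := by
  have : CompleteSpace C.compacts :=
    (Submodule.isClosed_topologicalClosure _).completeSpace_coe
  have h1 : AntilipschitzWith 1 (C.compactRep πX) :=
    AddMonoidHomClass.antilipschitz_of_bound _ fun K => by
      simpa using h.norm_le_compactRep hπ K
  exact h1.isClosed_range (C.compactRep πX).uniformContinuous

end CStarCorrespondence

end CorrespondenceReps

/-! ### Smallness of generated C⋆-algebras and of Hilbert spaces -/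

section Small

/-- A point of the closure is determined by a sequence in `α` whose image converges to it, and there
are only `u`-many sequences. -/
lemma small_closure_range {α : Type*} [Small.{u} α] {Y : Type*} [PseudoMetricSpace Y] [T2Space Y]
    (f : α → Y) : Small.{u} (closure (Set.range f)) := by
  have h : ∀ y : closure (Set.range f), ∃ s : ℕ → α, Tendsto (fun n => f (s n)) atTop (𝓝 y.1) := by
    intro y
    obtain ⟨s, hs, hy⟩ := mem_closure_iff_seq_limit.1 y.2
    choose t ht using hs
    exact ⟨t, by simpa only [ht] using hy⟩
  choose s hs using h
  refine small_of_injective (f := s) fun y z hyz => ?_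
  refine Subtype.ext (tendsto_nhds_unique (hs y) ?_)
  rw [hyz]
  exact hs z

lemma small_of_denseRange {α : Type*} [Small.{u} α] {Y : Type*} [PseudoMetricSpace Y] [T2Space Y]
    (f : α → Y) (hf : DenseRange f) : Small.{u} Y := by
  have := small_closure_range f
  exact small_of_injective (f := fun y => (⟨y, hf y⟩ : closure (Set.range f)))
    fun x y h => congrArg Subtype.val h

/-- Formal ⋆-polynomial expressions without constant term. -/
inductive StarExpr (ι : Type u) : Type u
  | of (i : ι) : StarExpr ι
  | zero : StarExpr ι
  | add (x y : StarExpr ι) : StarExpr ι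
  | mul (x y : StarExpr ι) : StarExpr ι
  | smul (c : ℂ) (x : StarExpr ι) : StarExpr ι
  | star (x : StarExpr ι) : StarExpr ι

/-- Evaluation of formal ⋆-polynomials. -/
def StarExpr.eval {ι : Type u} {B : Type v} [NonUnitalCStarAlgebra B] (f : ι → B) :
    StarExpr ι → B
  | .of i => f i
  | .zero => 0
  | .add x y => x.eval f + y.eval f
  | .mul x y => x.eval f * y.eval f
  | .smul c x => c • x.eval f
  | .star x => Star.star (x.eval f)

lemma small_cstarGenerated {B : Type v} [NonUnitalCStarAlgebra B] (s : Set B) [Small.{u} s] :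
    Small.{u} (cstarGenerated s) := by
  let f : Shrink.{u} s → B := fun i => ((equivShrink s).symm i).1
  have h : ∀ x ∈ NonUnitalStarAlgebra.adjoin ℂ s, x ∈ Set.range (StarExpr.eval f) := by
    intro x hx
    induction hx using NonUnitalStarAlgebra.adjoin_induction with
    | mem x hx => exact ⟨.of (equivShrink s ⟨x, hx⟩), by simp [StarExpr.eval, f]⟩
    | add x y _ _ h1 h2 =>
      obtain ⟨x, rfl⟩ := h1
      obtain ⟨y, rfl⟩ := h2
      exact ⟨.add x y, rfl⟩
    | zero => exact ⟨.zero, rfl⟩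
    | mul x y _ _ h1 h2 =>
      obtain ⟨x, rfl⟩ := h1
      obtain ⟨y, rfl⟩ := h2
      exact ⟨.mul x y, rfl⟩
    | smul r x _ h =>
      obtain ⟨x, rfl⟩ := h
      exact ⟨.smul r x, rfl⟩
    | star x _ h =>
      obtain ⟨x, rfl⟩ := h
      exact ⟨.star x, rfl⟩
  have h1 := small_closure_range (StarExpr.eval f)
  have h2 : ∀ x : cstarGenerated s, x.1 ∈ closure (Set.range (StarExpr.eval f)) := fun x =>
    closure_mono h x.2
  exact small_of_injective
    (f := fun x : cstarGenerated s => (⟨x.1, h2 x⟩ : closure (Set.range (StarExpr.eval f))))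
    fun x y hxy => Subtype.ext (Subtype.mk.inj hxy)

/-- A small Hilbert space is isometrically isomorphic to one in the small universe. -/
lemma exists_equiv_l2_of_small (H : Type v) [NormedAddCommGroup H] [InnerProductSpace ℂ H]
    [CompleteSpace H] [Small.{u} H] :
    ∃ ι : Type u, Nonempty (H ≃ₗᵢ[ℂ] lp (fun _ : ι => ℂ) 2) := by
  obtain ⟨w, b, -⟩ := exists_hilbertBasis ℂ H
  let e := equivShrink.{u} w
  have h1 : Orthonormal ℂ fun i => b (e.symm i) := b.orthonormal.comp _ e.symm.injective
  have h2 : Set.range (fun i => b (e.symm i)) = Set.range b := e.symm.surjective.range_comp b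
  have b' : HilbertBasis (Shrink.{u} w) ℂ H := HilbertBasis.mk h1 (by
    rw [h2, b.dense_span])
  exact ⟨_, ⟨b'.repr⟩⟩

end Small

/-! ### The GNS representation -/

section GNS

variable {B : Type v} [NonUnitalCStarAlgebra B] [PartialOrder B] [StarOrderedRing B]
  (f : B →ₚ[ℂ] ℂ)

lemma norm_toPreGNS_le : ∃ K : ℝ, ∀ b : B, ‖f.toPreGNS b‖ ≤ K * ‖b‖ := by
  obtain ⟨C, hC⟩ := f.exists_norm_apply_le
  refine ⟨√C, fun b => ?_⟩
  have h1 : ‖f.toPreGNS b‖ ^ 2 ≤ C * ‖b‖ ^ 2 := by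
    have h2 := f.preGNS_norm_sq (f.toPreGNS b)
    have h3 : ‖f.toPreGNS b‖ ^ 2 = ‖f (star b * b)‖ := by
      rw [f.ofPreGNS_toPreGNS] at h2
      rw [← h2]
      simp
    rw [h3, sq, ← CStarRing.norm_star_mul_self]
    exact hC _
  rw [← Real.sqrt_sq (norm_nonneg b), ← Real.sqrt_mul (by positivity)]
  exact Real.le_sqrt_of_sq_le h1

/-- The canonical map of a C⋆-algebra into the GNS space. -/
def gnsMk : B →L[ℂ] f.GNS :=
  UniformSpace.Completion.toComplL.comp
    (LinearMap.mkContinuousOfExistsBound (f.toPreGNS : B →ₗ[ℂ] f.PreGNS) (norm_toPreGNS_le f))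

lemma gnsMk_apply (b : B) : gnsMk f b = (f.toPreGNS b : f.GNS) := rfl

lemma denseRange_gnsMk : DenseRange (gnsMk f) :=
  UniformSpace.Completion.denseRange_coe.comp f.toPreGNS.surjective.denseRange
    (UniformSpace.Completion.continuous_coe _)

@[simp] lemma gns_apply_gnsMk (a b : B) :
    f.gnsNonUnitalStarAlgHom a (gnsMk f b) = gnsMk f (a * b) := by
  rw [gnsMk_apply, f.gnsNonUnitalStarAlgHom_apply_coe]
  rfl

lemma inner_gnsMk (a b : B) : inner ℂ (gnsMk f a) (gnsMk f b) = f (star a * b) := by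
  rw [gnsMk_apply, gnsMk_apply, UniformSpace.Completion.inner_coe]
  rfl

/-- Without a unit there is no evident cyclic vector; the approximate unit replaces it. -/
lemma gns_ne_zero {x : B} (hx : f (star x * x) ≠ 0) : f.gnsNonUnitalStarAlgHom x ≠ 0 := by
  intro h0
  have h1 : ∀ b : B, f (star (x * b) * (x * b)) = 0 := fun b => by
    rw [← inner_gnsMk, ← gns_apply_gnsMk, h0]
    simp
  have hl := CStarAlgebra.increasingApproximateUnit B
  have h2 : Tendsto (fun e : B => x * e) (CStarAlgebra.approximateUnit B) (𝓝 x) :=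
    hl.tendsto_mul_left x
  have h3 : Continuous fun y : B => f (star y * y) := by
    have := map_continuous f
    fun_prop
  have h4 := (h3.tendsto x).comp h2
  have := hl.neBot
  have h5 : Tendsto (fun _ : B => (0 : ℂ)) (CStarAlgebra.approximateUnit B) (𝓝 0) :=
    tendsto_const_nhds
  exact hx (tendsto_nhds_unique h4 (h5.congr fun e => (h1 e).symm))

/-- If `π : A → B` maps an approximate unit of `A` to an approximate unit of `B`, then the GNS
representation is non-degenerate on `A`. -/
lemma gns_nondegenerate {A : Type u} [NonUnitalCStarAlgebra A] (π : A →⋆ₙₐ[ℂ] B)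
    {l : Filter A} [l.NeBot] (hl : ∀ b : B, Tendsto (fun e => π e * b) l (𝓝 b)) :
    (Submodule.span ℂ {x : f.GNS | ∃ a h, x = f.gnsNonUnitalStarAlgHom (π a) h}).topologicalClosure
      = ⊤ := by
  rw [eq_top_iff]
  rintro x -
  refine (denseRange_gnsMk f).induction_on (p := fun x : f.GNS =>
    x ∈ (Submodule.span ℂ {x : f.GNS | ∃ a h, x = f.gnsNonUnitalStarAlgHom (π a) h}).topologicalClosure) x
    (Submodule.isClosed_topologicalClosure _) fun b => ?_
  have h1 := ((gnsMk f).continuous.tendsto b).comp (hl b)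
  refine mem_closure_of_tendsto h1 (Eventually.of_forall fun e => ?_)
  exact Submodule.subset_span ⟨e, gnsMk f b, by simp⟩

end GNS

/-! ### The Fock representation -/

section Fock

variable {A : Type u} [NonUnitalCStarAlgebra A] [PartialOrder A] [StarOrderedRing A]
  (E : ExelSystem A)

/-- Formally `L(α(b)* α(b)) = b* L(1) b ≤ ‖L‖ b* b`. The constant is uniform in `f`, which later
makes the creation operator bounded on the infinite direct sum. -/
lemma ExelSystem.exists_norm_gnsMk_le : ∃ C : ℝ, 0 ≤ C ∧ ∀ (f : A →ₚ[ℂ] ℂ) (b : A),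
    ‖gnsMk (f.comp E.L) (E.α b)‖ ≤ C * ‖gnsMk f b‖ := by
  obtain ⟨C, hC⟩ := E.L.exists_norm_apply_le
  refine ⟨√C, by positivity, fun f b => ?_⟩
  have hsq : ∀ (g : A →ₚ[ℂ] ℂ) (x : A), ‖gnsMk g x‖ ^ 2 = (g (star x * x)).re := fun g x => by
    rw [← inner_gnsMk, inner_self_eq_norm_sq_to_K]
    simp [← Complex.ofReal_pow]
  refine (sq_le_sq₀ (norm_nonneg _) (by positivity)).1 ?_
  rw [mul_pow, Real.sq_sqrt C.coe_nonneg, hsq, hsq]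
  have hl := CStarAlgebra.increasingApproximateUnit A
  have := hl.neBot
  -- In place of `L(1)`: insert `e` between the two factors, use `L(α(b)* e α(b)) = b* L(e) b`, and
  -- pass to the limit.
  have h2 : Tendsto (fun e : A => e * E.α b) (CStarAlgebra.approximateUnit A) (𝓝 (E.α b)) :=
    hl.tendsto_mul_right _
  have h3 : Continuous fun y : A => (f (E.L (star (E.α b) * y))).re := by
    have h1 := map_continuous f
    have h2 := map_continuous E.L
    exact Complex.continuous_re.comp (h1.comp (h2.comp (by fun_prop)))
  refine le_of_tendsto ((h3.tendsto _).comp h2) ?_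
  filter_upwards [hl.eventually_norm, hl.eventually_star_eq] with e he1 he2
  have h4 : E.L (star (E.α b) * (e * E.α b)) = star b * E.L e * b := by
    rw [← mul_assoc, E.transfer, ← map_star, E.transfer']
  simp only [Function.comp_apply]
  rw [h4]
  have h5 : IsSelfAdjoint (E.L e) := by
    rw [IsSelfAdjoint, ← map_star, he2]
  have h6 : star b * E.L e * b ≤ (C : ℝ) • (star b * b) := by
    refine (CStarAlgebra.star_left_conjugate_le_norm_smul h5).trans ?_
    refine smul_le_smul_of_nonneg_right ?_ (star_mul_self_nonneg b)
    calc ‖E.L e‖ ≤ C * ‖e‖ := hC e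
      _ ≤ C * 1 := by gcongr
      _ = C := mul_one _
  have h7 := OrderHomClass.mono f h6
  rw [PositiveLinearMap.map_smul_of_tower] at h7
  simpa using (Complex.le_def.1 h7).1

/-- The operator from the GNS space of `f` to that of `f ∘ L` with `b ↦ α(b)`. -/
def ExelSystem.creation (f : A →ₚ[ℂ] ℂ) : f.GNS →L[ℂ] (f.comp E.L).GNS :=
  ((gnsMk (f.comp E.L) : A →ₗ[ℂ] (f.comp E.L).GNS).comp (E.α : A →ₗ[ℂ] A)).extendOfNorm
    (gnsMk f : A →ₗ[ℂ] f.GNS)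

lemma ExelSystem.creation_gnsMk (f : A →ₚ[ℂ] ℂ) (b : A) :
    E.creation f (gnsMk f b) = gnsMk (f.comp E.L) (E.α b) := by
  obtain ⟨C, -, hC⟩ := E.exists_norm_gnsMk_le
  exact LinearMap.extendOfNorm_eq (denseRange_gnsMk f) ⟨C, hC f⟩ b

lemma ExelSystem.exists_norm_creation_le : ∃ C : ℝ, 0 ≤ C ∧ ∀ (f : A →ₚ[ℂ] ℂ) (x : f.GNS),
    ‖E.creation f x‖ ≤ C * ‖x‖ := by
  obtain ⟨C, hC0, hC⟩ := E.exists_norm_gnsMk_le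
  exact ⟨C, hC0, fun f x => LinearMap.norm_extendOfNorm_apply_le (denseRange_gnsMk f) C (hC f) x⟩

/-- On the dense image of `A` this is `L(α(b)* a α(c)) = b* L(a) c`; it is the relation `S* π(a) S =
π(L(a))` one level at a time. -/
lemma ExelSystem.inner_creation (f : A →ₚ[ℂ] ℂ) (a : A) (x y : f.GNS) :
    inner ℂ (E.creation f x) ((f.comp E.L).gnsNonUnitalStarAlgHom a (E.creation f y))
      = inner ℂ x (f.gnsNonUnitalStarAlgHom (E.L a) y) := by
  refine (denseRange_gnsMk f).induction_on₂ (p := fun x y : f.GNS =>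
    inner ℂ (E.creation f x) ((f.comp E.L).gnsNonUnitalStarAlgHom a (E.creation f y))
      = inner ℂ x (f.gnsNonUnitalStarAlgHom (E.L a) y)) ?_ (fun b c => ?_) x y
  · exact isClosed_eq (by fun_prop) (by fun_prop)
  · rw [E.creation_gnsMk, E.creation_gnsMk, gns_apply_gnsMk, gns_apply_gnsMk, inner_gnsMk,
      inner_gnsMk]
    change f (E.L _) = _
    rw [← mul_assoc, E.transfer, ← map_star, E.transfer', mul_assoc]

/-- The functionals `f ∘ L^n`. -/
def ExelSystem.iter (f : A →ₚ[ℂ] ℂ) : ℕ → (A →ₚ[ℂ] ℂ)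
  | 0 => f
  | n + 1 => (ExelSystem.iter f n).comp E.L

/-- The Fock space of a positive functional. -/
abbrev ExelSystem.Fock (f : A →ₚ[ℂ] ℂ) : Type u := lp (fun n => (E.iter f n).GNS) 2

variable (f : A →ₚ[ℂ] ℂ)

lemma ExelSystem.fock_norm_sq (x : E.Fock f) : HasSum (fun n => ‖x n‖ ^ 2) (‖x‖ ^ 2) := by
  have := lp.hasSum_norm (p := 2) (by norm_num) x
  simpa using this

lemma ExelSystem.memℓp_of_summable {x : ∀ n, (E.iter f n).GNS} (hx : Summable fun n => ‖x n‖ ^ 2) :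
    Memℓp x 2 := memℓp_gen (by simpa using hx)

lemma norm_diag_le (a : A) (x : E.Fock f) (n : ℕ) :
    ‖(E.iter f n).gnsNonUnitalStarAlgHom a (x n)‖ ≤ ‖((‖a‖ : ℂ) • x) n‖ := by
  rw [lp.coeFn_smul, Pi.smul_apply, norm_smul]
  simp only [Complex.norm_real, norm_norm]
  exact (ContinuousLinearMap.le_opNorm _ _).trans
    (by gcongr; exact NonUnitalStarAlgHom.norm_apply_le _ _)

/-- Diagonal operators on the Fock space. -/
def ExelSystem.fockDiag (a : A) : E.Fock f →L[ℂ] E.Fock f :=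
  LinearMap.mkContinuous
    { toFun := fun x => ⟨fun n => (E.iter f n).gnsNonUnitalStarAlgHom a (x n),
        (lp.memℓp ((‖a‖ : ℂ) • x)).mono' (norm_diag_le E f a x)⟩
      map_add' := fun x y => lp.ext (funext fun n => map_add _ (x n) (y n))
      map_smul' := fun c x => lp.ext (funext fun n => map_smul _ c (x n)) }
    ‖a‖ (fun x => by
      refine (lp.norm_mono (by norm_num) (norm_diag_le E f a x)).trans ?_
      rw [norm_smul]
      simp)

@[simp] lemma ExelSystem.fockDiag_apply (a : A) (x : E.Fock f) (n : ℕ) :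
    E.fockDiag f a x n = (E.iter f n).gnsNonUnitalStarAlgHom a (x n) := rfl

/-- The representation of `A` on the Fock space. -/
def ExelSystem.fockRep : A →⋆ₙₐ[ℂ] (E.Fock f →L[ℂ] E.Fock f) where
  toFun := E.fockDiag f
  map_smul' c a := by
    ext x n
    simp
  map_zero' := by
    ext x n
    simp
  map_add' a b := by
    ext x n
    simp
  map_mul' a b := by
    ext x n
    simp
  map_star' a := by
    refine (ContinuousLinearMap.eq_adjoint_iff _ _).2 fun x y => ?_
    rw [lp.inner_eq_tsum, lp.inner_eq_tsum]
    refine tsum_congr fun n => ?_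
    simp only [fockDiag_apply, map_star, ContinuousLinearMap.star_eq_adjoint]
    rw [ContinuousLinearMap.adjoint_inner_left]

/-- The components of the image of `x` under the creation operator. -/
def ExelSystem.fockShiftFun (x : E.Fock f) : ∀ n, (E.iter f n).GNS
  | 0 => 0
  | n + 1 => E.creation (E.iter f n) (x n)

lemma ExelSystem.exists_fockShift : ∃ T : E.Fock f →L[ℂ] E.Fock f,
    ∀ x n, T x n = E.fockShiftFun f x n := by
  obtain ⟨C, hC0, hC⟩ := E.exists_norm_creation_le
  have h1 : ∀ x : E.Fock f, HasSum (fun n => C ^ 2 * ‖x n‖ ^ 2) (C ^ 2 * ‖x‖ ^ 2) := fun x =>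
    (E.fock_norm_sq f x).mul_left _
  have h2 : ∀ (x : E.Fock f) (n : ℕ), ‖E.fockShiftFun f x (n + 1)‖ ^ 2 ≤ C ^ 2 * ‖x n‖ ^ 2 :=
    fun x n => by
      rw [← mul_pow]
      exact pow_le_pow_left₀ (norm_nonneg _) (hC _ _) 2
  have h3 : ∀ x : E.Fock f, Summable fun n => ‖E.fockShiftFun f x (n + 1)‖ ^ 2 := fun x =>
    Summable.of_nonneg_of_le (fun n => by positivity) (h2 x) (h1 x).summable
  have h4 : ∀ x : E.Fock f, Summable fun n => ‖E.fockShiftFun f x n‖ ^ 2 := fun x =>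
    (summable_nat_add_iff 1).1 (h3 x)
  let T : E.Fock f →ₗ[ℂ] E.Fock f :=
    { toFun := fun x => ⟨E.fockShiftFun f x, E.memℓp_of_summable f (h4 x)⟩
      map_add' := fun x y => lp.ext (funext fun n => by
        cases n with
        | zero => exact (add_zero (0 : (E.iter f 0).GNS)).symm
        | succ n => exact map_add (E.creation (E.iter f n)) (x n) (y n))
      map_smul' := fun c x => lp.ext (funext fun n => by
        cases n with
        | zero => exact (smul_zero (A := (E.iter f 0).GNS) c).symm
        | succ n => exact map_smul (E.creation (E.iter f n)) c (x n)) }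
  refine ⟨T.mkContinuous C fun x => ?_, fun x n => rfl⟩
  refine (sq_le_sq₀ (norm_nonneg _) (by positivity)).1 ?_
  rw [mul_pow, ← (h1 x).tsum_eq, ← (E.fock_norm_sq f (T x)).tsum_eq]
  change ∑' n, ‖E.fockShiftFun f x n‖ ^ 2 ≤ _
  rw [(h4 x).tsum_eq_zero_add]
  have h5 : ‖E.fockShiftFun f x 0‖ ^ 2 = 0 := by simp [fockShiftFun]
  rw [h5, zero_add]
  exact (h3 x).tsum_le_tsum (h2 x) (h1 x).summable

/-- The creation operator on the Fock space. -/
def ExelSystem.fockShift : E.Fock f →L[ℂ] E.Fock f := (E.exists_fockShift f).choose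

lemma ExelSystem.fockShift_zero (x : E.Fock f) : E.fockShift f x 0 = 0 :=
  (E.exists_fockShift f).choose_spec x 0

lemma ExelSystem.fockShift_succ (x : E.Fock f) (n : ℕ) :
    E.fockShift f x (n + 1) = E.creation (E.iter f n) (x n) :=
  (E.exists_fockShift f).choose_spec x (n + 1)

/-- Vectors in a single summand coming from `A` are reached by the approximate unit, and they span a
dense subspace. -/
lemma ExelSystem.fock_nondegenerate :
    (Submodule.span ℂ {x : E.Fock f | ∃ a h, x = E.fockRep f a h}).topologicalClosure = ⊤ := by
  rw [eq_top_iff]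
  rintro x -
  set K := (Submodule.span ℂ {x : E.Fock f | ∃ a h, x = E.fockRep f a h}).topologicalClosure
  have hK : IsClosed (K : Set (E.Fock f)) := Submodule.isClosed_topologicalClosure _
  have h1 : ∀ (n : ℕ) (y : (E.iter f n).GNS), (lp.single 2 n y : E.Fock f) ∈ K := by
    intro n y
    have hc : Continuous fun y : (E.iter f n).GNS => (lp.single 2 n y : E.Fock f) :=
      (lp.singleContinuousLinearMap ℂ (fun n => (E.iter f n).GNS) 2 n).continuous
    refine (denseRange_gnsMk _).induction_on (p := fun y : (E.iter f n).GNS =>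
      (lp.single 2 n y : E.Fock f) ∈ K) y (hK.preimage hc) fun b => ?_
    have hl := CStarAlgebra.increasingApproximateUnit A
    have := hl.neBot
    have h2 : Tendsto (fun e : A => e * b) (CStarAlgebra.approximateUnit A) (𝓝 b) :=
      hl.tendsto_mul_right b
    have h3 := ((hc.comp (gnsMk (E.iter f n)).continuous).tendsto b).comp h2
    refine mem_closure_of_tendsto h3 (Eventually.of_forall fun e => ?_)
    refine Submodule.subset_span ⟨e, lp.single 2 n (gnsMk _ b), ?_⟩
    refine lp.ext (funext fun m => ?_)
    change _ = (E.iter f m).gnsNonUnitalStarAlgHom e ((lp.single 2 n (gnsMk _ b) : E.Fock f) m)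
    simp only [Function.comp_apply]
    by_cases hm : m = n
    · subst hm
      rw [lp.single_apply_self, lp.single_apply_self, gns_apply_gnsMk]
    · rw [lp.single_apply_ne _ _ _ hm, lp.single_apply_ne _ _ _ hm, map_zero]
  have h2 := lp.hasSum_single (p := 2) (by norm_num) x
  exact hK.mem_of_tendsto h2 (Eventually.of_forall fun s => K.sum_mem fun n _ => h1 n _)

lemma l2_inner_eq_of_shift {G : ℕ → Type*} [∀ n, NormedAddCommGroup (G n)]
    [∀ n, InnerProductSpace ℂ (G n)] (x y x' y' : lp G 2) (h0 : inner ℂ (x' 0) (y' 0) = 0)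
    (h : ∀ n, inner ℂ (x' (n + 1)) (y' (n + 1)) = inner ℂ (x n) (y n)) :
    inner ℂ x' y' = inner ℂ x y := by
  have h1 := (hasSum_nat_add_iff' 1).2 (lp.hasSum_inner (𝕜 := ℂ) x' y')
  rw [Finset.sum_range_one, h0, sub_zero] at h1
  simp only [h] at h1
  exact h1.unique (lp.hasSum_inner x y)

lemma ExelSystem.inner_fockShift (a : A) (x y : E.Fock f) :
    inner ℂ (E.fockShift f y) (E.fockRep f a (E.fockShift f x))
      = inner ℂ y (E.fockRep f (E.L a) x) := by
  refine l2_inner_eq_of_shift _ _ _ _ ?_ fun n => ?_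
  · rw [E.fockShift_zero, inner_zero_left]
  · change inner ℂ (E.fockShift f y (n + 1))
      ((E.iter f (n + 1)).gnsNonUnitalStarAlgHom a (E.fockShift f x (n + 1)))
        = inner ℂ (y n) ((E.iter f n).gnsNonUnitalStarAlgHom (E.L a) (x n))
    rw [E.fockShift_succ, E.fockShift_succ]
    exact E.inner_creation (E.iter f n) a (y n) (x n)

/-- The Fock representation as a representation of `(A, L)`. -/
def ExelSystem.fock : CPRep E.L where
  H := E.Fock f
  π := E.fockRep f
  nondegenerate := E.fock_nondegenerate f
  S := E.fockShift f
  star_mul_mul a := by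
    refine ContinuousLinearMap.ext fun x => ext_inner_left ℂ fun y => ?_
    rw [← E.inner_fockShift f a x y]
    exact ContinuousLinearMap.adjoint_inner_right (E.fockShift f) y
      (E.fockRep f a (E.fockShift f x))

/-- A nonzero `a` acts nontrivially in the GNS representation of some `f`, and this is the zeroth
summand of a Fock representation. The further summands are there only to carry an operator `S`. -/
lemma ExelSystem.cpUnivπ_injective : Function.Injective (cpUnivπ E.L) := by
  refine (injective_iff_map_eq_zero _).2 fun a ha => ?_
  by_contra hne
  obtain ⟨f, -, hf⟩ := (ClosedIdeal.zero A).exists_positive_functional a hne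
  refine gns_ne_zero f hf (ContinuousLinearMap.ext fun x => ?_)
  have h1 : E.fockRep f a = 0 := by
    have := congrArg (BoundedProd.eval (E.fock f)) ha
    rwa [map_zero] at this
  have h2 : (E.fockRep f a (lp.single 2 0 x : E.Fock f) : E.Fock f) 0 = 0 := by
    rw [h1]; rfl
  change (E.iter f 0).gnsNonUnitalStarAlgHom a ((lp.single 2 0 x : E.Fock f) 0) = 0 at h2
  have h3 := lp.single_apply_self (E := fun n => (E.iter f n).GNS) 2 0 x
  exact (congrArg (f.gnsNonUnitalStarAlgHom a) h3).symm.trans h2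

lemma ExelSystem.norm_cpUnivπ (a : A) : ‖cpUnivπ E.L a‖ = ‖a‖ :=
  NonUnitalStarAlgHom.norm_map _ E.cpUnivπ_injective a

end Fock

/-! ### Approximate units and non-degeneracy -/

section ApproxUnits

lemma eq_zero_of_nondegenerate {A : Type u} [NonUnitalCStarAlgebra A] [PartialOrder A]
    [StarOrderedRing A] {H : Type u} [NormedAddCommGroup H] [InnerProductSpace ℂ H]
    [CompleteSpace H] (π : A →⋆ₙₐ[ℂ] (H →L[ℂ] H))
    (hπ : (Submodule.span ℂ {x : H | ∃ a h, x = π a h}).topologicalClosure = ⊤)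
    {D : H →L[ℂ] H} (hD : ∀ a, π a * D = 0) : D = 0 := by
  refine ContinuousLinearMap.ext fun x => norm_le_zero_iff.1 ?_
  refine norm_le_of_nondegenerate π hπ _ _ fun a _ => ?_
  have h1 : π a (D x) = 0 := DFunLike.congr_fun (hD a) x
  rw [h1, norm_zero]

lemma isClosed_setOf_tendsto_mul {B ι : Type*} [NonUnitalCStarAlgebra B] {l : Filter ι}
    {w : ι → B} (hw : ∀ᶠ i in l, ‖w i‖ ≤ 1) :
    IsClosed {b : B | Tendsto (fun i => w i * b) l (𝓝 b)} := by
  refine isClosed_of_closure_subset fun b hb => Metric.tendsto_nhds.2 fun ε hε => ?_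
  obtain ⟨c, hc, hbc⟩ := Metric.mem_closure_iff.1 hb (ε / 3) (by positivity)
  filter_upwards [hw, Metric.tendsto_nhds.1 hc (ε / 3) (by positivity)] with i hi1 hi2
  have h1 : dist (w i * b) (w i * c) ≤ dist b c := by
    rw [dist_eq_norm, dist_eq_norm, ← mul_sub]
    calc ‖w i * (b - c)‖ ≤ ‖w i‖ * ‖b - c‖ := norm_mul_le _ _
      _ ≤ 1 * ‖b - c‖ := by gcongr
      _ = ‖b - c‖ := one_mul _
  have h2 := dist_triangle4 (w i * b) (w i * c) c b
  rw [dist_comm c b] at h2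
  linarith

variable {A : Type u} [NonUnitalCStarAlgebra A] [PartialOrder A] [StarOrderedRing A]

lemma tendsto_conj_sub (p : A) : Tendsto (fun e : A => e * p * e - e * p - p * e + p)
    (CStarAlgebra.approximateUnit A) (𝓝 0) := by
  have hl := CStarAlgebra.increasingApproximateUnit A
  have h1 : Tendsto (fun e : A => e * p) (CStarAlgebra.approximateUnit A) (𝓝 p) :=
    hl.tendsto_mul_right p
  have h2 : Tendsto (fun e : A => p * e) (CStarAlgebra.approximateUnit A) (𝓝 p) :=
    hl.tendsto_mul_left p
  have h3 : Tendsto (fun e : A => (e * p - p) * e) (CStarAlgebra.approximateUnit A) (𝓝 0) := by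
    have h4 : Tendsto (fun e : A => ‖e * p - p‖) (CStarAlgebra.approximateUnit A) (𝓝 0) := by
      have := (h1.sub_const p).norm
      simpa using this
    refine squeeze_zero_norm' ?_ h4
    filter_upwards [hl.eventually_norm] with e he
    calc ‖(e * p - p) * e‖ ≤ ‖e * p - p‖ * ‖e‖ := norm_mul_le _ _
      _ ≤ ‖e * p - p‖ * 1 := by gcongr
      _ = ‖e * p - p‖ := mul_one _
  have h5 := h3.sub (h1.sub_const p)
  rw [sub_self, sub_zero] at h5
  refine h5.congr fun e => ?_
  rw [sub_mul]
  abel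

/-- By the C⋆-identity, `‖y π(e) - y‖²` is the norm of the image of `(1 - e) p (1 - e)`. It will be
used for `y = π(b) S`. -/
lemma tendsto_mul_approximateUnit {B : Type*} [NonUnitalCStarAlgebra B] (π : A →⋆ₙₐ[ℂ] B) {y : B}
    {p : A} (hy : star y * y = π p) :
    Tendsto (fun e => y * π e) (CStarAlgebra.approximateUnit A) (𝓝 y) := by
  have hl := CStarAlgebra.increasingApproximateUnit A
  rw [tendsto_iff_norm_sub_tendsto_zero]
  have h1 : Tendsto (fun e => ‖π (e * p * e - e * p - p * e + p)‖)
      (CStarAlgebra.approximateUnit A) (𝓝 0) := by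
    have := (((map_continuous π).tendsto 0).comp (tendsto_conj_sub p)).norm
    rw [map_zero, norm_zero] at this
    exact this
  have h2 : Tendsto (fun e => ‖y * π e - y‖ ^ 2) (CStarAlgebra.approximateUnit A) (𝓝 0) := by
    refine h1.congr' ?_
    filter_upwards [hl.eventually_star_eq] with e he
    rw [sq, ← CStarRing.norm_star_mul_self]
    congr 1
    have h3 : star (π e) = π e := by rw [← map_star, he]
    simp only [map_add, map_sub, map_mul, ← hy, star_sub, star_mul, h3, sub_mul, mul_sub, mul_assoc]
    abel
  have h4 := h2.sqrt
  simpa [Real.sqrt_sq (norm_nonneg _)] using h4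

end ApproxUnits

/-! ### Consequences of the hypotheses on an Exel system -/

section Hypotheses

variable {A : Type u} [NonUnitalCStarAlgebra A] [PartialOrder A] [StarOrderedRing A]
  {E : ExelSystem A}

omit [StarOrderedRing A] in
lemma Faithful.almostFaithful {L : A →ₚ[ℂ] A} (h : Faithful L) : AlmostFaithful L := by
  intro a ha
  have h1 : ∀ b, a * b = 0 := fun b => h _ (ha b)
  rw [← CStarRing.mul_star_self_eq_zero_iff]
  exact h1 _

omit [StarOrderedRing A] in
lemma AlmostFaithful.annihilator_gnsKernel {L : A →ₚ[ℂ] A} (h : AlmostFaithful L) :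
    annihilator (gnsKernel L) = Set.univ := by
  refine Set.eq_univ_of_forall fun a n hn => ?_
  rw [h n hn, mul_zero]

lemma Nondegenerate.rangeIdeal_eq (h : Nondegenerate E.α) : E.rangeIdeal = Set.univ := by
  refine Set.eq_univ_of_forall fun x => ?_
  let K := (Submodule.span ℂ {x : A | ∃ a b c : A, x = a * E.α b * c}).topologicalClosure
  have hK : IsClosed (K : Set A) := Submodule.isClosed_topologicalClosure _
  change x ∈ K
  have hx : x ∈ (Submodule.span ℂ {x : A | ∃ a b : A, x = E.α a * b}).topologicalClosure := by
    rw [h]; trivial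
  refine (Submodule.topologicalClosure_minimal _ (Submodule.span_le.2 ?_) hK) hx
  rintro _ ⟨a, b, rfl⟩
  have hl := CStarAlgebra.increasingApproximateUnit A
  have := hl.neBot
  have h1 : Tendsto (fun e : A => e * (E.α a * b)) (CStarAlgebra.approximateUnit A)
      (𝓝 (E.α a * b)) := hl.tendsto_mul_right _
  refine hK.mem_of_tendsto h1 (Eventually.of_forall fun e => ?_)
  exact Submodule.le_topologicalClosure _ (Submodule.subset_span ⟨e, a, b, (mul_assoc _ _ _).symm⟩)

/-- The approximate unit tends strictly to `1`, so `α(e)` tends strictly to `β(1)`; the limit sought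
is `b β(1)`. -/
lemma Extendible.exists_tendsto {α : A →⋆ₙₐ[ℂ] A} (h : Extendible α) (b : A) :
    ∃ x, Tendsto (fun e => b * α e) (CStarAlgebra.approximateUnit A) (𝓝 x) := by
  obtain ⟨β, hβ, hα⟩ := h
  have hl := CStarAlgebra.increasingApproximateUnit A
  let comps : DoubleCentralizer ℂ A → (A → A) × (A → A) := fun m =>
    (fun a => m.fst a, fun a => m.snd a)
  have h1 : @Tendsto A (DoubleCentralizer ℂ A) (fun e => DoubleCentralizer.coe ℂ e)
      (CStarAlgebra.approximateUnit A) (@nhds _ (strictTopology A) 1) := by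
    let _ := strictTopology A
    rw [(Topology.IsInducing.mk rfl : Topology.IsInducing comps).tendsto_nhds_iff]
    refine Tendsto.prodMk_nhds ?_ ?_
    · exact tendsto_pi_nhds.2 fun a => hl.tendsto_mul_right a
    · exact tendsto_pi_nhds.2 fun a => hl.tendsto_mul_left a
  have h2 : @Tendsto A (DoubleCentralizer ℂ A) (fun e => DoubleCentralizer.coe ℂ (α e))
      (CStarAlgebra.approximateUnit A) (@nhds _ (strictTopology A) (β 1)) := by
    let _ := strictTopology A
    have := (hβ.tendsto 1).comp h1
    exact this.congr fun e => hα e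
  let _ := strictTopology A
  rw [(Topology.IsInducing.mk rfl : Topology.IsInducing comps).tendsto_nhds_iff] at h2
  have h3 := (continuous_snd.tendsto _).comp h2
  exact ⟨_, tendsto_pi_nhds.1 h3 b⟩

/-- With `p = L(b* b)`, the transfer identities turn `L((b - b α(e))* (b - b α(e)))` into `(1 - e) p
(1 - e)`, which tends to `0`. Faithfulness therefore identifies the limit of `b α(e)` with `b`. -/
lemma Extendible.tendsto_mul (h : Extendible E.α) (hf : Faithful E.L) (b : A) :
    Tendsto (fun e => b * E.α e) (CStarAlgebra.approximateUnit A) (𝓝 b) := by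
  have hl := CStarAlgebra.increasingApproximateUnit A
  have := hl.neBot
  obtain ⟨x, hx⟩ := h.exists_tendsto b
  have h1 : E.L (star (b - x) * (b - x)) = 0 := by
    have hc : Continuous fun y => E.L (star (b - y) * (b - y)) := by
      have := map_continuous E.L
      fun_prop
    refine tendsto_nhds_unique ((hc.tendsto x).comp hx)
      ((tendsto_conj_sub (E.L (star b * b))).congr' ?_)
    filter_upwards [hl.eventually_star_eq] with e he
    have h2 : star (E.α e) = E.α e := by rw [← map_star, he]
    simp only [Function.comp_apply, star_sub, star_mul, h2, sub_mul, mul_sub, map_sub]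
    have e1 : E.L (star b * (b * E.α e)) = E.L (star b * b) * e := by
      rw [← mul_assoc, E.transfer]
    have e2 : E.L (E.α e * star b * b) = e * E.L (star b * b) := by
      rw [mul_assoc, E.transfer']
    have e3 : E.L (E.α e * star b * (b * E.α e)) = e * E.L (star b * b) * e := by
      rw [← mul_assoc, E.transfer, e2]
    rw [e1, e2, e3]
    abel
  rwa [← sub_eq_zero.1 (hf _ h1)] at hx

lemma Extendible.rangeIdeal_eq (h : Extendible E.α) (hf : Faithful E.L) :
    E.rangeIdeal = Set.univ := by
  refine Set.eq_univ_of_forall fun b => ?_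
  let K := (Submodule.span ℂ {x : A | ∃ a b c : A, x = a * E.α b * c}).topologicalClosure
  have hK : IsClosed (K : Set A) := Submodule.isClosed_topologicalClosure _
  have hl := CStarAlgebra.increasingApproximateUnit A
  have := hl.neBot
  refine hK.mem_of_tendsto (h.tendsto_mul hf b) (Eventually.of_forall fun e => ?_)
  have h1 : Tendsto (fun c : A => b * E.α e * c) (CStarAlgebra.approximateUnit A)
      (𝓝 (b * E.α e)) := hl.tendsto_mul_left _
  exact hK.mem_of_tendsto h1 (Eventually.of_forall fun c =>
    Submodule.le_topologicalClosure _ (Submodule.subset_span ⟨b, e, c, rfl⟩))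

end Hypotheses

/-! ### Representations of `(A, L)` and of the correspondence `M_L` -/

section Pairs

variable {A : Type u} [NonUnitalCStarAlgebra A] [PartialOrder A] [StarOrderedRing A]
  (E : ExelSystem A)

/-- This makes `α` redundant in the definition of a representation. After multiplication by `π(b)`,
all four terms of the square of the difference equal `π(a* p a)` with `p = L(b* b)`, and they
cancel. -/
lemma ExelSystem.mul_eq_of_star_mul_mul {H : Type u} [NormedAddCommGroup H] [InnerProductSpace ℂ H]
    [CompleteSpace H] (π : A →⋆ₙₐ[ℂ] (H →L[ℂ] H))
    (hπ : (Submodule.span ℂ {x : H | ∃ a h, x = π a h}).topologicalClosure = ⊤)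
    {S : H →L[ℂ] H} (hS : ∀ a, star S * π a * S = π (E.L a)) (a : A) :
    S * π a = π (E.α a) * S := by
  rw [← sub_eq_zero]
  refine eq_zero_of_nondegenerate π hπ fun b => ?_
  rw [← CStarRing.star_mul_self_eq_zero_iff]
  have hS' : ∀ x, star S * (π x * S) = π (E.L x) := fun x => by rw [← mul_assoc, hS]
  calc star (π b * (S * π a - π (E.α a) * S)) * (π b * (S * π a - π (E.α a) * S))
      = π (star a) * (star S * (π (star b * b) * S)) * π a
        - π (star a) * (star S * (π (star b * b * E.α a) * S))
        - star S * (π (E.α (star a) * (star b * b)) * S) * π a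
        + star S * (π (E.α (star a) * (star b * b) * E.α a) * S) := by
          simp only [map_star, map_mul, star_mul, star_sub, mul_sub, sub_mul, mul_assoc]
          abel
    _ = 0 := by
          simp only [hS']
          rw [E.transfer, E.transfer, E.transfer']
          generalize E.L (star b * b) = p
          simp only [map_mul, mul_assoc]
          abel

section Redundancies

variable {B : Type*} [NonUnitalCStarAlgebra B] {π : A →⋆ₙₐ[ℂ] B} {S : B}

/-- The two closed spans coincide: `S π(c) = π(α(c)) S` moves the middle factor to the left, and
`π(b) S = lim π(b) S π(e)` creates one. -/
lemma ExelSystem.isRedundancy_iff (hS : ∀ a, star S * π a * S = π (E.L a))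
    (hS2 : ∀ a, S * π a = π (E.α a) * S) (a : A) (k : B) :
    IsRedundancy π S a k ↔ IsExelRedundancy π S a k := by
  have hl := CStarAlgebra.increasingApproximateUnit A
  have := hl.neBot
  let K₁ := (Submodule.span ℂ
      {x : B | ∃ b c d : A, x = π b * S * π c * star S * π d}).topologicalClosure
  let K₂ := (Submodule.span ℂ {x : B | ∃ b c : A, x = π b * S * star S * π c}).topologicalClosure
  have h₁ : IsClosed (K₁ : Set B) := Submodule.isClosed_topologicalClosure _
  have h₂ : IsClosed (K₂ : Set B) := Submodule.isClosed_topologicalClosure _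
  have hle1 : K₁ ≤ K₂ := by
    refine Submodule.topologicalClosure_minimal _ (Submodule.span_le.2 ?_) h₂
    rintro _ ⟨b, c, d, rfl⟩
    refine Submodule.le_topologicalClosure _ (Submodule.subset_span ⟨b * E.α c, d, ?_⟩)
    rw [mul_assoc (π b), hS2, map_mul]
    simp only [mul_assoc]
  have hle2 : K₂ ≤ K₁ := by
    refine Submodule.topologicalClosure_minimal _ (Submodule.span_le.2 ?_) h₁
    rintro _ ⟨b, d, rfl⟩
    have h1 : star (π b * S) * (π b * S) = π (E.L (star b * b)) := by
      rw [← hS, star_mul, map_mul, map_star]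
      simp only [mul_assoc]
    have h2 := ((tendsto_mul_approximateUnit π h1).mul_const (star S)).mul_const (π d)
    exact h₁.mem_of_tendsto h2 (Eventually.of_forall fun e =>
      Submodule.le_topologicalClosure _ (Submodule.subset_span ⟨b, e, d, rfl⟩))
  exact and_congr_left' ⟨fun h => hle1 h, fun h => hle2 h⟩

omit [PartialOrder A] [StarOrderedRing A] in
lemma IsExelRedundancy.map {D : Type*} [NonUnitalCStarAlgebra D] (σ : B →⋆ₙₐ[ℂ] D)
    {ρ : A →⋆ₙₐ[ℂ] D} (hρ : ∀ a, σ (π a) = ρ a) {T : D} (hT : σ S = T) {a : A} {k : B}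
    (h : IsExelRedundancy π S a k) : IsExelRedundancy ρ T a (σ k) := by
  subst hT
  refine ⟨?_, fun b => ?_⟩
  · let K := (Submodule.span ℂ
      {x : D | ∃ b c : A, x = ρ b * σ S * star (σ S) * ρ c}).topologicalClosure
    have hK : IsClosed (K : Set D) := Submodule.isClosed_topologicalClosure _
    have h1 : (Submodule.span ℂ {x : B | ∃ b c : A, x = π b * S * star S * π c}).topologicalClosure
        ≤ K.comap (σ : B →ₗ[ℂ] D) := by
      refine Submodule.topologicalClosure_minimal _ (Submodule.span_le.2 ?_)
        (hK.preimage (map_continuous σ))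
      rintro _ ⟨b, c, rfl⟩
      refine Submodule.le_topologicalClosure _ (Submodule.subset_span ⟨b, c, ?_⟩)
      change σ _ = _
      simp only [map_mul, map_star, hρ]
    exact h1 h.1
  · have := congrArg σ (h.2 b)
    simpa only [map_mul, hρ] using this

end Redundancies

/-! ### Passing between maps on `A` and representations of `M_L` -/

/-- The canonical map `q : A → M_L` as a linear map. -/
def ExelSystem.qₗ : A →ₗ[ℂ] E.M :=
  (UniformSpace.Completion.toComplL : E.Pre →L[ℂ] E.M).toLinearMap.comp E.toPre.toLinearMap

lemma ExelSystem.qₗ_apply (a : A) : E.qₗ a = E.q a := rfl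

lemma ExelSystem.denseRange_q : DenseRange E.q :=
  UniformSpace.Completion.denseRange_coe.comp E.toPre.surjective.denseRange
    (UniformSpace.Completion.continuous_coe _)

lemma ExelSystem.inner_q (a b : A) :
    E.correspondence.inner (E.q a) (E.q b) = E.L (star a * b) := E.M_inner_coe _ _

lemma ExelSystem.φ_q (a b : A) : E.correspondence.φ a (E.q b) = E.q (a * b) :=
  E.leftAction_q a b

lemma ExelSystem.continuous_q : Continuous E.q := by
  obtain ⟨C, hC⟩ := E.L.exists_norm_apply_le
  refine AddMonoidHomClass.continuous_of_bound E.qₗ (√C) fun a => ?_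
  have h1 : ‖E.q a‖ ^ 2 ≤ C * ‖a‖ ^ 2 := by
    rw [E.correspondence.norm_sq_eq, E.inner_q, sq, ← CStarRing.norm_star_mul_self]
    exact hC _
  rw [← Real.sqrt_sq (norm_nonneg a), ← Real.sqrt_mul C.coe_nonneg]
  exact Real.le_sqrt_of_sq_le h1

lemma ExelSystem.M_ext {F : Type*} [TopologicalSpace F] [T2Space F] {f g : E.M → F}
    (hf : Continuous f) (hg : Continuous g) (h : ∀ a, f (E.q a) = g (E.q a)) (x : E.M) :
    f x = g x :=
  E.denseRange_q.induction_on (p := fun x => f x = g x) x (isClosed_eq hf hg) h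

/-- If `φ(a) = 0` then all `⟨q(a b), q(a b)⟩ = L((a b)* (a b))` vanish. -/
lemma AlmostFaithful.eq_zero_of_φ_eq_zero {E : ExelSystem A} (h : AlmostFaithful E.L) {a : A}
    (ha : E.correspondence.φ a = 0) : a = 0 := by
  refine h a fun b => ?_
  rw [← E.inner_q, ← E.φ_q, ha]
  have := E.correspondence.norm_sq_eq 0
  rw [norm_zero, zero_pow two_ne_zero, eq_comm, norm_eq_zero] at this
  exact this

/-- The extension to `M_L` of a linear map on `A`. -/
def ExelSystem.extendRep {B : Type*} [NonUnitalCStarAlgebra B] (V : A →ₗ[ℂ] B) : E.M →L[ℂ] B :=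
  V.extendOfNorm E.qₗ

section ExtendRep

variable {E} {B : Type*} [NonUnitalCStarAlgebra B] {π : A →⋆ₙₐ[ℂ] B} {V : A →ₗ[ℂ] B}

lemma ExelSystem.extendRep_q (hV : ∀ a b, star (V a) * V b = π (E.L (star a * b))) (a : A) :
    E.extendRep V (E.q a) = V a := by
  refine LinearMap.extendOfNorm_eq (e := E.qₗ) E.denseRange_q ⟨1, fun a => ?_⟩ a
  rw [one_mul]
  refine (sq_le_sq₀ (norm_nonneg _) (norm_nonneg _)).1 ?_
  rw [E.qₗ_apply, E.correspondence.norm_sq_eq, E.inner_q, sq, ← CStarRing.norm_star_mul_self, hV]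
  exact NonUnitalStarAlgHom.norm_apply_le _ _

lemma ExelSystem.isRepOn_extendRep (hV : ∀ a b, star (V a) * V b = π (E.L (star a * b)))
    (hV2 : ∀ a b, V (a * b) = π a * V b) : E.correspondence.IsRepOn π (E.extendRep V) where
  map_inner x y := by
    refine E.M_ext (f := fun x => star (E.extendRep V x) * E.extendRep V y)
      (g := fun x => π (E.correspondence.inner x y)) (by fun_prop) ?_ (fun a => ?_) x
    · exact (map_continuous π).comp (E.M_continuous_inner' continuous_id continuous_const)
    refine E.M_ext (f := fun y => star (E.extendRep V (E.q a)) * E.extendRep V y)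
      (g := fun y => π (E.correspondence.inner (E.q a) y)) (by fun_prop) ?_ (fun b => ?_) y
    · exact (map_continuous π).comp (E.M_continuous_inner' continuous_const continuous_id)
    rw [extendRep_q hV, extendRep_q hV, E.inner_q, hV]
  map_left a x := by
    refine E.M_ext (f := fun x => E.extendRep V (E.correspondence.φ a x))
      (g := fun x => π a * E.extendRep V x) (by fun_prop) (by fun_prop) (fun b => ?_) x
    rw [E.φ_q, extendRep_q hV, extendRep_q hV, hV2]

end ExtendRep

/-- The operator `S` of the representation of `(A, L)` corresponding to a representation of
`M_L`. -/
lemma ExelSystem.exists_operator {H : Type u} [NormedAddCommGroup H] [InnerProductSpace ℂ H]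
    [CompleteSpace H] {π : A →⋆ₙₐ[ℂ] (H →L[ℂ] H)} {πX : E.M →L[ℂ] (H →L[ℂ] H)}
    (h : E.correspondence.IsRepOn π πX) :
    ∃ S : H →L[ℂ] H, (∀ a, π a * S = πX (E.q a)) ∧ ∀ a, star S * π a * S = π (E.L a) := by
  have hl := CStarAlgebra.increasingApproximateUnit A
  have := hl.neBot
  -- The operators `π_X(q(e))` are bounded, so along an ultrafilter their matrix coefficients
  -- converge, and the limit form defines `S`.
  let F : Ultrafilter A := Ultrafilter.of (CStarAlgebra.approximateUnit A)
  have hF : (F : Filter A) ≤ CStarAlgebra.approximateUnit A := Ultrafilter.of_le _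
  obtain ⟨C, hC⟩ := E.L.exists_norm_apply_le
  have hq : ∀ᶠ e in (F : Filter A), ‖πX (E.q e)‖ ≤ √C := by
    filter_upwards [hF hl.eventually_norm] with e he
    refine (h.norm_le _).trans (Real.le_sqrt_of_sq_le ?_)
    rw [E.correspondence.norm_sq_eq, E.inner_q]
    calc ‖E.L (star e * e)‖ ≤ C * (‖e‖ * ‖e‖) := by
          rw [← CStarRing.norm_star_mul_self]; exact hC _
      _ ≤ C * (1 * 1) := by gcongr
      _ = C := by ring
  have hlim : ∀ v w : H, ∃ z : ℂ, Tendsto (fun e => inner ℂ (πX (E.q e) v) w) F (𝓝 z) ∧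
      ‖z‖ ≤ √C * ‖v‖ * ‖w‖ := by
    intro v w
    have h1 : ∀ᶠ e in (F : Filter A),
        inner ℂ (πX (E.q e) v) w ∈ Metric.closedBall (0 : ℂ) (√C * ‖v‖ * ‖w‖) := by
      filter_upwards [hq] with e he
      rw [mem_closedBall_zero_iff]
      refine (norm_inner_le_norm _ _).trans ?_
      gcongr
      exact (ContinuousLinearMap.le_opNorm _ _).trans (by gcongr)
    obtain ⟨z, hz1, hz2⟩ := (isCompact_closedBall (0 : ℂ) (√C * ‖v‖ * ‖w‖)).ultrafilter_le_nhds
      (F.map fun e => inner ℂ (πX (E.q e) v) w) (le_principal_iff.2 h1)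
    exact ⟨z, hz2, mem_closedBall_zero_iff.1 hz1⟩
  choose b hb hbn using hlim
  let Bf : H →L⋆[ℂ] H →L[ℂ] ℂ := LinearMap.mkContinuous₂ (LinearMap.mk₂'ₛₗ _ _ b
    (fun v v' w => tendsto_nhds_unique (hb _ _) (by
      simpa only [map_add, inner_add_left] using (hb v w).add (hb v' w)))
    (fun c v w => tendsto_nhds_unique (hb _ _) (by
      simpa only [map_smul, inner_smul_left, smul_eq_mul] using (hb v w).const_mul _))
    (fun v w w' => tendsto_nhds_unique (hb _ _) (by
      simpa only [inner_add_right] using (hb v w).add (hb v w')))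
    (fun c v w => tendsto_nhds_unique (hb _ _) (by
      simpa only [inner_smul_right, smul_eq_mul, RingHom.id_apply] using (hb v w).const_mul _))) (√C) hbn
  let S := InnerProductSpace.continuousLinearMapOfBilin Bf
  have hS : ∀ v w, inner ℂ (S v) w = b v w := fun v w =>
    InnerProductSpace.continuousLinearMapOfBilin_apply Bf v w
  have h1 : ∀ a, π a * S = πX (E.q a) := by
    intro a
    refine ContinuousLinearMap.ext fun v => ext_inner_right ℂ fun w => ?_
    have e1 : inner ℂ ((π a * S) v) w = b v (π (star a) w) := by
      rw [← hS, map_star, ContinuousLinearMap.star_eq_adjoint,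
        ContinuousLinearMap.adjoint_inner_right]
      rfl
    rw [e1]
    have h2 : Tendsto (fun e => E.q (a * e)) F (𝓝 (E.q a)) := by
      refine ((E.continuous_q.tendsto a).comp (hl.tendsto_mul_left a)).mono_left hF
    have h3 : Continuous fun x : E.M => inner ℂ (πX x v) w := by fun_prop
    refine tendsto_nhds_unique (hb _ _) (((h3.tendsto _).comp h2).congr fun e => ?_)
    simp only [Function.comp_apply]
    rw [← E.φ_q, h.map_left, map_star, ContinuousLinearMap.star_eq_adjoint,
      ContinuousLinearMap.adjoint_inner_right]
    rfl
  refine ⟨S, h1, fun a => ?_⟩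
  -- The inner product formula only reaches products `x* y`; the approximate unit then extends it to
  -- every `a`.
  have h2 : ∀ x y, star S * π (star x * y) * S = π (E.L (star x * y)) := by
    intro x y
    rw [← E.inner_q, ← h.map_inner, ← h1, ← h1, star_mul, map_mul, map_star]
    simp only [mul_assoc]
  have h3 : Tendsto (fun e => star (star a) * e) (CStarAlgebra.approximateUnit A) (𝓝 a) := by
    rw [star_star]
    exact hl.tendsto_mul_left a
  have hc1 : Continuous fun x => star S * π x * S := by
    have := map_continuous π
    fun_prop
  have hc2 : Continuous fun x => π (E.L x) := (map_continuous π).comp (map_continuous E.L)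
  refine tendsto_nhds_unique ((hc1.tendsto a).comp h3) (((hc2.tendsto a).comp h3).congr fun e => ?_)
  exact (h2 (star a) e).symm

end Pairs

/-! ### The universal representations -/

section Universal

/-- The ⋆-homomorphism into a product of `B(H_i)` with given components. -/
def homToProd {ι : Type*} {H : ι → Type u} [∀ i, NormedAddCommGroup (H i)]
    [∀ i, InnerProductSpace ℂ (H i)] [∀ i, CompleteSpace (H i)] {B : Type*}
    [NonUnitalCStarAlgebra B] (σ : ∀ i, B →⋆ₙₐ[ℂ] (H i →L[ℂ] H i)) : B →⋆ₙₐ[ℂ] BoundedProd H where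
  toFun x := BoundedProd.ofBounded (fun i => σ i x)
    ⟨‖x‖, fun i => NonUnitalStarAlgHom.norm_apply_le (σ i) x⟩
  map_smul' c x := BoundedProd.ext fun i => by simp
  map_zero' := BoundedProd.ext fun i => by simp
  map_add' x y := BoundedProd.ext fun i => by simp
  map_mul' x y := BoundedProd.ext fun i => by simp
  map_star' x := BoundedProd.ext fun i => by simp [map_star]

/-- The quotient map by a closed ideal as a ⋆-homomorphism. -/
def ClosedIdeal.projHom {B : Type*} [NonUnitalCStarAlgebra B] (I : ClosedIdeal B) :
    B →⋆ₙₐ[ℂ] I.Quotient where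
  toFun := I.proj
  map_smul' := map_smul I.proj
  map_zero' := map_zero I.proj
  map_add' := map_add I.proj
  map_mul' := I.proj_mul
  map_star' := I.proj_star

lemma ClosedIdeal.proj_eq_zero {B : Type*} [NonUnitalCStarAlgebra B] (I : ClosedIdeal B) {x : B} :
    I.proj x = 0 ↔ x ∈ I.carrier := by
  rw [← map_zero I.proj, I.proj_eq_proj, sub_zero]

variable {A : Type u} [NonUnitalCStarAlgebra A] [PartialOrder A] [StarOrderedRing A]
  (E : ExelSystem A)

/-! ### The Toeplitz algebras `T(A, α, L)` and `T(A, L)` and their redundancy ideals -/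

lemma cpUniv_star_mul_mul (L : A →ₚ[ℂ] A) (a : A) :
    star (cpUnivS L) * cpUnivπ L a * cpUnivS L = cpUnivπ L (L a) :=
  BoundedProd.ext fun ρ => by
    simp only [map_mul, map_star]
    exact ρ.star_mul_mul a

lemma ExelSystem.cpUniv_mul_eq (a : A) :
    cpUnivS E.L * cpUnivπ E.L a = cpUnivπ E.L (E.α a) * cpUnivS E.L :=
  BoundedProd.ext fun ρ => by
    simp only [map_mul]
    exact E.mul_eq_of_star_mul_mul ρ.π ρ.nondegenerate ρ.star_mul_mul a

/-- Every representation of `(A, L)` is a representation of `(A, α, L)`. -/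
def ExelSystem.toExelRep (ρ : CPRep E.L) : ExelRep E where
  toCPRep := ρ
  mul_eq := E.mul_eq_of_star_mul_mul ρ.π ρ.nondegenerate ρ.star_mul_mul

/-- The canonical homomorphism from the algebra of `(A, α, L)` to that of `(A, L)`. -/
def ExelSystem.exelToCP : (BoundedProd fun ρ : ExelRep E => ρ.H) →⋆ₙₐ[ℂ]
    BoundedProd fun ρ : CPRep E.L => ρ.H :=
  homToProd fun ρ : CPRep E.L => BoundedProd.eval (H := fun ρ : ExelRep E => ρ.H) (E.toExelRep ρ)

/-- The canonical homomorphism from the algebra of `(A, L)` to that of `(A, α, L)`. -/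
def ExelSystem.cpToExel : (BoundedProd fun ρ : CPRep E.L => ρ.H) →⋆ₙₐ[ℂ]
    BoundedProd fun ρ : ExelRep E => ρ.H :=
  homToProd fun ρ : ExelRep E => BoundedProd.eval (H := fun ρ : CPRep E.L => ρ.H) ρ.toCPRep

lemma ExelSystem.exelToCP_π (a : A) : E.exelToCP (E.univπ a) = cpUnivπ E.L a := rfl

lemma ExelSystem.exelToCP_S : E.exelToCP E.univS = cpUnivS E.L := rfl

lemma ExelSystem.cpToExel_π (a : A) : E.cpToExel (cpUnivπ E.L a) = E.univπ a := rfl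

lemma ExelSystem.cpToExel_S : E.cpToExel (cpUnivS E.L) = E.univS := rfl

/-- The canonical homomorphism `T(A, α, L) → T(A, L)`. -/
def ExelSystem.toeplitzToCP : E.Toeplitz →⋆ₙₐ[ℂ] CPToeplitz E.L :=
  cstarGeneratedMap _ E.exelToCP (by
    rintro _ (⟨a, rfl⟩ | ⟨a, rfl⟩)
    · exact Or.inl ⟨a, rfl⟩
    · exact Or.inr ⟨a, by simp only [map_mul, exelToCP_π, exelToCP_S]⟩)

/-- The canonical homomorphism `T(A, L) → T(A, α, L)`. -/
def ExelSystem.toeplitzFromCP : CPToeplitz E.L →⋆ₙₐ[ℂ] E.Toeplitz :=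
  cstarGeneratedMap _ E.cpToExel (by
    rintro _ (⟨a, rfl⟩ | ⟨a, rfl⟩)
    · exact Or.inl ⟨a, rfl⟩
    · exact Or.inr ⟨a, by simp only [map_mul, cpToExel_π, cpToExel_S]⟩)

/-- Holds by definition, because the extra field of `ExelRep` is a proposition: both universal
families have the same members. -/
lemma ExelSystem.toeplitzFromCP_toeplitzToCP (x : E.Toeplitz) :
    E.toeplitzFromCP (E.toeplitzToCP x) = x := rfl

/-- Exel's crossed product is the crossed product by `L` if the ideals coincide with `A`. -/
theorem ExelSystem.exists_exel_equiv (h1 : E.rangeIdeal = Set.univ)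
    (h2 : annihilator (gnsKernel E.L) = Set.univ) :
    ∃ Φ : E.CrossedProduct ≃⋆ₐ[ℂ] CPCrossedProduct E.L,
      (∀ a : A, Φ (E.j a) = CPCrossedProduct.j E.L a) ∧
      (∀ a : A, Φ (E.js a) = CPCrossedProduct.js E.L a) := by
  set I := cpIdeal E.L (annihilator (gnsKernel E.L)) with hI
  have hle1 : ∀ x ∈ I.carrier, E.toeplitzFromCP x ∈ E.redundancyIdeal.carrier := by
    intro x hx
    refine hx (E.redundancyIdeal.comap E.toeplitzFromCP) ?_
    rintro y ⟨a, -, k, hk, hy⟩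
    refine ClosedIdeal.subset_generatedBy _ ⟨a, h1 ▸ Set.mem_univ a, E.cpToExel k, ?_, ?_⟩
    · exact ((E.isRedundancy_iff (cpUniv_star_mul_mul E.L) E.cpUniv_mul_eq a k).1 hk).map _
        E.cpToExel_π E.cpToExel_S
    · change E.cpToExel y.1 = _
      rw [hy, map_sub, cpToExel_π]
  have hle2 : ∀ x ∈ E.redundancyIdeal.carrier, E.toeplitzToCP x ∈ I.carrier := by
    intro x hx
    refine hx (I.comap E.toeplitzToCP) ?_
    rintro y ⟨a, -, k, hk, hy⟩
    refine ClosedIdeal.subset_generatedBy _ ⟨a, h2 ▸ Set.mem_univ a, E.exelToCP k, ?_, ?_⟩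
    · exact (E.isRedundancy_iff (cpUniv_star_mul_mul E.L) E.cpUniv_mul_eq a _).2
        (hk.map _ E.exelToCP_π E.exelToCP_S)
    · change E.exelToCP y.1 = _
      rw [hy, map_sub, exelToCP_π]
  let φ : E.Toeplitz →⋆ₙₐ[ℂ] I.Quotient := I.projHom.comp E.toeplitzToCP
  have hker : ∀ x, φ x = 0 ↔ x ∈ E.redundancyIdeal.carrier := fun x => by
    change I.proj (E.toeplitzToCP x) = 0 ↔ _
    rw [I.proj_eq_zero]
    exact ⟨fun h => by simpa only [toeplitzFromCP_toeplitzToCP] using hle1 _ h, hle2 x⟩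
  have hsurj : Function.Surjective φ := fun y => by
    obtain ⟨y, rfl⟩ := I.proj_surjective y
    exact ⟨E.toeplitzFromCP y, rfl⟩
  refine ⟨E.redundancyIdeal.quotientEquiv φ hker hsurj, fun a => ?_, fun a => ?_⟩
  · rfl
  · rfl

/-! ### The module `M_L` inside the Toeplitz algebra: redundancies and compact operators -/

/-- The homomorphism `i_A` into the Toeplitz algebra. -/
def toeplitzπ (L : A →ₚ[ℂ] A) : A →⋆ₙₐ[ℂ] CPToeplitz L :=
  NonUnitalStarAlgHom.codRestrict (cpUnivπ L) (pairAlgebra (cpUnivπ L) (cpUnivS L))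
    (mem_pairAlgebra _ _)

/-- The map `a ↦ i_A(a) t` into the Toeplitz algebra. -/
def toeplitzV (L : A →ₚ[ℂ] A) : A →ₗ[ℂ] CPToeplitz L where
  toFun a := ⟨cpUnivπ L a * cpUnivS L, mul_mem_pairAlgebra _ _ a⟩
  map_add' a b := Subtype.ext (by
    change cpUnivπ L (a + b) * cpUnivS L = cpUnivπ L a * cpUnivS L + cpUnivπ L b * cpUnivS L
    rw [map_add, add_mul])
  map_smul' c a := Subtype.ext (by
    change cpUnivπ L (c • a) * cpUnivS L = c • (cpUnivπ L a * cpUnivS L)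
    rw [map_smul, smul_mul_assoc])

lemma star_toeplitzV_mul (L : A →ₚ[ℂ] A) (a b : A) :
    star (toeplitzV L a) * toeplitzV L b = toeplitzπ L (L (star a * b)) := by
  refine Subtype.ext ?_
  change star (cpUnivπ L a * cpUnivS L) * (cpUnivπ L b * cpUnivS L) = cpUnivπ L _
  rw [← cpUniv_star_mul_mul, star_mul, map_mul, map_star]
  simp only [mul_assoc]

lemma toeplitzV_mul (L : A →ₚ[ℂ] A) (a b : A) :
    toeplitzV L (a * b) = toeplitzπ L a * toeplitzV L b := by
  refine Subtype.ext ?_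
  change cpUnivπ L (a * b) * cpUnivS L = cpUnivπ L a * (cpUnivπ L b * cpUnivS L)
  rw [map_mul, mul_assoc]

/-- Needed to keep GNS representations of the Toeplitz algebra non-degenerate on `A`. -/
lemma tendsto_toeplitzπ_mul (L : A →ₚ[ℂ] A) (x : CPToeplitz L) :
    Tendsto (fun e => toeplitzπ L e * x) (CStarAlgebra.approximateUnit A) (𝓝 x) := by
  have hl := CStarAlgebra.increasingApproximateUnit A
  have hn : ∀ᶠ e in CStarAlgebra.approximateUnit A, ‖toeplitzπ L e‖ ≤ 1 := by
    filter_upwards [hl.eventually_norm] with e he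
    exact (NonUnitalStarAlgHom.norm_apply_le _ _).trans he
  have hstar : ∀ y : CPToeplitz L,
      Tendsto (fun e => y * toeplitzπ L e) (CStarAlgebra.approximateUnit A) (𝓝 y) →
      Tendsto (fun e => toeplitzπ L e * star y) (CStarAlgebra.approximateUnit A) (𝓝 (star y)) := by
    intro y hy
    refine ((continuous_star.tendsto y).comp hy).congr' ?_
    filter_upwards [hl.eventually_star_eq] with e he
    rw [Function.comp_apply, star_mul, ← map_star, he]
  have hstar' : ∀ y : CPToeplitz L,
      Tendsto (fun e => toeplitzπ L e * y) (CStarAlgebra.approximateUnit A) (𝓝 y) →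
      Tendsto (fun e => star y * toeplitzπ L e) (CStarAlgebra.approximateUnit A) (𝓝 (star y)) := by
    intro y hy
    refine ((continuous_star.tendsto y).comp hy).congr' ?_
    filter_upwards [hl.eventually_star_eq] with e he
    rw [Function.comp_apply, star_mul, ← map_star, he]
  have hπ : ∀ a, Tendsto (fun e => toeplitzπ L e * toeplitzπ L a)
      (CStarAlgebra.approximateUnit A) (𝓝 (toeplitzπ L a)) := fun a => by
    refine (((map_continuous (toeplitzπ L)).tendsto a).comp (hl.tendsto_mul_right a)).congr
      fun e => ?_
    exact map_mul _ _ _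
  have hV : ∀ a, Tendsto (fun e => toeplitzπ L e * toeplitzV L a)
      (CStarAlgebra.approximateUnit A) (𝓝 (toeplitzV L a)) := fun a => by
    have hc : Continuous (toeplitzV L) := by
      refine continuous_induced_rng.2 ?_
      exact (map_continuous (cpUnivπ L)).mul continuous_const
    refine ((hc.tendsto a).comp (hl.tendsto_mul_right a)).congr fun e => ?_
    exact toeplitzV_mul L e a
  have hcl : IsClosed {x : CPToeplitz L |
      Tendsto (fun e => toeplitzπ L e * x) (CStarAlgebra.approximateUnit A) (𝓝 x)} :=
    isClosed_setOf_tendsto_mul hn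
  -- The induction passes through adjoints, so `x` and `x*` are treated together. For the generator
  -- `i_A(a) t` the adjoint side rests on `(i_A(a) t)* (i_A(a) t) ∈ i_A(A)`.
  suffices h : Tendsto (fun e => toeplitzπ L e * x) (CStarAlgebra.approximateUnit A) (𝓝 x) ∧
      Tendsto (fun e => toeplitzπ L e * star x) (CStarAlgebra.approximateUnit A) (𝓝 (star x)) from
    h.1
  induction x using cstarGenerated_induction with
  | mem x hx =>
    rcases hx with ⟨a, rfl⟩ | ⟨a, rfl⟩
    · refine ⟨hπ a, ?_⟩
      have := hπ (star a)
      rwa [map_star] at this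
    · exact ⟨hV a, hstar _ (tendsto_mul_approximateUnit _ (star_toeplitzV_mul L a a))⟩
  | zero => simp
  | add x y h1 h2 =>
    simp only [star_add, mul_add]
    exact ⟨h1.1.add h2.1, h1.2.add h2.2⟩
  | mul x y h1 h2 =>
    simp only [star_mul, ← mul_assoc]
    exact ⟨h1.1.mul_const y, h2.2.mul_const (star x)⟩
  | smul c x h =>
    simp only [star_smul, mul_smul_comm]
    exact ⟨h.1.const_smul c, h.2.const_smul _⟩
  | star x h =>
    rw [star_star]
    exact ⟨h.2, h.1⟩
  | closed => exact hcl.inter (hcl.preimage continuous_star)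

/-- The linear map `i_X` from `M_L` into the Toeplitz algebra. -/
def ExelSystem.toeplitzX : E.M →L[ℂ] CPToeplitz E.L := E.extendRep (toeplitzV E.L)

lemma ExelSystem.isRepOn_toeplitz : E.correspondence.IsRepOn (toeplitzπ E.L) E.toeplitzX :=
  isRepOn_extendRep (star_toeplitzV_mul E.L) (toeplitzV_mul E.L)

lemma ExelSystem.toeplitzX_q (a : A) : E.toeplitzX (E.q a) = toeplitzV E.L a :=
  extendRep_q (star_toeplitzV_mul E.L) a

lemma ExelSystem.norm_toeplitzπ (a : A) : ‖toeplitzπ E.L a‖ = ‖a‖ := E.norm_cpUnivπ a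

/-- The homomorphism `K(M_L) → T(A, L)`. -/
def ExelSystem.toeplitzK : E.correspondence.compacts →L[ℂ] CPToeplitz E.L :=
  E.correspondence.compactRep E.toeplitzX

/-- The second components of redundancies are images of compact operators. -/
lemma ExelSystem.exists_compact_of_redundancy {a : A} {k : BoundedProd fun ρ : CPRep E.L => ρ.H}
    (hk : IsRedundancy (cpUnivπ E.L) (cpUnivS E.L) a k) :
    ∃ h : E.correspondence.φ a ∈ E.correspondence.compacts,
      (E.toeplitzK ⟨E.correspondence.φ a, h⟩ : CPToeplitz E.L).1 = k := by
  have hrep := E.isRepOn_toeplitz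
  let incl : CPToeplitz E.L →L[ℂ] BoundedProd fun ρ : CPRep E.L => ρ.H :=
    homCLM (NonUnitalStarSubalgebraClass.subtype (pairAlgebra (cpUnivπ E.L) (cpUnivS E.L)))
  -- Since `i_A` is isometric, the image of `K(M_L)` is closed, so it contains the whole closed span
  -- in which `k` lies.
  have hcl : IsClosed (LinearMap.range (incl.comp E.toeplitzK).toLinearMap :
      Set (BoundedProd fun ρ : CPRep E.L => ρ.H)) := by
    have h1 := hrep.isClosed_range_compactRep E.norm_toeplitzπ
    have h2 : IsClosed ((pairAlgebra (cpUnivπ E.L) (cpUnivS E.L) :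
        NonUnitalStarSubalgebra ℂ _) : Set (BoundedProd fun ρ : CPRep E.L => ρ.H)) :=
      NonUnitalStarSubalgebra.isClosed_topologicalClosure _
    have h3 := h2.isClosedMap_subtype_val _ h1
    convert h3 using 1
    ext x
    constructor
    · rintro ⟨K, rfl⟩
      exact ⟨_, ⟨K, rfl⟩, rfl⟩
    · rintro ⟨_, ⟨K, rfl⟩, rfl⟩
      exact ⟨K, rfl⟩
  have hle : (Submodule.span ℂ {x | ∃ b c d : A, x = cpUnivπ E.L b * cpUnivS E.L * cpUnivπ E.L c *
      star (cpUnivS E.L) * cpUnivπ E.L d}).topologicalClosure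
      ≤ LinearMap.range (incl.comp E.toeplitzK).toLinearMap := by
    refine Submodule.topologicalClosure_minimal _ (Submodule.span_le.2 ?_) hcl
    rintro _ ⟨b, c, d, rfl⟩
    refine ⟨⟨_, E.correspondence.Θ_mem (E.correspondence.rsmul (E.q b) c) (E.q (star d))⟩, ?_⟩
    change (E.toeplitzK ⟨_, _⟩ : CPToeplitz E.L).1 = _
    rw [toeplitzK, hrep.compactRep_Θ, hrep.map_rsmul, toeplitzX_q, toeplitzX_q]
    change cpUnivπ E.L b * cpUnivS E.L * cpUnivπ E.L c *
      star (cpUnivπ E.L (star d) * cpUnivS E.L) = _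
    rw [star_mul, ← map_star, star_star]
    simp only [mul_assoc]
  obtain ⟨K, hK⟩ := hle hk.1
  have hK' : (E.toeplitzK K).1 = k := hK
  -- Both operators act in the same way after applying the isometric `i_X`: one by `i_A(a)`, the
  -- other by `k`.
  have hφ : E.correspondence.φ a = K.1 := by
    refine E.M_clm_ext fun m => ?_
    change E.correspondence.φ a (E.q (E.ofPre m)) = K.1 (E.q (E.ofPre m))
    set b := E.ofPre m
    have h1 : E.toeplitzX (E.correspondence.φ a (E.q b)) = E.toeplitzX (K.1 (E.q b)) := by
      rw [← hrep.compactRep_mul, hrep.map_left, toeplitzX_q]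
      refine Subtype.ext ?_
      change cpUnivπ E.L a * (cpUnivπ E.L b * cpUnivS E.L)
        = (E.toeplitzK K).1 * (cpUnivπ E.L b * cpUnivS E.L)
      rw [hK', ← mul_assoc]
      exact hk.2 b
    have h2 := hrep.norm_eq_of_injective E.norm_toeplitzπ
      (E.correspondence.φ a (E.q b) - K.1 (E.q b))
    rw [map_sub, h1, sub_self, norm_zero, eq_comm, norm_eq_zero, sub_eq_zero] at h2
    exact h2
  exact ⟨hφ ▸ K.2, by rw [← hK']; congr 2; exact Subtype.ext hφ⟩

/-- `φ(a)` compact gives rise to a redundancy. -/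
lemma ExelSystem.isRedundancy_toeplitzK {a : A}
    (h : E.correspondence.φ a ∈ E.correspondence.compacts) :
    IsRedundancy (cpUnivπ E.L) (cpUnivS E.L) a
      (E.toeplitzK ⟨E.correspondence.φ a, h⟩ : CPToeplitz E.L).1 := by
  have hrep := E.isRepOn_toeplitz
  -- The image of `Θ_{q(b), q(c)}` is `i_A(b) t t* i_A(c*)`, which has no middle factor, so the
  -- second form of the span is the convenient one.
  rw [E.isRedundancy_iff (cpUniv_star_mul_mul E.L) E.cpUniv_mul_eq]
  refine ⟨?_, fun b => ?_⟩
  · let W := (Submodule.span ℂ {x | ∃ b c : A, x = cpUnivπ E.L b * cpUnivS E.L *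
      star (cpUnivS E.L) * cpUnivπ E.L c}).topologicalClosure
    have hW : IsClosed (W : Set (BoundedProd fun ρ : CPRep E.L => ρ.H)) :=
      Submodule.isClosed_topologicalClosure _
    have hΘ : ∀ x y : E.M, (E.toeplitzX x * star (E.toeplitzX y)).1 ∈ W := by
      intro x y
      have hc : Continuous fun p : E.M × E.M => (E.toeplitzX p.1 * star (E.toeplitzX p.2)).1 :=
        continuous_subtype_val.comp (by fun_prop)
      refine E.denseRange_q.induction_on₂ (p := fun x y : E.M =>
        (E.toeplitzX x * star (E.toeplitzX y)).1 ∈ W) (hW.preimage hc) (fun b c => ?_) x y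
      rw [toeplitzX_q, toeplitzX_q]
      refine Submodule.le_topologicalClosure _ (Submodule.subset_span ⟨b, star c, ?_⟩)
      change cpUnivπ E.L b * cpUnivS E.L * star (cpUnivπ E.L c * cpUnivS E.L) = _
      rw [star_mul, map_star]
      simp only [mul_assoc]
    have hK : ∀ K : E.correspondence.compacts, (E.toeplitzK K).1 ∈ W := by
      intro K
      refine E.correspondence.denseRange_finiteRankCompact.induction_on
        (p := fun K : E.correspondence.compacts => (E.toeplitzK K).1 ∈ W) K
        (hW.preimage (continuous_subtype_val.comp E.toeplitzK.continuous)) fun c => ?_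
      rw [toeplitzK, hrep.compactRep_finiteRank]
      induction c using Finsupp.induction_linear with
      | zero => rw [map_zero]; exact W.zero_mem
      | add c d hc hd => rw [map_add]; exact W.add_mem hc hd
      | single p r =>
        obtain ⟨x, y⟩ := p
        rw [CStarCorrespondence.finiteRankRep_single]
        exact W.smul_mem r (hΘ x y)
    exact hK _
  · have h1 := hrep.compactRep_mul ⟨E.correspondence.φ a, h⟩ (E.q b)
    rw [hrep.map_left, toeplitzX_q] at h1
    have h2 := congrArg Subtype.val h1
    rw [mul_assoc]
    exact h2.symm

/-- A representation of `M_L` induces a homomorphism of the product algebra of all representations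
of `(A, L)`. -/
lemma ExelSystem.exists_hom_of_isRepOn {H : Type u} [NormedAddCommGroup H]
    [InnerProductSpace ℂ H] [CompleteSpace H] {π : A →⋆ₙₐ[ℂ] (H →L[ℂ] H)}
    (hπ : (Submodule.span ℂ {x : H | ∃ a h, x = π a h}).topologicalClosure = ⊤)
    {πX : E.M →L[ℂ] (H →L[ℂ] H)} (h : E.correspondence.IsRepOn π πX) :
    ∃ σ : (BoundedProd fun ρ : CPRep E.L => ρ.H) →⋆ₙₐ[ℂ] (H →L[ℂ] H),
      (∀ a, σ (cpUnivπ E.L a) = π a) ∧ ∀ a, σ (cpUnivπ E.L a * cpUnivS E.L) = πX (E.q a) := by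
  obtain ⟨S, hS1, hS2⟩ := E.exists_operator h
  let ρ : CPRep E.L :=
    { H := H
      π := π
      nondegenerate := hπ
      S := S
      star_mul_mul := hS2 }
  exact ⟨BoundedProd.eval (H := fun ρ : CPRep E.L => ρ.H) ρ, fun a => rfl, hS1⟩

end Universal

/-! ### The crossed product as a Cuntz-Pimsner algebra -/

section Comparison

lemma gns_eq_zero_of_mem {B : Type v} [NonUnitalCStarAlgebra B] [PartialOrder B] [StarOrderedRing B]
    (f : B →ₚ[ℂ] ℂ) (I : ClosedIdeal B) (hf : ∀ i ∈ I.carrier, f i = 0) {i : B}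
    (hi : i ∈ I.carrier) : f.gnsNonUnitalStarAlgHom i = 0 := by
  refine ContinuousLinearMap.ext fun x => ?_
  refine (denseRange_gnsMk f).induction_on (p := fun x : f.GNS =>
    f.gnsNonUnitalStarAlgHom i x = 0) x (isClosed_eq (by fun_prop) continuous_const) fun b => ?_
  rw [gns_apply_gnsMk, ← inner_self_eq_zero (𝕜 := ℂ), inner_gnsMk]
  exact hf _ (I.mul_mem_left _ (I.mul_mem_right _ hi))

/-- Elements outside a closed ideal of a small C⋆-algebra are separated from the ideal by
representations on small Hilbert spaces. -/
lemma ClosedIdeal.exists_representation {B : Type v} [NonUnitalCStarAlgebra B] [Small.{u} B]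
    (I : ClosedIdeal B) {x : B} (hx : x ∉ I.carrier) {A : Type u} [NonUnitalCStarAlgebra A]
    (π : A →⋆ₙₐ[ℂ] B) {l : Filter A} [l.NeBot] (hl : ∀ b, Tendsto (fun e => π e * b) l (𝓝 b)) :
    ∃ (ι : Type u) (σ : B →⋆ₙₐ[ℂ] (lp (fun _ : ι => ℂ) 2 →L[ℂ] lp (fun _ : ι => ℂ) 2)),
      (∀ i ∈ I.carrier, σ i = 0) ∧ σ x ≠ 0 ∧
      (Submodule.span ℂ {y | ∃ a h, y = σ (π a) h}).topologicalClosure = ⊤ := by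
  let _ := CStarAlgebra.spectralOrder B
  let _ := CStarAlgebra.spectralOrderedRing B
  obtain ⟨f, hf, hfx⟩ := I.exists_positive_functional x hx
  -- `f.GNS` lives in the universe of `B`; smallness passes to it from its dense image of `B`, and
  -- it can then be moved to an `ℓ²(ι)` with `ι` in `Type u`.
  have : Small.{u} f.GNS := small_of_denseRange _ (denseRange_gnsMk f)
  obtain ⟨ι, ⟨e⟩⟩ := exists_equiv_l2_of_small f.GNS
  let conj : (f.GNS →L[ℂ] f.GNS) →⋆ₙₐ[ℂ] (lp (fun _ : ι => ℂ) 2 →L[ℂ] lp (fun _ : ι => ℂ) 2) :=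
    { toFun := e.conjStarAlgEquiv
      map_smul' := fun c T => ContinuousLinearMap.ext fun h => map_smul e c (T (e.symm h))
      map_zero' := map_zero e.conjStarAlgEquiv
      map_add' := map_add e.conjStarAlgEquiv
      map_mul' := map_mul e.conjStarAlgEquiv
      map_star' := map_star e.conjStarAlgEquiv }
  have hconj : ∀ T h, conj T h = e (T (e.symm h)) := fun T h => rfl
  refine ⟨ι, conj.comp f.gnsNonUnitalStarAlgHom, fun i hi => ?_, fun h0 => ?_, ?_⟩
  · rw [NonUnitalStarAlgHom.comp_apply, gns_eq_zero_of_mem f I hf hi, map_zero]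
  · refine gns_ne_zero f hfx (ContinuousLinearMap.ext fun h => e.injective ?_)
    have h1 := DFunLike.congr_fun h0 (e h)
    rw [NonUnitalStarAlgHom.comp_apply, hconj, e.symm_apply_apply] at h1
    rw [h1, zero_apply, zero_apply, map_zero]
  · rw [eq_top_iff]
    rintro y -
    have hy : e.symm y ∈ (Submodule.span ℂ
        {x : f.GNS | ∃ a h, x = f.gnsNonUnitalStarAlgHom (π a) h}).topologicalClosure := by
      rw [gns_nondegenerate f π hl]; trivial
    let K := (Submodule.span ℂ {y : lp (fun _ : ι => ℂ) 2 |
      ∃ a h, y = conj.comp f.gnsNonUnitalStarAlgHom (π a) h}).topologicalClosure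
    have hK : IsClosed (K : Set (lp (fun _ : ι => ℂ) 2)) := Submodule.isClosed_topologicalClosure _
    have hle : (Submodule.span ℂ
        {x : f.GNS | ∃ a h, x = f.gnsNonUnitalStarAlgHom (π a) h}).topologicalClosure
        ≤ K.comap (e.toLinearEquiv : f.GNS →ₗ[ℂ] lp (fun _ : ι => ℂ) 2) := by
      refine Submodule.topologicalClosure_minimal _ (Submodule.span_le.2 ?_)
        (hK.preimage e.continuous)
      rintro _ ⟨a, h, rfl⟩
      refine Submodule.le_topologicalClosure _ (Submodule.subset_span ⟨a, e h, ?_⟩)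
      rw [NonUnitalStarAlgHom.comp_apply, hconj, e.symm_apply_apply]
      rfl
    have h1 : e (e.symm y) ∈ K := hle hy
    rwa [e.apply_symm_apply] at h1

variable {A : Type u} [NonUnitalCStarAlgebra A] [PartialOrder A] [StarOrderedRing A]

namespace CStarCorrespondence

variable {X : Type u} [NormedAddCommGroup X] [NormedSpace ℂ X] [CompleteSpace X]
  {C : CStarCorrespondence A X}

/-- The linear map of a representation of a correspondence as a continuous linear map. -/
def Rep.clm (c : C.Rep) : X →L[ℂ] (c.H →L[ℂ] c.H) :=
  LinearMap.mkContinuous c.πX 1 fun x => by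
    rw [one_mul]; exact norm_le_of_map_inner c.map_inner x

/-- The bimodule relation gives left linearity only after right multiplication by some `π(b)`;
taking adjoints, non-degeneracy cancels this factor. -/
lemma Rep.isRepOn (c : C.Rep) : C.IsRepOn c.π c.clm where
  map_inner := c.map_inner
  map_left a x := by
    rw [← sub_eq_zero, ← star_eq_zero]
    refine eq_zero_of_nondegenerate c.π c.nondegenerate fun b => ?_
    rw [← star_inj, star_mul, star_star, star_zero, ← map_star, sub_mul, sub_eq_zero]
    have h1 := c.map_bimod a x (star b)
    rwa [map_rsmul_of_map_inner c.map_inner] at h1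

/-- A non-degenerate representation by operators in the sense of `IsRepOn`. -/
def IsRepOn.toRep {H : Type u} [NormedAddCommGroup H] [InnerProductSpace ℂ H] [CompleteSpace H]
    {π : A →⋆ₙₐ[ℂ] (H →L[ℂ] H)} {πX : X →L[ℂ] (H →L[ℂ] H)} (h : C.IsRepOn π πX)
    (hπ : (Submodule.span ℂ {x : H | ∃ a h, x = π a h}).topologicalClosure = ⊤) : C.Rep where
  H := H
  π := π
  nondegenerate := hπ
  πX := πX
  map_bimod a x b := by
    change πX _ = _ * πX x * _
    rw [h.map_rsmul, h.map_left]
  map_inner := h.map_inner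

end CStarCorrespondence

namespace ExelSystem

variable (E : ExelSystem A)

/-- The algebra of all covariant representations of `M_L`. -/
abbrev CovProd : Type (u + 1) :=
  BoundedProd fun c : E.correspondence.CovRep E.correspondence.katsuraIdeal => c.1.H

/-- The homomorphism of the product algebra of `(A, L)` which a representation of `M_L` induces. -/
def repHom (c : E.correspondence.Rep) :
    (BoundedProd fun ρ : CPRep E.L => ρ.H) →⋆ₙₐ[ℂ] (c.H →L[ℂ] c.H) :=
  (E.exists_hom_of_isRepOn c.nondegenerate c.isRepOn).choose

lemma repHom_π (c : E.correspondence.Rep) (a : A) : E.repHom c (cpUnivπ E.L a) = c.π a :=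
  (E.exists_hom_of_isRepOn c.nondegenerate c.isRepOn).choose_spec.1 a

lemma repHom_S (c : E.correspondence.Rep) (a : A) :
    E.repHom c (cpUnivπ E.L a * cpUnivS E.L) = c.πX (E.q a) :=
  (E.exists_hom_of_isRepOn c.nondegenerate c.isRepOn).choose_spec.2 a

/-- The inclusion of the Toeplitz algebra. -/
def toeplitzIncl : CPToeplitz E.L →⋆ₙₐ[ℂ] BoundedProd fun ρ : CPRep E.L => ρ.H :=
  NonUnitalStarSubalgebraClass.subtype (pairAlgebra (cpUnivπ E.L) (cpUnivS E.L))

lemma repHom_toeplitzX (c : E.correspondence.Rep) (x : E.M) :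
    E.repHom c (E.toeplitzX x).1 = c.πX x := by
  refine E.M_ext (f := fun x => E.repHom c (E.toeplitzX x).1) (g := fun x => c.clm x)
    ?_ (by fun_prop) (fun a => ?_) x
  · exact (map_continuous (E.repHom c)).comp
      (continuous_subtype_val.comp E.toeplitzX.continuous)
  · rw [toeplitzX_q]
    exact E.repHom_S c a

/-- Both sides are continuous in `K` and agree on the `Θ_{x,y}`, so any `ψ` witnessing covariance is
computed through the Toeplitz algebra. -/
lemma repHom_toeplitzK (c : E.correspondence.Rep)
    {ψ : E.correspondence.compacts →L[ℂ] (c.H →L[ℂ] c.H)}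
    (hψ : ∀ x y, ψ ⟨E.correspondence.Θ x y, E.correspondence.Θ_mem x y⟩
      = c.πX x * star (c.πX y)) (K : E.correspondence.compacts) :
    E.repHom c (E.toeplitzK K).1 = ψ K := by
  refine CStarCorrespondence.compacts_clm_ext
    (f := (homCLM ((E.repHom c).comp E.toeplitzIncl)).comp E.toeplitzK) (g := ψ)
    (fun x y => ?_) K
  change E.repHom c (E.toeplitzK _).1 = _
  rw [toeplitzK, E.isRepOn_toeplitz.compactRep_Θ, hψ, ← repHom_toeplitzX, ← repHom_toeplitzX,
    ← map_star (E.repHom c), ← map_mul (E.repHom c)]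
  rfl

/-- The canonical homomorphism from the product algebra of `(A, L)` to that of the covariant
representations of `M_L`. -/
def cpToCov : (BoundedProd fun ρ : CPRep E.L => ρ.H) →⋆ₙₐ[ℂ] E.CovProd :=
  homToProd fun c => E.repHom c.1

lemma cpToCov_π (a : A) : E.cpToCov (cpUnivπ E.L a) = E.correspondence.univA _ a :=
  BoundedProd.ext fun c => E.repHom_π c.1 a

lemma cpToCov_toeplitzX (x : E.M) : E.cpToCov (E.toeplitzX x).1 = E.correspondence.univX _ x :=
  BoundedProd.ext fun c => E.repHom_toeplitzX c.1 x

lemma cpToCov_S (a : A) :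
    E.cpToCov (cpUnivπ E.L a * cpUnivS E.L) = E.correspondence.univX _ (E.q a) :=
  BoundedProd.ext fun c => E.repHom_S c.1 a

/-- The canonical homomorphism from `T(A, L)` onto the Cuntz-Pimsner algebra of `M_L`. -/
def toeplitzToCuntzPimsner : CPToeplitz E.L →⋆ₙₐ[ℂ] E.correspondence.CuntzPimsner :=
  cstarGeneratedMap _ E.cpToCov (by
    rintro _ (⟨a, rfl⟩ | ⟨a, rfl⟩)
    · exact Or.inl ⟨a, (E.cpToCov_π a).symm⟩
    · exact Or.inr ⟨E.q a, (E.cpToCov_S a).symm⟩)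

/-- The generators of `O_{M_L}` include `j_X(x)` for all `x`, not only for `x = q(a)`; the extension
of `q(a) ↦ i_A(a) t` to all of `M_L` supplies preimages. -/
lemma toeplitzToCuntzPimsner_surjective : Function.Surjective E.toeplitzToCuntzPimsner := by
  refine cstarGeneratedMap_surjective _ _ _ ?_
  rintro _ (⟨a, rfl⟩ | ⟨x, rfl⟩)
  · exact ⟨_, (toeplitzπ E.L a).2, E.cpToCov_π a⟩
  · exact ⟨_, (E.toeplitzX x).2, E.cpToCov_toeplitzX x⟩

variable {E}

lemma mem_katsuraIdeal (h : AlmostFaithful E.L) {a : A}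
    (ha : E.correspondence.φ a ∈ E.correspondence.compacts) :
    a ∈ E.correspondence.katsuraIdeal :=
  ⟨fun n hn => by rw [h.eq_zero_of_φ_eq_zero hn, mul_zero], ha⟩

/-- A redundancy `(i_A(a), k)` forces `φ(a)` to be compact with image `k`. Almost faithfulness puts
`a` in Katsura's ideal, so covariance kills `i_A(a) - k`. -/
lemma toeplitzToCuntzPimsner_eq_zero (h : AlmostFaithful E.L) {J : Set A} {x : CPToeplitz E.L}
    (hx : x ∈ (cpIdeal E.L J).carrier) : E.toeplitzToCuntzPimsner x = 0 := by
  refine hx ((ClosedIdeal.zero _).comap E.toeplitzToCuntzPimsner) ?_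
  rintro y ⟨a, -, k, hk, hy⟩
  obtain ⟨ha, rfl⟩ := E.exists_compact_of_redundancy hk
  refine Subtype.ext (BoundedProd.ext fun c => ?_)
  change E.repHom c.1 y.1 = 0
  obtain ⟨ψ, hψ, hcov⟩ := c.2
  obtain ⟨ha', h1⟩ := hcov a (mem_katsuraIdeal h ha)
  rw [hy, map_sub, repHom_π, E.repHom_toeplitzK c.1 hψ, h1, sub_self]

lemma small_toeplitz (L : A →ₚ[ℂ] A) : Small.{u} (CPToeplitz L) := small_cstarGenerated _

/-- An element outside the ideal survives in some representation `σ` that kills the ideal. Such a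
`σ` comes from a covariant representation of `M_L`, hence is a coordinate of `O_{M_L}`. -/
lemma mem_cpIdeal_of_toeplitzToCuntzPimsner_eq_zero
    {x : CPToeplitz E.L} (hx : E.toeplitzToCuntzPimsner x = 0) :
    x ∈ (cpIdeal E.L Set.univ).carrier := by
  by_contra hmem
  have hl := CStarAlgebra.increasingApproximateUnit A
  have := hl.neBot
  have := small_toeplitz E.L
  obtain ⟨ι, σ, hσ, hσx, hnd⟩ := (cpIdeal E.L Set.univ).exists_representation hmem
    (toeplitzπ E.L) (tendsto_toeplitzπ_mul E.L)
  have hrep := E.isRepOn_toeplitz.comp σ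
  let c : E.correspondence.Rep := hrep.toRep hnd
  -- A compact `φ(a)` gives a redundancy, and `σ` kills all redundancies.
  have hc : c.IsCovariant E.correspondence.katsuraIdeal := by
    refine ⟨(homCLM σ).comp E.toeplitzK, fun x y => ?_, fun a ha => ⟨ha.2, ?_⟩⟩
    · change σ (E.toeplitzK _) = σ (E.toeplitzX x) * star (σ (E.toeplitzX y))
      rw [toeplitzK, E.isRepOn_toeplitz.compactRep_Θ, map_mul, map_star]
    · change σ (E.toeplitzK _) = σ (toeplitzπ E.L a)
      rw [eq_comm, ← sub_eq_zero, ← map_sub]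
      exact hσ _ (ClosedIdeal.subset_generatedBy _
        ⟨a, Set.mem_univ a, _, E.isRedundancy_toeplitzK ha.2, rfl⟩)
  -- `repHom c` involves an operator chosen as a limit, but on the Toeplitz algebra it is determined
  -- by the generators.
  have heq : ∀ y, E.repHom c y.1 = σ y := by
    refine cstarGenerated_hom_ext (φ := (E.repHom c).comp E.toeplitzIncl) ?_
    rintro _ (⟨a, rfl⟩ | ⟨a, rfl⟩)
    · exact E.repHom_π c a
    · refine (E.repHom_S c a).trans ?_
      change σ (E.toeplitzX (E.q a)) = _
      rw [toeplitzX_q]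
      rfl
  refine hσx ?_
  rw [← heq]
  exact congrArg (fun z : E.correspondence.CuntzPimsner => BoundedProd.eval
    (H := fun c : E.correspondence.CovRep E.correspondence.katsuraIdeal => c.1.H) ⟨c, hc⟩ z.1) hx

/-- The crossed product by `L` is the Cuntz-Pimsner algebra of `M_L` if `L` is almost faithful. -/
theorem exists_cuntzPimsner_equiv (h : AlmostFaithful E.L) :
    ∃ Ψ : CPCrossedProduct E.L ≃⋆ₐ[ℂ] E.correspondence.CuntzPimsner,
      (∀ a : A, Ψ (CPCrossedProduct.j E.L a) =
        CStarCorrespondence.CuntzPimsner.jA E.correspondence a) ∧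
      (∀ a : A, Ψ (CPCrossedProduct.js E.L a) =
        CStarCorrespondence.CuntzPimsner.jX E.correspondence (E.q a)) := by
  refine ⟨(cpIdeal E.L (annihilator (gnsKernel E.L))).quotientEquiv E.toeplitzToCuntzPimsner
    (fun x => ⟨fun hx => ?_, toeplitzToCuntzPimsner_eq_zero h⟩)
    E.toeplitzToCuntzPimsner_surjective, fun a => ?_, fun a => ?_⟩
  · rw [h.annihilator_gnsKernel]
    exact mem_cpIdeal_of_toeplitzToCuntzPimsner_eq_zero hx
  · exact Subtype.ext (E.cpToCov_π a)
  · exact Subtype.ext (E.cpToCov_S a)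

end ExelSystem

end Comparison

end ExelCrossed

end

/-! ### The proposition -/

open ExelCrossed in
theorem mainTheorem7 {A : Type u} [NonUnitalCStarAlgebra A] [PartialOrder A] [StarOrderedRing A]
    (E : ExelSystem A)
    (h : (AlmostFaithful E.L ∧ Nondegenerate E.α) ∨ (Faithful E.L ∧ Extendible E.α)) :
    (∃ Φ : E.CrossedProduct ≃⋆ₐ[ℂ] CPCrossedProduct E.L,
        (∀ a : A, Φ (E.j a) = CPCrossedProduct.j E.L a) ∧
        (∀ a : A, Φ (E.js a) = CPCrossedProduct.js E.L a)) ∧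
      (∃ Ψ : CPCrossedProduct E.L ≃⋆ₐ[ℂ] E.correspondence.CuntzPimsner,
        (∀ a : A, Ψ (CPCrossedProduct.j E.L a) =
          CStarCorrespondence.CuntzPimsner.jA E.correspondence a) ∧
        (∀ a : A, Ψ (CPCrossedProduct.js E.L a) =
          CStarCorrespondence.CuntzPimsner.jX E.correspondence (E.q a))) := by
  have hL : AlmostFaithful E.L := h.elim And.left fun h => h.1.almostFaithful
  have hα : E.rangeIdeal = Set.univ :=
    h.elim (fun h => h.2.rangeIdeal_eq) fun h => h.2.rangeIdeal_eq h.1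
  exact ⟨E.exists_exel_equiv hα hL.annihilator_gnsKernel, ExelSystem.exists_cuntzPimsner_equiv hL⟩
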